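/- Let $d\ge 1$ and write points of $\mathbb R^d$ as $x=(y,z)\in\mathbb R^{d-1}\times\mathbb R$. Let $\Lambda>0$, $0<\delta\le H$ and $1\le r<2$. Let $\zeta,f:[0,\infty)\times\mathbb R^d\to\mathbb R$ and $u:[0,\infty)\times\mathbb R^d\to\mathbb R^d$ be smooth, $\Lambda$-periodic in each coordinate of $y$ and $2H$-periodic in $z$, with $$\partial_t\zeta+u\cdot\nabla\zeta-\Delta\zeta=f,\qquad \operatorname{div}u=0,\qquad u=0\ \text{ at } z=0,$$ and with $\zeta(t,y,z)=0$ whenever $\delta<|z|\le H$. For $g\ge 0$ and $t_0>0$ put $$m_{t_0}(g)(z):=\frac1{t_0}\int_0^{t_0}\frac1{\Lambda^{d-1}}\int_{[0,\Lambda)^{d-1}}g(t,y,z)\,dy\,dt,\qquad \langle g\rangle(z):=\limsup_{t_0\to\infty}m_{t_0}(g)(z),$$ $$\mathcal A_a^b(g):=\limsup_{t_0\to\infty}\int_a^b m_{t_0}(g)(z)\,dz ,$$ with values in $[0,\infty]$. Gradients, Hessians and Jacobians are measured in the Euclidean (Frobenius) norm, and $0\cdot\infty:=0$. Then there is a constant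 $C$, depending only on $d$ (and not on $r,\Lambda,H,\delta,\zeta,u,f$), such that the following holds. (i) For all integers $M,N\ge 0$, $$\begin{aligned} \mathcal A_{-H}^{H}(|\nabla^2\zeta|^r)^{\frac1r}\le C\Big[\,&M\,\mathcal A_{-H}^{H}(|f|^r)^{\frac1r}+e^{-M}\mathcal A_{-H}^{H}(|\nabla f|^r)^{\frac1r}+\delta^{\frac{2-r}{2r}}\mathcal A_{-H}^{H}(\zeta^2)^{\frac12}\\ &+N\,\mathcal A_{-2\delta}^{2\delta}(|\nabla u|^2)^{\frac12}\,\mathcal A_{-H}^{H}\big(|\zeta|^{\frac{2r}{2-r}}\big)^{\frac{2-r}{2r}}\\ &+e^{-N}\mathcal A_{-H}^{H}(|\nabla u|^4)^{\frac14}\,\mathcal A_{-H}^{H}\big(|\nabla\zeta|^{\frac{4r}{4-r}}\big)^{\frac{4-r}{4r}}\Big], \end{aligned}$$ provided that neither of the two pairs of averages $\big(\mathcal A_{-2\delta}^{2\delta}(|\nabla u|^2),\mathcal A_{-H}^{H}(|\zeta|^{2r/(2-r)})\big)$ and $\big(\mathcal A_{-H}^{H}(|\nabla u|^4),\mathcal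 A_{-H}^{H}(|\nabla\zeta|^{4r/(4-r)})\big)$ consists of $0$ and $\infty$ (in particular whenever these averages are finite). (ii) The same estimate holds, for all integers $M,N\ge 0$ and with the same $C$, with every $\mathcal A_a^b(g)$ replaced by $\int_a^b\langle g\rangle\,dz$, if $\zeta,\nabla\zeta,\nabla u,f,\nabla f$ are bounded on $[0,\infty)\times\mathbb R^d$ and if, for almost every $z\in[-H,H]$, the upper limit defining $\langle|\nabla^2\zeta|^r\rangle(z)$ is a limit. -/

import Mathlib

open Set MeasureTheory Filter
open scoped ENNReal ContDiff

namespace ConvDiff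

/-- The space `ℝ^d` with `d = n + 1`; the first `n` coordinates are horizontal and the last one
is vertical. -/
abbrev Space (n : ℕ) : Type := EuclideanSpace ℝ (Fin (n + 1))

/-- The vertical coordinate `z` of a point. -/
def height {n : ℕ} (x : Space n) : ℝ := x (Fin.last n)

/-- The point `x = (y, z)` with horizontal part `y` and vertical coordinate `z`. -/
def point {n : ℕ} (y : Fin n → ℝ) (z : ℝ) : Space n :=
  WithLp.toLp 2 (Fin.snoc (α := fun _ => ℝ) y z)

/-- Smoothness on `[0, ∞) × ℝ^d`. -/
def IsSmooth {n : ℕ} {E : Type*} [NormedAddCommGroup E] [NormedSpace ℝ E]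
    (g : ℝ → Space n → E) : Prop :=
  ContDiffOn ℝ ∞ (fun p : ℝ × Space n => g p.1 p.2) (Ici 0 ×ˢ univ)

/-- Spatial periodicity, with period `Λ` in every horizontal direction and period `2 * H` in the
vertical direction. -/
def IsPeriodic {n : ℕ} {E : Type*} (Λ H : ℝ) (g : ℝ → Space n → E) : Prop :=
  ∀ t : ℝ, 0 ≤ t → ∀ x : Space n,
    (∀ i : Fin n, g t (x + EuclideanSpace.single i.castSucc Λ) = g t x) ∧
      g t (x + EuclideanSpace.single (Fin.last n) (2 * H)) = g t x

/-- The partial derivative `∂ᵢ g`. -/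
noncomputable def pd {n : ℕ} (i : Fin (n + 1)) (g : Space n → ℝ) (x : Space n) : ℝ :=
  fderiv ℝ g x (EuclideanSpace.single i 1)

/-- The Laplacian `Δ g`. -/
noncomputable def laplace {n : ℕ} (g : Space n → ℝ) (x : Space n) : ℝ :=
  ∑ i, pd i (pd i g) x

/-- The divergence of a vector field. -/
noncomputable def divergence {n : ℕ} (v : Space n → Space n) (x : Space n) : ℝ :=
  ∑ i, pd i (fun x' => v x' i) x

/-- The length `|∇ g|` of the gradient of a function. -/
noncomputable def gradNorm {n : ℕ} (g : Space n → ℝ) (x : Space n) : ℝ :=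
  Real.sqrt (∑ i, (pd i g x) ^ 2)

/-- The Euclidean (Frobenius) length `|∇² g|` of the Hessian of a function. -/
noncomputable def hessNorm {n : ℕ} (g : Space n → ℝ) (x : Space n) : ℝ :=
  Real.sqrt (∑ i, ∑ j, (pd i (pd j g) x) ^ 2)

/-- The Euclidean (Frobenius) length `|∇ v|` of the Jacobian of a vector field. -/
noncomputable def jacNorm {n : ℕ} (v : Space n → Space n) (x : Space n) : ℝ :=
  Real.sqrt (∑ i, ∑ j, (pd j (fun x' => v x' i) x) ^ 2)

/-- The average of a nonnegative function over the time interval `(0, t₀)` and over the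
horizontal cell of periodicity `[0, Λ)^n`, at height `z`. -/
noncomputable def partialMean {n : ℕ} (Λ t₀ : ℝ) (g : ℝ → Space n → ℝ) (z : ℝ) : ℝ≥0∞ :=
  (ENNReal.ofReal t₀)⁻¹ * ∫⁻ t in Ioc 0 t₀,
    (ENNReal.ofReal (Λ ^ n))⁻¹ *
      ∫⁻ y in Set.pi univ (fun _ : Fin n => Ico (0 : ℝ) Λ), ENNReal.ofReal (g t (point y z))

/-- The long-time and horizontal average `⟨g⟩` at height `z`. -/
noncomputable def longTimeMean {n : ℕ} (Λ : ℝ) (g : ℝ → Space n → ℝ) (z : ℝ) : ℝ≥0∞ :=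
  limsup (fun t₀ : ℝ => partialMean Λ t₀ g z) atTop

/-- The long-time average of the vertical integral over `[a, b]` of the horizontal averages:
`limsup_{t₀ → ∞} ∫_a^b (mean of g over (0, t₀) and the horizontal cell) dz`. -/
noncomputable def layerMean {n : ℕ} (Λ a b : ℝ) (g : ℝ → Space n → ℝ) : ℝ≥0∞ :=
  limsup (fun t₀ : ℝ => ∫⁻ z in Icc a b, partialMean Λ t₀ g z) atTop

/-- The vertical integral `∫_a^b ⟨g⟩ dz`, the upper limit in time being taken separately at each
height. -/
noncomputable def iteratedMean {n : ℕ} (Λ a b : ℝ) (g : ℝ → Space n → ℝ) : ℝ≥0∞ :=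
  ∫⁻ z in Icc a b, longTimeMean Λ g z

/-- The sum of the five terms on the right-hand side of the maximal regularity estimate. The
space-time average `A a b g` stands for `∫_a^b ⟨g⟩ dz` in either order of the upper limit and the
vertical integral. -/
noncomputable def rightHandSide {n : ℕ} (A : ℝ → ℝ → (ℝ → Space n → ℝ) → ℝ≥0∞)
    (H δ r : ℝ) (M N : ℕ) (ζ : ℝ → Space n → ℝ) (u : ℝ → Space n → Space n)
    (f : ℝ → Space n → ℝ) : ℝ≥0∞ :=
  (M : ℝ≥0∞) * (A (-H) H (fun t x => |f t x| ^ r)) ^ (1 / r)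
  + ENNReal.ofReal (Real.exp (-(M : ℝ))) *
      (A (-H) H (fun t x => gradNorm (f t) x ^ r)) ^ (1 / r)
  + ENNReal.ofReal (δ ^ ((2 - r) / (2 * r))) *
      (A (-H) H (fun t x => ζ t x ^ 2)) ^ (1 / 2 : ℝ)
  + (N : ℝ≥0∞) *
      ((A (-(2 * δ)) (2 * δ) (fun t x => jacNorm (u t) x ^ 2)) ^ (1 / 2 : ℝ) *
        (A (-H) H (fun t x => |ζ t x| ^ (2 * r / (2 - r)))) ^ ((2 - r) / (2 * r)))
  + ENNReal.ofReal (Real.exp (-(N : ℝ))) *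
      ((A (-H) H (fun t x => jacNorm (u t) x ^ 4)) ^ (1 / 4 : ℝ) *
        (A (-H) H (fun t x => gradNorm (ζ t) x ^ (4 * r / (4 - r)))) ^ ((4 - r) / (4 * r)))

/-- The product of `a` and `b` is not of the undefined form `0 · ∞`. -/
def ProductDefined (a b : ℝ≥0∞) : Prop :=
  (a ≠ 0 ∨ b ≠ ⊤) ∧ (a ≠ ⊤ ∨ b ≠ 0)

end ConvDiff

open scoped ENNReal ContDiff Pointwise

/-! ### Periodic functions: cells, translation invariance, tame space-time functions. -/

namespace ConvDiff

variable {n : ℕ}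

/-! The Hessian is reached by following a parabolic Gaussian average from scale 1 down to scale 0.
For a fixed pair i, j put W_σ(t,x) = ∫ e^{-|h|²/4} ∂_i∂_jζ(t-σ², x+σh) dh for 0 ≤ σ ≤ 1. At σ = 0
this is the Hessian entry times the mass of the Gaussian. At σ = 1 both derivatives can be moved to
the kernel (`smear_dir`), so W_1 is bounded by ζ in L^r, and Hölder on the support of ζ, of
thickness of order δ, turns this into the third term of the estimate.

Because the Gaussian is the heat kernel, ∂_σ W_σ is 2σ times the same average of (Δ-∂_t)∂_i∂_jζ =
∂_i∂_j(u·∇ζ - f) (`hasDerivAt_smear_scale`). Freezing the drift at (t-σ², x) splits this into a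
transport term 2σ u·∇W_σ, a commutator, and a forcing term. In d/dσ ∫|W_σ|^r the transport term
reduces, after integration by parts on a periodic cell, to a divergence term
(`integral_convection`).

Each remaining term has two bounds, depending on how many derivatives go to the kernel. The forcing
is controlled by ∇f and by f/σ. In the commutator the increments u(x+σh)-u(x) produce a factor σ|h|
and the Jacobian of u, which leaves |∇u||∇ζ| (Hölder with 4 and 4r/(4-r)) or |∇u||ζ|/σ (Hölder with
2 and 2r/(2-r)); see `Flow.mul_commTerm_eq` and `Flow.sq_mul_commTerm_eq`. Integrating min(b, a/σ)
over (0,1), with the choice switched at σ = e^{-M}, yields aM + be^{-M}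
(`rpow_inv_le_of_deriv_bound`). This is the origin of the logarithmic parameters M and N.

To see ∇u only in the strip |z| ≤ 2δ, the drift is replaced by v = ηu, where η is a periodic
vertical cutoff equal to 1 on the support of ζ. The equation is unchanged. The extra term η'u is
absorbed by a Poincaré inequality, since u vanishes at z = 0 (`nrm_strip_le_vertical_deriv`). The
field v is no longer solenoidal, but ζ div v = 0 is enough for the commutator, and the surviving
term 2σ W_σ div v obeys the same two bounds as the commutator.

The time shift σ² ≤ 1 costs only a passage from the interval [2,T] to [1,T], and the times before 2
contribute O(1/T) to the averages. Hence the estimate holds at every T > 2 up to an error that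
vanishes as T tends to infinity. Taking upper limits in T gives (i). For (ii), T runs through the
integers: the reverse Fatou lemma bounds the averages on the right, and Fatou's lemma together with
the assumed existence of the limit handles the Hessian. -/

/-- Periodicity with period `per i` in the `i`-th coordinate direction. -/
def CellPeriodic {α : Type*} (per : Fin (n + 1) → ℝ) (G : Space n → α) : Prop :=
  ∀ x i, G (x + EuclideanSpace.single i (per i)) = G x

/-- The half-open box with lower corner `a` and side lengths `per`. -/
def cell (a per : Fin (n + 1) → ℝ) : Set (Space n) := {x | ∀ i, x i ∈ Ico (a i) (a i + per i)}

/-- The basis of period vectors. -/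
noncomputable def periodBasis (per : Fin (n + 1) → ℝ) (h : ∀ i, 0 < per i) :
    Module.Basis (Fin (n + 1)) ℝ (Space n) :=
  (EuclideanSpace.basisFun (Fin (n + 1)) ℝ).toBasis.isUnitSMul
    (w := per) (fun i => (h i).ne'.isUnit)

theorem periodBasis_apply (per : Fin (n + 1) → ℝ) (h : ∀ i, 0 < per i) (i : Fin (n + 1)) :
    periodBasis per h i = EuclideanSpace.single i (per i) := by
  rw [periodBasis, Module.Basis.isUnitSMul_apply]
  ext j
  simp

theorem periodBasis_repr (per : Fin (n + 1) → ℝ) (h : ∀ i, 0 < per i) (x : Space n)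
    (i : Fin (n + 1)) : (periodBasis per h).repr x i = (per i)⁻¹ * x i := by
  simp only [periodBasis, Module.Basis.repr_isUnitSMul]
  simp [Units.smul_def]

theorem CellPeriodic.add_span {α : Type*} {per : Fin (n + 1) → ℝ} (h : ∀ i, 0 < per i)
    {G : Space n → α} (hG : CellPeriodic per G) {v : Space n}
    (hv : v ∈ Submodule.span ℤ (range (periodBasis per h))) (x : Space n) : G (x + v) = G x := by
  induction hv using Submodule.span_induction generalizing x with
  | mem v hv =>
    obtain ⟨i, rfl⟩ := hv
    rw [periodBasis_apply]; exact hG x i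
  | zero => simp
  | add v w _ _ hv hw => rw [← add_assoc, hw, hv]
  | smul m v _ hv =>
    have key : ∀ k : ℕ, ∀ x, G (x + (k : ℤ) • v) = G x := by
      intro k
      induction k with
      | zero => simp
      | succ k ih =>
        intro x
        rw [Nat.cast_succ, add_smul, one_smul, ← add_assoc, hv, ih]
    obtain ⟨k, rfl | rfl⟩ := m.eq_nat_or_neg
    · exact key k x
    · have := key k (x + (-(k : ℤ)) • v)
      rw [← this]; simp [add_assoc]

theorem cell_eq_vadd (a per : Fin (n + 1) → ℝ) (h : ∀ i, 0 < per i) :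
    cell a per = (WithLp.toLp 2 a : Space n) +ᵥ
    ZSpan.fundamentalDomain (periodBasis per h) := by
  ext x
  rw [Set.mem_vadd_set_iff_neg_vadd_mem, ZSpan.mem_fundamentalDomain]
  simp only [cell, Set.mem_ofPred_eq, periodBasis_repr, Set.mem_Ico]
  refine forall_congr' fun i => ?_
  have hi := h i
  have : (-(WithLp.toLp 2 a : Space n) +ᵥ x) i = x i - a i := by
    simp [vadd_eq_add]; ring
  rw [this, inv_mul_eq_div, le_div_iff₀ hi, div_lt_one hi]
  constructor <;> rintro ⟨h1, h2⟩ <;> constructor <;> linarith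

instance (per : Fin (n + 1) → ℝ) (h : ∀ i, 0 < per i) :
    Countable (Submodule.span ℤ (range (periodBasis per h))).toAddSubgroup :=
  inferInstanceAs (Countable (Submodule.span ℤ (range (periodBasis per h))))

/-- The corner is arbitrary: all boxes with these side lengths are fundamental domains of one and
the same lattice, so the integral of a periodic function does not depend on the box. Translation
invariance on a cell rests on this. -/
theorem isAddFundamentalDomain_cell (a per : Fin (n + 1) → ℝ) (h : ∀ i, 0 < per i) :
    IsAddFundamentalDomain (Submodule.span ℤ (range (periodBasis per h))).toAddSubgroup
      (cell a per) (volume : Measure (Space n)) := by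
  rw [cell_eq_vadd a per h]
  exact (ZSpan.isAddFundamentalDomain' (periodBasis per h) volume).vadd_of_comm
    (WithLp.toLp 2 a : Space n)

theorem measurableSet_cell (a per : Fin (n + 1) → ℝ) : MeasurableSet (cell a per) := by
  have : cell a per = ⋂ i, (fun x : Space n => x i) ⁻¹' Ico (a i) (a i + per i) := by
    ext x; simp [cell]
  rw [this]
  exact MeasurableSet.iInter fun i => measurableSet_Ico.preimage (by fun_prop)

theorem cell_preimage_sub (a per : Fin (n + 1) → ℝ) (y : Space n) :
    (fun x => x + y) ⁻¹' cell (fun i => a i + y i) per = cell a per := by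
  ext x
  simp only [cell, mem_preimage, mem_ofPred_eq, mem_Ico, PiLp.add_apply]
  refine forall_congr' fun i => ?_
  constructor <;> rintro ⟨h1, h2⟩ <;> constructor <;> linarith

theorem setLIntegral_cell_add {a per : Fin (n + 1) → ℝ} (h : ∀ i, 0 < per i)
    {G : Space n → ℝ≥0∞} (hG : CellPeriodic per G) (y : Space n) :
    ∫⁻ x in cell a per, G (x + y) = ∫⁻ x in cell a per, G x := by
  have hmp : MeasurePreserving (fun x : Space n => x + y) volume volume :=
    measurePreserving_add_right _ y
  rw [← cell_preimage_sub a per y, hmp.setLIntegral_comp_preimage_emb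
    (measurableEmbedding_addRight y), cell_preimage_sub]
  exact (isAddFundamentalDomain_cell _ per h).setLIntegral_eq (isAddFundamentalDomain_cell a per h)
    G (fun g x => by
      rw [AddSubgroup.vadd_def, vadd_eq_add, add_comm]; exact hG.add_span h g.2 x)

theorem setIntegral_cell_add {a per : Fin (n + 1) → ℝ} (h : ∀ i, 0 < per i)
    {G : Space n → ℝ} (hG : CellPeriodic per G) (y : Space n) :
    ∫ x in cell a per, G (x + y) = ∫ x in cell a per, G x := by
  have hmp : MeasurePreserving (fun x : Space n => x + y) volume volume :=
    measurePreserving_add_right _ y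
  rw [← cell_preimage_sub a per y, hmp.setIntegral_preimage_emb
    (measurableEmbedding_addRight y), cell_preimage_sub]
  exact (isAddFundamentalDomain_cell _ per h).setIntegral_eq (isAddFundamentalDomain_cell a per h)
    (fun g x => by
      rw [AddSubgroup.vadd_def, vadd_eq_add, add_comm]; exact hG.add_span h g.2 x)

theorem isBounded_cell (a per : Fin (n + 1) → ℝ) (h : ∀ i, 0 < per i) :
    Bornology.IsBounded (cell a per) := by
  rw [cell_eq_vadd a per h]
  exact (ZSpan.fundamentalDomain_isBounded (periodBasis per h)).vadd _

theorem volume_cell_lt_top (a per : Fin (n + 1) → ℝ) (h : ∀ i, 0 < per i) :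
    volume (cell a per) < ⊤ := (isBounded_cell a per h).measure_lt_top

theorem volume_cell_ne_zero (a per : Fin (n + 1) → ℝ) (h : ∀ i, 0 < per i) :
    volume (cell a per) ≠ 0 :=
  (isAddFundamentalDomain_cell a per h).measure_ne_zero (NeZero.ne volume)

/-- A smooth function on space-time which is periodic in space. -/
structure Tame (per : Fin (n + 1) → ℝ) (g : ℝ × Space n → ℝ) : Prop where
  smooth : ContDiff ℝ ∞ g
  periodic : ∀ t, CellPeriodic per fun x => g (t, x)

/-- The derivative in the direction `a`. -/
noncomputable def dir (a : ℝ × Space n) (g : ℝ × Space n → ℝ) (p : ℝ × Space n) : ℝ :=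
  fderiv ℝ g p a

/-- The direction of the `i`-th space coordinate. -/
noncomputable def sp (i : Fin (n + 1)) : ℝ × Space n := (0, EuclideanSpace.single i 1)

namespace Tame

variable {per : Fin (n + 1) → ℝ} {g g' : ℝ × Space n → ℝ}

theorem continuous (hg : Tame per g) : Continuous g := hg.smooth.continuous

theorem differentiable (hg : Tame per g) : Differentiable ℝ g :=
  hg.smooth.differentiable (by simp)

theorem const (c : ℝ) : Tame per (fun _ : ℝ × Space n => c) :=
  ⟨contDiff_const, fun _ _ _ => rfl⟩

theorem mul (hg : Tame per g) (hg' : Tame per g') : Tame per (fun p => g p * g' p) :=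
  ⟨hg.smooth.mul hg'.smooth, fun t x i => by
    have h1 := hg.periodic t x i; have h2 := hg'.periodic t x i; simp only at *; rw [h1, h2]⟩

theorem sub (hg : Tame per g) (hg' : Tame per g') : Tame per (fun p => g p - g' p) :=
  ⟨hg.smooth.sub hg'.smooth, fun t x i => by
    have h1 := hg.periodic t x i; have h2 := hg'.periodic t x i; simp only at *; rw [h1, h2]⟩

theorem sum {ι : Type*} (s : Finset ι) {G : ι → ℝ × Space n → ℝ} (hG : ∀ k, Tame per (G k)) :
    Tame per (fun p => ∑ k ∈ s, G k p) :=
  ⟨ContDiff.sum fun k _ => (hG k).smooth, fun t x i =>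
    Finset.sum_congr rfl fun k _ => (hG k).periodic t x i⟩

theorem dir (hg : Tame per g) (a : ℝ × Space n) : Tame per (dir a g) := by
  refine ⟨(hg.smooth.fderiv_right (m := ∞) (by simp)).clm_apply contDiff_const, fun t x i => ?_⟩
  have : g = fun p => g (p + (0, EuclideanSpace.single i (per i))) := by
    funext p
    have : g (p.1, p.2 + EuclideanSpace.single i (per i)) = g p := hg.periodic p.1 p.2 i
    rw [show p + (0, EuclideanSpace.single i (per i)) =
      (p.1, p.2 + EuclideanSpace.single i (per i)) by ext <;> simp, this]
  change fderiv ℝ g _ a = fderiv ℝ g (t, x) a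
  conv_rhs => rw [this, fderiv_comp_add_right]
  rw [Prod.mk_add_mk, add_zero]

/-- Reduction modulo the lattice brings the space variable into a bounded fundamental domain, and
continuity on a compact set does the rest. The bound is uniform over all of space and serves as the
domination under the Gaussian integrals. -/
theorem bounded (hper : ∀ i, 0 < per i) (hg : Tame per g) (T : ℝ) :
    ∃ K, 0 ≤ K ∧ ∀ t ∈ Icc (-T) T, ∀ x, |g (t, x)| ≤ K := by
  have hb : Bornology.IsBounded (ZSpan.fundamentalDomain (periodBasis per hper)) :=
    ZSpan.fundamentalDomain_isBounded _
  obtain ⟨R, hR⟩ := hb.subset_closedBall 0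
  obtain ⟨K, hK⟩ := ((isCompact_Icc (a := -T) (b := T)).prod
    (isCompact_closedBall (0 : Space n) R)).exists_bound_of_continuousOn hg.continuous.continuousOn
  refine ⟨max K 0, le_max_right _ _, fun t ht x => le_max_of_le_left ?_⟩
  have h1 : g (t, x) = g (t, ZSpan.fract (periodBasis per hper) x) := by
    have : g (t, ZSpan.fract (periodBasis per hper) x + ZSpan.floor (periodBasis per hper) x) =
        g (t, ZSpan.fract (periodBasis per hper) x) :=
      (hg.periodic t).add_span hper (ZSpan.floor (periodBasis per hper) x).2 _
    rw [← this, ZSpan.fract_apply]; simp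
  rw [h1]
  exact hK _ ⟨ht, hR (ZSpan.fract_mem_fundamentalDomain _ _)⟩

theorem dir_comm (hg : Tame per g) (a b : ℝ × Space n) :
    ConvDiff.dir a (ConvDiff.dir b g) = ConvDiff.dir b (ConvDiff.dir a g) := by
  funext p
  have hs := (hg.smooth.contDiffAt (x := p)).isSymmSndFDerivAt
      (by simpa using WithTop.coe_le_coe.2 (le_top : (2 : ℕ∞) ≤ ⊤))
  have hd : DifferentiableAt ℝ (fderiv ℝ g) p :=
    (hg.smooth.fderiv_right (m := ∞) (by simp)).differentiable (by simp) p
  have key : ∀ a b, ConvDiff.dir a (ConvDiff.dir b g) p = fderiv ℝ (fderiv ℝ g) p a b := by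
    intro a b
    unfold ConvDiff.dir
    rw [fderiv_clm_apply hd (differentiableAt_const _)]
    simp
  rw [key, key]
  exact hs a b

end Tame

end ConvDiff

/-! ### Gaussian kernels with polynomial factors and parabolic averages. -/

namespace ConvDiff

variable {n : ℕ}

/-- A polynomial multiple of the Gaussian `exp (-‖h‖² / 4)`. -/
noncomputable def gker (P : MvPolynomial (Fin (n + 1)) ℝ) (h : Space n) : ℝ :=
  MvPolynomial.eval h.ofLp P * Real.exp (-‖h‖ ^ 2 / 4)

/-- The polynomial factor of the `k`-th partial derivative of `gker P`. -/
noncomputable def gkerD (k : Fin (n + 1)) (P : MvPolynomial (Fin (n + 1)) ℝ) :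
    MvPolynomial (Fin (n + 1)) ℝ :=
  MvPolynomial.pderiv k P - MvPolynomial.C (1 / 2) * MvPolynomial.X k * P

theorem eval_differentiable_and_fderiv (P : MvPolynomial (Fin (n + 1)) ℝ) :
    Differentiable ℝ (fun h : Space n => MvPolynomial.eval h.ofLp P) ∧
      ∀ (k : Fin (n + 1)) (h : Space n), fderiv ℝ (fun h : Space n => MvPolynomial.eval h.ofLp P) h
        (EuclideanSpace.single k 1) = MvPolynomial.eval h.ofLp (MvPolynomial.pderiv k P) := by
  induction P using MvPolynomial.induction_on with
  | C a => simp
  | add p q hp hq =>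
    simp only [map_add]
    refine ⟨hp.1.add hq.1, fun k h => ?_⟩
    rw [fderiv_fun_add (hp.1 h) (hq.1 h), add_apply, hp.2, hq.2]
  | mul_X p i hp =>
    simp only [map_mul, MvPolynomial.eval_X]
    have hX : Differentiable ℝ (fun h : Space n => h i) := by fun_prop
    refine ⟨hp.1.mul hX, fun k h => ?_⟩
    have hXd : fderiv ℝ (fun h : Space n => h i) h = (EuclideanSpace.proj i : Space n →L[ℝ] ℝ) :=
      (EuclideanSpace.proj i : Space n →L[ℝ] ℝ).hasFDerivAt.fderiv
    rw [fderiv_fun_mul (hp.1 h) (hX h), hXd]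
    simp only [add_apply, smul_apply, hp.2,
      Derivation.leibniz, MvPolynomial.pderiv_X, map_add, smul_eq_mul, map_mul,
      MvPolynomial.eval_X]
    by_cases hik : i = k
    · subst hik; simp
    · simp [hik]

theorem differentiable_exp_norm :
    Differentiable ℝ (fun h : Space n => Real.exp (-‖h‖ ^ 2 / 4)) := by
  have : Differentiable ℝ (fun h : Space n => ‖h‖ ^ 2) :=
    (contDiff_norm_sq ℝ (n := 1)).differentiable (by simp)
  fun_prop

theorem differentiable_gker (P : MvPolynomial (Fin (n + 1)) ℝ) : Differentiable ℝ (gker P) :=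
  (eval_differentiable_and_fderiv P).1.mul differentiable_exp_norm

theorem continuous_gker (P : MvPolynomial (Fin (n + 1)) ℝ) : Continuous (gker P) :=
  (differentiable_gker P).continuous

/-- Polynomial multiples of the Gaussian are closed under differentiation. Kernels are indexed by
polynomials so that up to three derivatives can be moved onto them without leaving the class. -/
theorem fderiv_gker (P : MvPolynomial (Fin (n + 1)) ℝ) (k : Fin (n + 1)) (h : Space n) :
    fderiv ℝ (gker P) h (EuclideanSpace.single k 1) = gker (gkerD k P) h := by
  have hP := eval_differentiable_and_fderiv P
  have he : HasFDerivAt (fun h : Space n => Real.exp (-‖h‖ ^ 2 / 4))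
      (Real.exp (-‖h‖ ^ 2 / 4) • (-(1 / 4 : ℝ)) • (2 • (innerSL ℝ h))) h := by
    have h1 : HasFDerivAt (fun h : Space n => ‖h‖ ^ 2) (2 • (innerSL ℝ h)) h :=
      (hasStrictFDerivAt_norm_sq h).hasFDerivAt
    have h2 := (h1.const_mul (-(1 / 4 : ℝ))).exp
    have e : ∀ x : Space n, -‖x‖ ^ 2 / 4 = -(1 / 4 : ℝ) * ‖x‖ ^ 2 := fun x => by ring
    simpa only [e] using h2
  have : gker P = fun h => MvPolynomial.eval h.ofLp P * Real.exp (-‖h‖ ^ 2 / 4) := rfl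
  rw [this, fderiv_fun_mul (hP.1 h) he.differentiableAt, he.fderiv]
  simp only [add_apply, smul_apply, hP.2, gker, gkerD,
    map_sub, map_mul, MvPolynomial.eval_C, MvPolynomial.eval_X, smul_eq_mul, innerSL_apply_apply,
    EuclideanSpace.inner_single_right, nsmul_eq_mul]
  simp
  ring

theorem one_add_norm_le_exp {ε : ℝ} (hε : 0 < ε) (x : ℝ) :
    1 + x ≤ Real.exp (1 / (4 * ε)) * Real.exp (ε * x ^ 2) := by
  rw [← Real.exp_add]
  have h1 : 1 + x ≤ Real.exp x := by linarith [Real.add_one_le_exp x]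
  refine h1.trans (Real.exp_le_exp.2 ?_)
  have h2 : 0 ≤ (2 * ε * x - 1) ^ 2 / (4 * ε) := by positivity
  have h3 : (2 * ε * x - 1) ^ 2 / (4 * ε) = 1 / (4 * ε) + ε * x ^ 2 - x := by field_simp; ring
  linarith

/-- The rate ε is quantified inside the induction because each new variable factor spends half of
it: the polynomial built so far and the linear factor each take ε/2. -/
theorem eval_le_exp (P : MvPolynomial (Fin (n + 1)) ℝ) : ∀ ε : ℝ, 0 < ε → ∃ C : ℝ, 0 ≤ C ∧
    ∀ h : Space n, |MvPolynomial.eval h.ofLp P| ≤ C * Real.exp (ε * ‖h‖ ^ 2) := by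
  induction P using MvPolynomial.induction_on with
  | C a =>
    refine fun ε hε => ⟨|a|, abs_nonneg _, fun h => ?_⟩
    rw [MvPolynomial.eval_C]
    exact le_mul_of_one_le_right (abs_nonneg _) (Real.one_le_exp (by positivity))
  | add p q hp hq =>
    intro ε hε
    obtain ⟨A, hA, hA'⟩ := hp ε hε
    obtain ⟨B, hB, hB'⟩ := hq ε hε
    refine ⟨A + B, by positivity, fun h => ?_⟩
    rw [map_add, add_mul]
    exact (abs_add_le _ _).trans (add_le_add (hA' h) (hB' h))
  | mul_X p i hp =>
    intro ε hε
    obtain ⟨A, hA, hA'⟩ := hp (ε / 2) (by positivity)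
    refine ⟨A * Real.exp (1 / (4 * (ε / 2))), by positivity, fun h => ?_⟩
    rw [map_mul, abs_mul, MvPolynomial.eval_X]
    have h1 : |h i| ≤ ‖h‖ := PiLp.norm_apply_le h i
    have h2 := one_add_norm_le_exp (ε := ε / 2) (by positivity) ‖h‖
    calc _ ≤ (A * Real.exp (ε / 2 * ‖h‖ ^ 2)) *
          (Real.exp (1 / (4 * (ε / 2))) * Real.exp (ε / 2 * ‖h‖ ^ 2)) :=
          mul_le_mul (hA' h) (by linarith) (abs_nonneg _) (by positivity)
      _ = A * Real.exp (1 / (4 * (ε / 2))) *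
          (Real.exp (ε / 2 * ‖h‖ ^ 2) * Real.exp (ε / 2 * ‖h‖ ^ 2)) := by ring
      _ = _ := by rw [← Real.exp_add]; ring_nf

theorem integrable_exp_neg_mul_norm_sq {b : ℝ} (hb : 0 < b) :
    Integrable (fun h : Space n => Real.exp (-b * ‖h‖ ^ 2)) := by
  have h1 := (GaussianFourier.integrable_cexp_neg_mul_sq_norm_add (V := Space n) (b := (b : ℂ))
    (by simpa using hb) 0 0).norm
  refine h1.congr (Eventually.of_forall fun h => ?_)
  simp [Complex.norm_exp]
  left
  norm_cast

/-- The weight ‖h‖ occurs twice later: in the term h·∇g when the average is differentiated in the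
scale, and in the increment of the drift over the distance σ‖h‖. -/
theorem integrable_one_add_norm_mul_gker (P : MvPolynomial (Fin (n + 1)) ℝ) :
    Integrable (fun h : Space n => (1 + ‖h‖) * |gker P h|) := by
  -- The polynomial and the weight each cost 1/16 of the exponent, leaving 1/4 - 1/8 = 1/8.
  obtain ⟨A, hA, hA'⟩ := eval_le_exp P (1 / 16) (by norm_num)
  refine ((integrable_exp_neg_mul_norm_sq (n := n) (b := 1 / 8) (by norm_num)).const_mul
    (Real.exp (1 / (4 * (1 / 16))) * A)).mono'
    ((by fun_prop : Continuous fun h : Space n => 1 + ‖h‖).mul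
      (continuous_gker P).abs).aestronglyMeasurable (Eventually.of_forall fun h => ?_)
  have h2 := one_add_norm_le_exp (ε := 1 / 16) (by norm_num) ‖h‖
  rw [Real.norm_of_nonneg (by positivity), gker, abs_mul, Real.abs_exp]
  calc _ ≤ (Real.exp (1 / (4 * (1 / 16))) * Real.exp (1 / 16 * ‖h‖ ^ 2)) *
        (A * Real.exp (1 / 16 * ‖h‖ ^ 2) * Real.exp (-‖h‖ ^ 2 / 4)) := by
        gcongr; exact hA' h
    _ = Real.exp (1 / (4 * (1 / 16))) * A * (Real.exp (1 / 16 * ‖h‖ ^ 2) *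
        Real.exp (1 / 16 * ‖h‖ ^ 2) * Real.exp (-‖h‖ ^ 2 / 4)) := by ring
    _ = _ := by rw [← Real.exp_add, ← Real.exp_add]; ring_nf

theorem integrable_gker (P : MvPolynomial (Fin (n + 1)) ℝ) : Integrable (gker P) := by
  refine (integrable_one_add_norm_mul_gker P).mono' (continuous_gker P).aestronglyMeasurable
    (Eventually.of_forall fun h => ?_)
  rw [Real.norm_eq_abs]
  exact le_mul_of_one_le_left (abs_nonneg _) (by linarith [norm_nonneg h])

/-- The average of `g` at time `t - σ²` around `x` at scale `σ`, with weight `κ`. -/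
noncomputable def smear (κ : Space n → ℝ) (g : ℝ × Space n → ℝ) (σ t : ℝ) (x : Space n) : ℝ :=
  ∫ h, κ h * g (t - σ ^ 2, x + σ • h)

section smear

variable {per : Fin (n + 1) → ℝ} {g g' : ℝ × Space n → ℝ} (P : MvPolynomial (Fin (n + 1)) ℝ)

theorem Tame.integrable_smear (hper : ∀ i, 0 < per i) (hg : Tame per g) (σ t : ℝ) (x : Space n) :
    Integrable (fun h => gker P h * g (t - σ ^ 2, x + σ • h)) := by
  obtain ⟨K, hK, hb⟩ := hg.bounded hper |t - σ ^ 2|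
  have hc := hg.continuous
  exact (integrable_gker P).mul_bdd (c := K) (by fun_prop)
    (Eventually.of_forall fun h => hb _ ⟨neg_abs_le _, le_abs_self _⟩ _)

theorem smear_sub (hper : ∀ i, 0 < per i) (hg : Tame per g) (hg' : Tame per g') (σ t : ℝ)
    (x : Space n) : smear (gker P) (fun p => g p - g' p) σ t x =
      smear (gker P) g σ t x - smear (gker P) g' σ t x := by
  unfold smear
  rw [← integral_sub (hg.integrable_smear P hper σ t x) (hg'.integrable_smear P hper σ t x)]
  simp only [mul_sub]

theorem smear_sum (hper : ∀ i, 0 < per i) {ι : Type*} (s : Finset ι) {G : ι → ℝ × Space n → ℝ}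
    (hG : ∀ k, Tame per (G k)) (σ t : ℝ) (x : Space n) :
    smear (gker P) (fun p => ∑ k ∈ s, G k p) σ t x = ∑ k ∈ s, smear (gker P) (G k) σ t x := by
  unfold smear
  rw [← integral_finsetSum _ fun k _ => (hG k).integrable_smear P hper σ t x]
  simp only [Finset.mul_sum]

theorem smear_const_mul (κ : Space n → ℝ) (g : ℝ × Space n → ℝ) (c σ t : ℝ) (x : Space n) :
    smear κ (fun p => c * g p) σ t x = c * smear κ g σ t x := by
  unfold smear
  rw [← integral_const_mul]
  congr 1; funext h; ring

theorem smear_zero (κ : Space n → ℝ) (g : ℝ × Space n → ℝ) (t : ℝ) (x : Space n) :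
    smear κ g 0 t x = (∫ h, κ h) * g (t, x) := by
  simp [smear, integral_mul_const]

theorem Tame.fderiv_scaled (hg : Tame per g) (s σ : ℝ) (x h : Space n) (k : Fin (n + 1)) :
    fderiv ℝ (fun h => g (s, x + σ • h)) h (EuclideanSpace.single k 1) =
      σ * ConvDiff.dir (sp k) g (s, x + σ • h) := by
  have h1 : HasFDerivAt (fun h : Space n => ((s, x + σ • h) : ℝ × Space n))
      ((0 : Space n →L[ℝ] ℝ).prod (σ • ContinuousLinearMap.id ℝ (Space n))) h :=
    (hasFDerivAt_const s h).prodMk (((hasFDerivAt_id h).const_smul σ).const_add x)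
  have h2 := ((hg.differentiable (s, x + σ • h)).hasFDerivAt.comp h h1).fderiv
  change fderiv ℝ (g ∘ fun h : Space n => ((s, x + σ • h) : ℝ × Space n)) h _ = _
  rw [h2]
  simp only [ContinuousLinearMap.comp_apply, ContinuousLinearMap.prod_apply, ConvDiff.dir, sp]
  rw [← smul_eq_mul, ← map_smul]
  simp

/-- Integration by parts in h. The chain rule for x + σh supplies the factor σ, so each derivative
moved from the function to the kernel costs one power of 1/σ. -/
theorem smear_dir (hper : ∀ i, 0 < per i) (hg : Tame per g) (k : Fin (n + 1)) (σ t : ℝ)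
    (x : Space n) :
    σ * smear (gker P) (dir (sp k) g) σ t x = - smear (gker (gkerD k P)) g σ t x := by
  have hd : Differentiable ℝ (fun h : Space n => g (t - σ ^ 2, x + σ • h)) :=
    hg.differentiable.comp (by fun_prop)
  have := integral_mul_fderiv_eq_neg_fderiv_mul_of_integrable (μ := (volume : Measure (Space n)))
    (f := gker P) (g := fun h => g (t - σ ^ 2, x + σ • h)) (v := EuclideanSpace.single k 1)
    (by simpa only [fderiv_gker] using hg.integrable_smear _ hper σ t x)
    (by
      simp only [hg.fderiv_scaled]
      refine (((hg.dir (sp k)).integrable_smear P hper σ t x).const_mul σ).congr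
        (Eventually.of_forall fun h => ?_)
      simp only; ring)
    (hg.integrable_smear _ hper σ t x) (fun h _ => differentiable_gker P h) (fun h _ => hd h)
  simp only [fderiv_gker, hg.fderiv_scaled] at this
  rw [smear, smear, ← this, ← integral_const_mul]
  congr 1; funext h; ring

theorem continuous_smear (hper : ∀ i, 0 < per i) (hg : Tame per g) :
    Continuous (fun q : ℝ × ℝ × Space n => smear (gker P) g q.1 q.2.1 q.2.2) := by
  refine continuous_iff_continuousAt.2 fun q₀ => ?_
  have hc := hg.continuous
  obtain ⟨K, hK, hb⟩ := hg.bounded hper (|q₀.2.1 - q₀.1 ^ 2| + 1)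
  refine continuousAt_of_dominated (bound := fun h => |gker P h| * K)
    (Eventually.of_forall fun q => ((continuous_gker P).mul (by fun_prop)).aestronglyMeasurable)
    ?_ ((integrable_gker P).abs.mul_const K) (Eventually.of_forall fun h => by fun_prop)
  have hcont : Continuous fun q : ℝ × ℝ × Space n => |q.2.1 - q.1 ^ 2| := by fun_prop
  filter_upwards [hcont.continuousAt.eventually_lt_const (lt_add_one |q₀.2.1 - q₀.1 ^ 2|)] with q hq
  refine Eventually.of_forall fun h => ?_
  rw [Real.norm_eq_abs, abs_mul]
  refine mul_le_mul_of_nonneg_left (hb _ (abs_le.1 hq.le) _) (abs_nonneg _)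

theorem hasDerivAt_smear_space (hper : ∀ i, 0 < per i) (hg : Tame per g) (k : Fin (n + 1))
    (σ t : ℝ) (x : Space n) (τ : ℝ) :
    HasDerivAt (fun τ : ℝ => smear (gker P) g σ t (x + EuclideanSpace.single k τ))
      (smear (gker P) (dir (sp k) g) σ t (x + EuclideanSpace.single k τ)) τ := by
  have hc := hg.continuous
  have hc' := (hg.dir (sp k)).continuous
  have hcg := continuous_gker P
  obtain ⟨K, hK, hb⟩ := (hg.dir (sp k)).bounded hper |t - σ ^ 2|
  refine (hasDerivAt_integral_of_dominated_loc_of_deriv_le (s := univ) univ_mem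
    (bound := fun h => |gker P h| * K)
    (F' := fun τ h => gker P h * dir (sp k) g (t - σ ^ 2, x + EuclideanSpace.single k τ + σ • h))
    (Eventually.of_forall fun τ => ?_) (hg.integrable_smear P hper _ _ _)
    ?_ ?_ ((integrable_gker P).abs.mul_const K) ?_).2
  · exact (hg.integrable_smear P hper _ _ _).aestronglyMeasurable
  · exact ((hg.dir (sp k)).integrable_smear P hper _ _ _).aestronglyMeasurable
  · refine Eventually.of_forall fun h τ _ => ?_
    rw [Real.norm_eq_abs, abs_mul]
    exact mul_le_mul_of_nonneg_left (hb _ ⟨neg_abs_le _, le_abs_self _⟩ _) (abs_nonneg _)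
  · refine Eventually.of_forall fun h τ _ => ?_
    refine HasDerivAt.const_mul _ ?_
    have h1 : HasDerivAt (fun τ : ℝ => ((t - σ ^ 2, x + EuclideanSpace.single k τ + σ • h) :
        ℝ × Space n)) (sp k) τ := by
      have h2 : HasDerivAt (fun τ : ℝ => (EuclideanSpace.single k τ : Space n))
          (EuclideanSpace.single k 1) τ := by
        have : (fun τ : ℝ => (EuclideanSpace.single k τ : Space n)) =
            fun τ => τ • EuclideanSpace.single k 1 := by
          funext τ; ext j; simp
        rw [this]
        simpa using (hasDerivAt_id τ).smul_const (EuclideanSpace.single k (1 : ℝ) : Space n)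
      exact (hasDerivAt_const τ _).prodMk ((h2.const_add x).add_const _)
    exact (hg.differentiable _).hasFDerivAt.comp_hasDerivAt τ h1

/-- The spatial Laplacian minus the time derivative. -/
noncomputable def heatOp (g : ℝ × Space n → ℝ) (p : ℝ × Space n) : ℝ :=
  (∑ k, dir (sp k) (dir (sp k) g) p) - dir (1, 0) g p

theorem space_eq_sum (h : Space n) : h = ∑ k, h k • EuclideanSpace.single k (1 : ℝ) := by
  ext j; simp [Pi.single_apply]

theorem dir_space (g : ℝ × Space n → ℝ) (p : ℝ × Space n) (h : Space n) :
    fderiv ℝ g p (0, h) = ∑ k, h k * dir (sp k) g p := by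
  have : ((0, h) : ℝ × Space n) = ∑ k, h k • sp k := by
    refine Prod.ext ?_ ?_
    · simp [sp, Prod.fst_sum]
    · rw [Prod.snd_sum]; simpa [sp] using space_eq_sum h
  rw [this, map_sum]
  simp [dir]

/-- This is the heat equation in disguise. Differentiating g(t-σ², x+σh) gives -2σ∂_t g + h·∇g, and
since h_k e^{-|h|²/4} is -2 times the k-th derivative of the Gaussian, integration by parts turns
h·∇g into 2σΔg. -/
theorem hasDerivAt_smear_scale (hper : ∀ i, 0 < per i) (hg : Tame per g) (σ t : ℝ)
    (x : Space n) :
    HasDerivAt (fun σ : ℝ => smear (gker 1) g σ t x)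
      (2 * σ * smear (gker 1) (heatOp g) σ t x) σ := by
  have hcg := continuous_gker (n := n) 1
  have hDs := hg.dir (1, 0)
  choose K hK hb using fun k => (hg.dir (sp k)).bounded hper (|t| + (|σ| + 1) ^ 2)
  obtain ⟨K₀, hK₀, hb₀⟩ := hDs.bounded hper (|t| + (|σ| + 1) ^ 2)
  let F' : ℝ → Space n → ℝ := fun σ h => gker 1 h *
    (-(2 * σ) * dir (1, 0) g (t - σ ^ 2, x + σ • h) +
      ∑ k, h k * dir (sp k) g (t - σ ^ 2, x + σ • h))
  have hF'c : ∀ σ, Continuous (F' σ) := fun σ => by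
    refine hcg.mul ((hDs.continuous.comp (by fun_prop)).const_mul _ |>.add
      (continuous_finsetSum _ fun k _ => ?_))
    exact (by fun_prop : Continuous fun h : Space n => h k).mul
      ((hg.dir (sp k)).continuous.comp (by fun_prop))
  have hmain := (hasDerivAt_integral_of_dominated_loc_of_deriv_le
    (F := fun σ h => gker 1 h * g (t - σ ^ 2, x + σ • h)) (x₀ := σ) (μ := volume)
    (s := Metric.ball σ 1) (Metric.ball_mem_nhds _ one_pos)
    (bound := fun h => ((1 + ‖h‖) * |gker 1 h|) * (2 * (|σ| + 1) * K₀ + ∑ k, K k)) (F' := F')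
    (Eventually.of_forall fun σ => (hg.integrable_smear 1 hper _ _ _).aestronglyMeasurable)
    (hg.integrable_smear 1 hper _ _ _) (hF'c σ).aestronglyMeasurable ?_
    ((integrable_one_add_norm_mul_gker 1).mul_const _) ?_).2
  · have hval : ∫ h, F' σ h = 2 * σ * smear (gker 1) (heatOp g) σ t x := by
      -- The factor `h k` times the Gaussian equals -2 times `gker (gkerD k 1)`, so `smear_dir`
      -- applies and produces the second derivative in direction k.
      have hk : ∀ k, ∫ h, gker 1 h * (h k * dir (sp k) g (t - σ ^ 2, x + σ • h)) =
          2 * (σ * smear (gker 1) (dir (sp k) (dir (sp k) g)) σ t x) := fun k => by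
        rw [smear_dir 1 hper (hg.dir (sp k)), smear, ← integral_neg, ← integral_const_mul]
        congr 1; funext h
        simp [gker, gkerD]; ring
      have hi1 : Integrable (fun h => gker 1 h * (-(2 * σ) *
          dir (1, 0) g (t - σ ^ 2, x + σ • h))) := by
        refine ((hDs.integrable_smear 1 hper σ t x).const_mul (-(2 * σ))).congr
          (Eventually.of_forall fun h => ?_)
        simp only; ring
      have hi2 : ∀ k, Integrable
          (fun h => gker 1 h * (h k * dir (sp k) g (t - σ ^ 2, x + σ • h))) := fun k => by
        refine (((hg.dir (sp k)).integrable_smear (gkerD k 1) hper σ t x).const_mul (-2)).congr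
          (Eventually.of_forall fun h => ?_)
        simp [gker, gkerD]; ring
      simp only [F', mul_add, Finset.mul_sum]
      rw [integral_add hi1 (integrable_finsetSum _ fun k _ => hi2 k),
        integral_finsetSum _ fun k _ => hi2 k]
      simp only [hk]
      have : smear (gker 1) (heatOp g) σ t x =
          ∑ k, smear (gker 1) (dir (sp k) (dir (sp k) g)) σ t x -
            smear (gker 1) (dir (1, 0) g) σ t x := by
        rw [← smear_sum 1 hper _ fun k => (hg.dir (sp k)).dir (sp k)]
        exact smear_sub 1 hper (Tame.sum _ fun k => (hg.dir (sp k)).dir (sp k)) hDs σ t x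
      rw [this, mul_sub, Finset.mul_sum]
      have h3 : ∫ h, gker 1 h * (-(2 * σ) * dir (1, 0) g (t - σ ^ 2, x + σ • h)) =
          -(2 * σ) * smear (gker 1) (dir (1, 0) g) σ t x := by
        rw [smear, ← integral_const_mul]
        congr 1; funext h; ring
      rw [h3]
      have : ∑ k, 2 * (σ * smear (gker 1) (dir (sp k) (dir (sp k) g)) σ t x) =
        ∑ k, 2 * σ * smear (gker 1) (dir (sp k) (dir (sp k) g)) σ t x :=
        Finset.sum_congr rfl fun k _ => by ring
      rw [this]; ring
    rw [← hval]
    exact hmain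
  · refine Eventually.of_forall fun h s hs => ?_
    have hs1 : |s| ≤ |σ| + 1 := by
      rw [Metric.mem_ball, Real.dist_eq] at hs
      have := abs_sub_abs_le_abs_sub s σ
      linarith
    have hs2 : t - s ^ 2 ∈ Icc (-(|t| + (|σ| + 1) ^ 2)) (|t| + (|σ| + 1) ^ 2) := by
      have : s ^ 2 ≤ (|σ| + 1) ^ 2 := by
        rw [← sq_abs s]; gcongr
      constructor
      · linarith [neg_abs_le t]
      · linarith [le_abs_self t, sq_nonneg s, sq_nonneg (|σ| + 1)]
    rw [Real.norm_eq_abs, abs_mul, mul_comm, mul_comm (1 + ‖h‖), mul_assoc |gker 1 h|, mul_comm |gker 1 h|]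
    gcongr
    refine (abs_add_le _ _).trans ?_
    have e1 : |-(2 * s) * dir (1, 0) g (t - s ^ 2, x + s • h)| ≤ 2 * (|σ| + 1) * K₀ := by
      rw [abs_mul, abs_neg, abs_mul, abs_two]
      exact mul_le_mul (by linarith) (hb₀ _ hs2 _) (abs_nonneg _) (by positivity)
    have e2 : |∑ k, h k * dir (sp k) g (t - s ^ 2, x + s • h)| ≤ ‖h‖ * ∑ k, K k := by
      rw [Finset.mul_sum]
      refine (Finset.abs_sum_le_sum_abs _ _).trans (Finset.sum_le_sum fun k _ => ?_)
      rw [abs_mul]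
      exact mul_le_mul (PiLp.norm_apply_le h k) (hb k _ hs2 _) (abs_nonneg _) (norm_nonneg _)
    have e3 : 0 ≤ ∑ k, K k := Finset.sum_nonneg fun k _ => hK k
    have e4 : 0 ≤ 2 * (|σ| + 1) * K₀ := by positivity
    nlinarith [norm_nonneg h, mul_nonneg (norm_nonneg h) e4]
  · refine Eventually.of_forall fun h s _ => ?_
    refine HasDerivAt.const_mul _ ?_
    have h1 : HasDerivAt (fun s : ℝ => ((t - s ^ 2, x + s • h) : ℝ × Space n))
        (-(2 * s), h) s := by
      have ha : HasDerivAt (fun s : ℝ => t - s ^ 2) (-(2 * s)) s := by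
        simpa using (hasDerivAt_pow 2 s).const_sub t
      have hbd : HasDerivAt (fun s : ℝ => x + s • h) h s := by
        simpa using ((hasDerivAt_id s).smul_const h).const_add x
      exact ha.prodMk hbd
    have h2 := (hg.differentiable _).hasFDerivAt.comp_hasDerivAt s h1
    convert! h2 using 1
    rw [← dir_space]
    have : ((-(2 * s), h) : ℝ × Space n) = (-(2 * s)) • ((1, 0) : ℝ × Space n) + (0, h) := by
      ext <;> simp
    rw [this, map_add, map_smul]
    simp [dir]

end smear

end ConvDiff

/-! ### L^p inequalities for nonnegative functions and for averages on space-time slabs. -/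

namespace ConvDiff

section nrm

variable {α β : Type*} [MeasurableSpace α] [MeasurableSpace β]

/-- The `L^p` norm of a nonnegative function. -/
noncomputable def nrm (p : ℝ) (μ : Measure α) (G : α → ℝ≥0∞) : ℝ≥0∞ :=
  (∫⁻ x, G x ^ p ∂μ) ^ (1 / p)

variable {μ : Measure α} {p q r : ℝ} {F G : α → ℝ≥0∞}

theorem nrm_mono_ae (hp : 0 < p) (h : ∀ᵐ x ∂μ, F x ≤ G x) : nrm p μ F ≤ nrm p μ G :=
  ENNReal.rpow_le_rpow (lintegral_mono_ae (h.mono fun _ hx => ENNReal.rpow_le_rpow hx hp.le))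
    (by positivity)

theorem nrm_mono (hp : 0 < p) (h : ∀ x, F x ≤ G x) : nrm p μ F ≤ nrm p μ G :=
  nrm_mono_ae hp (Eventually.of_forall h)

theorem nrm_rpow (hp : 0 < p) : nrm p μ G ^ p = ∫⁻ x, G x ^ p ∂μ := by
  rw [nrm, ← ENNReal.rpow_mul, one_div_mul_cancel hp.ne', ENNReal.rpow_one]

theorem nrm_add_le (hp : 1 ≤ p) (hF : AEMeasurable F μ) (hG : AEMeasurable G μ) :
    nrm p μ (fun x => F x + G x) ≤ nrm p μ F + nrm p μ G :=
  ENNReal.lintegral_Lp_add_le hF hG hp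

theorem nrm_sum_le {ι : Type*} (hp : 1 ≤ p) (s : Finset ι) {F : ι → α → ℝ≥0∞}
    (hF : ∀ i, Measurable (F i)) :
    nrm p μ (fun x => ∑ i ∈ s, F i x) ≤ ∑ i ∈ s, nrm p μ (F i) := by
  classical
  induction s using Finset.induction_on with
  | empty => simp [nrm, ENNReal.zero_rpow_of_pos (zero_lt_one.trans_le hp),
      ENNReal.zero_rpow_of_pos (inv_pos.2 (zero_lt_one.trans_le hp))]
  | insert i s hi ih =>
    simp only [Finset.sum_insert hi]
    exact (nrm_add_le hp (hF i).aemeasurable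
      (Finset.measurable_sum _ fun k _ => hF k).aemeasurable).trans (by gcongr)

theorem nrm_const_mul (hp : 0 < p) (c : ℝ≥0∞) (hG : AEMeasurable G μ) :
    nrm p μ (fun x => c * G x) = c * nrm p μ G := by
  simp only [nrm, ENNReal.mul_rpow_of_nonneg _ _ hp.le]
  rw [lintegral_const_mul'' _ (hG.pow_const _), ENNReal.mul_rpow_of_nonneg _ _ (by positivity),
    ← ENNReal.rpow_mul, mul_one_div_cancel hp.ne', ENNReal.rpow_one]

theorem nrm_mul_le (hp : 0 < p) (hq : 0 < q) (hr : 0 < r) (h : 1 / r = 1 / p + 1 / q)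
    (hF : AEMeasurable F μ) (hG : AEMeasurable G μ) :
    nrm r μ (fun x => F x * G x) ≤ nrm p μ F * nrm q μ G := by
  have hH := ENNReal.lintegral_mul_norm_pow_le (μ := μ) (hF.pow_const p) (hG.pow_const q)
    (p := r / p) (q := r / q) (by positivity) (by positivity) (by field_simp at h ⊢; linarith)
  simp only [← ENNReal.rpow_mul, mul_div_cancel₀ _ hp.ne', mul_div_cancel₀ _ hq.ne'] at hH
  have := ENNReal.rpow_le_rpow hH (z := 1 / r) (by positivity)
  rw [ENNReal.mul_rpow_of_nonneg _ _ (by positivity), ← ENNReal.rpow_mul, ← ENNReal.rpow_mul] at this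
  simp only [nrm, ENNReal.mul_rpow_of_nonneg _ _ hr.le]
  convert this using 3 <;> field_simp

/-- Jensen's inequality for powers. -/
theorem lintegral_rpow_le {α : Type*} [MeasurableSpace α] {μ : Measure α} {p : ℝ} (hp : 1 ≤ p)
    {F : α → ℝ≥0∞} (hF : AEMeasurable F μ) :
    (∫⁻ x, F x ∂μ) ^ p ≤ μ univ ^ (p - 1) * ∫⁻ x, F x ^ p ∂μ := by
  have hp0 : 0 < p := by linarith
  have hH := ENNReal.lintegral_mul_norm_pow_le (μ := μ) (f := fun _ => 1) (by fun_prop)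
    (hF.pow_const p) (p := 1 - 1 / p) (q := 1 / p)
    (by rw [sub_nonneg]; exact (div_le_one hp0).2 hp) (by positivity) (by ring)
  simp only [← ENNReal.rpow_mul, mul_one_div_cancel hp0.ne', ENNReal.rpow_one, one_mul,
    ENNReal.one_rpow, lintegral_one] at hH
  have := ENNReal.rpow_le_rpow hH hp0.le
  rw [ENNReal.mul_rpow_of_nonneg _ _ hp0.le, ← ENNReal.rpow_mul, ← ENNReal.rpow_mul,
    one_div_mul_cancel hp0.ne', ENNReal.rpow_one] at this
  convert this using 3
  field_simp

/-- Minkowski's integral inequality for a family of uniformly bounded norms. -/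
theorem nrm_lintegral_le {X : Type*} [MeasurableSpace X] {m : Measure X} [SFinite m] [SFinite μ]
    (hr : 1 ≤ r) {G : X → α → ℝ≥0∞} (hG : Measurable (Function.uncurry G)) {B : ℝ≥0∞}
    (hB : ∀ x, nrm r μ (G x) ≤ B) :
    nrm r μ (fun a => ∫⁻ x, G x a ∂m) ≤ m univ * B := by
  have hr0 : 0 < r := zero_lt_one.trans_le hr
  have h1 : ∀ a, (∫⁻ x, G x a ∂m) ^ r ≤ m univ ^ (r - 1) * ∫⁻ x, G x a ^ r ∂m := fun a =>
    lintegral_rpow_le hr hG.of_uncurry_right.aemeasurable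
  have h2 : ∫⁻ a, (∫⁻ x, G x a ∂m) ^ r ∂μ ≤ (m univ * B) ^ r := by
    calc _ ≤ ∫⁻ a, m univ ^ (r - 1) * ∫⁻ x, G x a ^ r ∂m ∂μ := lintegral_mono h1
      _ = m univ ^ (r - 1) * ∫⁻ a, ∫⁻ x, G x a ^ r ∂m ∂μ := by
        refine lintegral_const_mul _ ?_
        exact Measurable.lintegral_prod_left' (f := fun z : X × α => G z.1 z.2 ^ r)
          (hG.pow_const r)
      _ = m univ ^ (r - 1) * ∫⁻ x, ∫⁻ a, G x a ^ r ∂μ ∂m := by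
        rw [lintegral_lintegral_swap]
        exact ((hG.comp measurable_swap).pow_const r).aemeasurable
      _ ≤ m univ ^ (r - 1) * ∫⁻ _, B ^ r ∂m := by
        gcongr with x
        rw [← nrm_rpow hr0]
        exact ENNReal.rpow_le_rpow (hB x) hr0.le
      _ = (m univ * B) ^ r := by
        rw [lintegral_const, ENNReal.mul_rpow_of_nonneg _ _ hr0.le, mul_comm (B ^ r), ← mul_assoc]
        congr 1
        conv_lhs => rw [← ENNReal.rpow_one (m univ), ← ENNReal.rpow_mul]
        rw [← ENNReal.rpow_add_of_nonneg _ _ (by simpa using hr) (by norm_num)]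
        congr 1; ring
  calc _ ≤ ((m univ * B) ^ r) ^ (1 / r) := ENNReal.rpow_le_rpow h2 (by positivity)
    _ = _ := by rw [← ENNReal.rpow_mul, mul_one_div_cancel hr0.ne', ENNReal.rpow_one]

end nrm

variable {n : ℕ}

/-- A multiple of Lebesgue measure on the product of the time interval `[s, T]` and a cell. -/
noncomputable def slab (c : NNReal) (a per : Fin (n + 1) → ℝ) (s T : ℝ) :
    Measure (ℝ × Space n) :=
  (c • volume.restrict (Icc s T)).prod (volume.restrict (cell a per))

instance (c : NNReal) (a per : Fin (n + 1) → ℝ) (s T : ℝ) : SFinite (slab c a per s T) := by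
  unfold slab; infer_instance

theorem isFiniteMeasure_slab (c : NNReal) {a per : Fin (n + 1) → ℝ} (hper : ∀ i, 0 < per i)
    (s T : ℝ) : IsFiniteMeasure (slab c a per s T) := by
  have : Fact (volume (cell a per) < ⊤) := ⟨volume_cell_lt_top a per hper⟩
  unfold slab; infer_instance

/-- A nonnegative measurable function on space-time which is periodic in space. -/
structure TameE (per : Fin (n + 1) → ℝ) (G : ℝ × Space n → ℝ≥0∞) : Prop where
  measurable : Measurable G
  periodic : ∀ t, CellPeriodic per fun x => G (t, x)

variable {c : NNReal} {a per : Fin (n + 1) → ℝ} {T : ℝ} {F G : ℝ × Space n → ℝ≥0∞}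

theorem Tame.tameE {g : ℝ × Space n → ℝ} (hg : Tame per g) :
    TameE per fun p => ENNReal.ofReal |g p| :=
  ⟨by have := hg.continuous; fun_prop, fun t x i => by
    have : g (t, x + EuclideanSpace.single i (per i)) = g (t, x) := hg.periodic t x i
    simp only [this]⟩

theorem TameE.rpow (hG : TameE per G) (p : ℝ) : TameE per fun x => G x ^ p :=
  ⟨hG.measurable.pow_const p, fun t x i => congrArg (· ^ p) (hG.periodic t x i)⟩

theorem TameE.sum {ι : Type*} (s : Finset ι) {F : ι → ℝ × Space n → ℝ≥0∞}
    (hF : ∀ k, TameE per (F k)) : TameE per fun p => ∑ k ∈ s, F k p :=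
  ⟨Finset.measurable_sum _ fun k _ => (hF k).measurable, fun t x i =>
    Finset.sum_congr rfl fun k _ => (hF k).periodic t x i⟩

/-- The space shift is invisible by periodicity. The time shift maps [2,T] to [2-s,T-s], which lies
in [1,T]; this is the only loss caused by the parabolic averages. -/
theorem lintegral_slab_shift (hper : ∀ i, 0 < per i) (hG : TameE per G) {s : ℝ}
    (hs : s ∈ Icc (0 : ℝ) 1) (y : Space n) :
    ∫⁻ p, G (p.1 - s, p.2 + y) ∂slab c a per 2 T ≤ ∫⁻ p, G p ∂slab c a per 1 T := by
  have hm := hG.measurable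
  unfold slab
  rw [lintegral_prod _ (by fun_prop), lintegral_prod _ (by fun_prop)]
  simp only
  have h1 : ∀ t, ∫⁻ x in cell a per, G (t - s, x + y) = ∫⁻ x in cell a per, G (t - s, x) :=
    fun t => setLIntegral_cell_add hper (hG.periodic (t - s)) y
  simp only [h1]
  set φ : ℝ → ℝ≥0∞ := fun t => ∫⁻ x in cell a per, G (t, x)
  change ∫⁻ t, φ (t - s) ∂_ ≤ ∫⁻ t, φ t ∂_
  rw [lintegral_smul_measure, lintegral_smul_measure]
  refine smul_le_smul_of_nonneg_left ?_ zero_le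
  have h2 : Icc 2 T = (fun t => t - s) ⁻¹' Icc (2 - s) (T - s) := by
    ext t; simp
  rw [h2, (measurePreserving_sub_right (volume : Measure ℝ) s).setLIntegral_comp_preimage_emb
    (MeasurableEquiv.subRight s).measurableEmbedding]
  exact lintegral_mono_set (Icc_subset_Icc (by linarith [hs.2]) (by linarith [hs.1]))

theorem nrm_slab_shift (hper : ∀ i, 0 < per i) (hG : TameE per G) {r : ℝ} (hr : 0 < r) {s : ℝ}
    (hs : s ∈ Icc (0 : ℝ) 1) (y : Space n) :
    nrm r (slab c a per 2 T) (fun p => G (p.1 - s, p.2 + y)) ≤ nrm r (slab c a per 1 T) G :=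
  ENNReal.rpow_le_rpow (lintegral_slab_shift hper (hG.rpow r) hs y) (by positivity)

theorem sq_mem_unit {σ : ℝ} (hσ : σ ∈ Icc (0 : ℝ) 1) : σ ^ 2 ∈ Icc (0 : ℝ) 1 :=
  ⟨sq_nonneg _, pow_le_one₀ hσ.1 hσ.2⟩

/-- Minkowski's integral inequality with respect to the measure with density κ. -/
theorem nrm_weighted_le {μ : Measure (ℝ × Space n)} [SFinite μ] {r : ℝ} (hr : 1 ≤ r)
    {κ : Space n → ℝ≥0∞} (hκ : Measurable κ) {G : Space n → ℝ × Space n → ℝ≥0∞}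
    (hG : Measurable (Function.uncurry G)) {B : ℝ≥0∞} (hB : ∀ h, nrm r μ (G h) ≤ B) :
    nrm r μ (fun p => ∫⁻ h, κ h * G h p) ≤ (∫⁻ h, κ h) * B := by
  have := nrm_lintegral_le (m := volume.withDensity κ) (μ := μ) hr hG hB
  rw [withDensity_apply _ MeasurableSet.univ, Measure.restrict_univ] at this
  convert this using 3
  rw [lintegral_withDensity_eq_lintegral_mul _ hκ hG.of_uncurry_right]
  rfl

theorem nrm_smear_le (hper : ∀ i, 0 < per i) (hG : TameE per G) {r : ℝ} (hr : 1 ≤ r)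
    {κ : Space n → ℝ≥0∞} (hκ : Measurable κ) {σ : ℝ} (hσ : σ ∈ Icc (0 : ℝ) 1) :
    nrm r (slab c a per 2 T) (fun p => ∫⁻ h, κ h * G (p.1 - σ ^ 2, p.2 + σ • h)) ≤
      (∫⁻ h, κ h) * nrm r (slab c a per 1 T) G := by
  have hm := hG.measurable
  refine nrm_weighted_le hr hκ (G := fun h p => G (p.1 - σ ^ 2, p.2 + σ • h)) ?_ fun h =>
    nrm_slab_shift hper hG (by linarith) (sq_mem_unit hσ) _
  exact hm.comp (by fun_prop)

/-- For fixed h and θ, Hölder separates the two factors and the shift bound removes their different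
translations. The result does not depend on h or θ, so integrating over them contributes only the
mass of κ. -/
theorem nrm_smear_bilinear_le (hper : ∀ i, 0 < per i) (hF : TameE per F) (hG : TameE per G)
    {p q r : ℝ} (hp : 0 < p) (hq : 0 < q) (hr : 1 ≤ r) (hpq : 1 / r = 1 / p + 1 / q)
    {κ : Space n → ℝ≥0∞} (hκ : Measurable κ) {σ : ℝ} (hσ : σ ∈ Icc (0 : ℝ) 1) :
    nrm r (slab c a per 2 T) (fun x => ∫⁻ h, κ h * ∫⁻ θ in Icc (0 : ℝ) 1,
      F (x.1 - σ ^ 2, x.2 + (θ * σ) • h) * G (x.1 - σ ^ 2, x.2 + σ • h)) ≤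
      (∫⁻ h, κ h) * (nrm p (slab c a per 1 T) F * nrm q (slab c a per 1 T) G) := by
  have hmF := hF.measurable
  have hmG := hG.measurable
  have hF' : Measurable fun z : (ℝ × Space n × ℝ × Space n) =>
      F (z.2.2.1 - σ ^ 2, z.2.2.2 + (z.1 * σ) • z.2.1) := hmF.comp (by fun_prop)
  have hG' : Measurable fun z : (ℝ × Space n × ℝ × Space n) =>
      G (z.2.2.1 - σ ^ 2, z.2.2.2 + σ • z.2.1) := hmG.comp (by fun_prop)
  refine nrm_weighted_le hr hκ (G := fun h x => ∫⁻ θ in Icc (0 : ℝ) 1,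
      F (x.1 - σ ^ 2, x.2 + (θ * σ) • h) * G (x.1 - σ ^ 2, x.2 + σ • h)) ?_ fun h => ?_
  · exact Measurable.lintegral_prod_left' (μ := volume.restrict (Icc (0 : ℝ) 1)) (hF'.mul hG')
  · have hsec : Measurable fun z : ℝ × ℝ × Space n => ((z.1, h, z.2) : ℝ × Space n × ℝ × Space n) :=
      by fun_prop
    have := nrm_lintegral_le (m := volume.restrict (Icc (0 : ℝ) 1)) (μ := slab c a per 2 T) hr
      (G := fun θ x => F (x.1 - σ ^ 2, x.2 + (θ * σ) • h) * G (x.1 - σ ^ 2, x.2 + σ • h))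
      (B := nrm p (slab c a per 1 T) F * nrm q (slab c a per 1 T) G)
      ((hF'.mul hG').comp hsec) fun θ => ?_
    · simpa using this
    · refine (nrm_mul_le hp hq (by linarith) hpq
        (hmF.comp (by fun_prop)).aemeasurable (hmG.comp (by fun_prop)).aemeasurable).trans ?_
      exact mul_le_mul' (nrm_slab_shift hper hF hp (sq_mem_unit hσ) _)
        (nrm_slab_shift hper hG hq (sq_mem_unit hσ) _)

end ConvDiff

/-! ### The equation along scales: forcing term and commutator. -/

namespace ConvDiff

variable {n : ℕ} {per a : Fin (n + 1) → ℝ} {c : NNReal} {T : ℝ}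

/-- The total mass of a Gaussian kernel with weight `1 + ‖h‖`. -/
noncomputable def mass (P : MvPolynomial (Fin (n + 1)) ℝ) : ℝ≥0∞ :=
  ∫⁻ h : Space n, ENNReal.ofReal ((1 + ‖h‖) * |gker P h|)

theorem mass_ne_top (P : MvPolynomial (Fin (n + 1)) ℝ) : mass P ≠ ⊤ := by
  have := (integrable_one_add_norm_mul_gker P).lintegral_lt_top
  exact this.ne

theorem ofReal_abs_smear_le (P : MvPolynomial (Fin (n + 1)) ℝ) (g : ℝ × Space n → ℝ) (σ t : ℝ)
    (x : Space n) : ENNReal.ofReal |smear (gker P) g σ t x| ≤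
      ∫⁻ h, ENNReal.ofReal |gker P h| * ENNReal.ofReal |g (t - σ ^ 2, x + σ • h)| := by
  have := enorm_integral_le_lintegral_enorm (μ := (volume : Measure (Space n)))
    (fun h => gker P h * g (t - σ ^ 2, x + σ • h))
  simpa only [smear, ← Real.enorm_eq_ofReal_abs, enorm_mul] using this

theorem lintegral_gker_le_mass (P : MvPolynomial (Fin (n + 1)) ℝ) :
    ∫⁻ h, ENNReal.ofReal |gker P h| ≤ mass P :=
  lintegral_mono fun h => ENNReal.ofReal_le_ofReal
    (le_mul_of_one_le_left (abs_nonneg _) (by linarith [norm_nonneg h]))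

theorem lintegral_norm_gker_le_mass (P : MvPolynomial (Fin (n + 1)) ℝ) :
    ∫⁻ h : Space n, ENNReal.ofReal (‖h‖ * |gker P h|) ≤ mass P :=
  lintegral_mono fun h => ENNReal.ofReal_le_ofReal
    (mul_le_mul_of_nonneg_right (by linarith) (abs_nonneg _))

theorem nrm_abs_smear_le (hper : ∀ i, 0 < per i) {g : ℝ × Space n → ℝ} (hg : Tame per g)
    (P : MvPolynomial (Fin (n + 1)) ℝ) {r : ℝ} (hr : 1 ≤ r) {σ : ℝ} (hσ : σ ∈ Icc (0 : ℝ) 1) :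
    nrm r (slab c a per 2 T) (fun p => ENNReal.ofReal |smear (gker P) g σ p.1 p.2|) ≤
      mass P * nrm r (slab c a per 1 T) (fun p => ENNReal.ofReal |g p|) := by
  have hc := continuous_gker P
  refine (nrm_mono (by linarith) fun p : ℝ × Space n =>
    ofReal_abs_smear_le P g σ p.1 p.2).trans ?_
  refine (nrm_smear_le hper hg.tameE hr (κ := fun h => ENNReal.ofReal |gker P h|)
    (by fun_prop) hσ).trans ?_
  gcongr
  exact lintegral_gker_le_mass P

theorem smear_dir_dir (hper : ∀ i, 0 < per i) {g : ℝ × Space n → ℝ} (hg : Tame per g)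
    (i j : Fin (n + 1)) (P : MvPolynomial (Fin (n + 1)) ℝ) (σ t : ℝ) (x : Space n) :
    σ ^ 2 * smear (gker P) (dir (sp i) (dir (sp j) g)) σ t x =
      smear (gker (gkerD j (gkerD i P))) g σ t x := by
  have h1 := smear_dir P hper (hg.dir (sp j)) i σ t x
  have h2 := smear_dir (gkerD i P) hper hg j σ t x
  linear_combination σ * h1 - h2

theorem dir_sub {g g' : ℝ × Space n → ℝ} (hg : Tame per g) (hg' : Tame per g')
    (b : ℝ × Space n) : dir b (fun p => g p - g' p) = fun p => dir b g p - dir b g' p := by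
  funext p
  simp only [dir]
  rw [fderiv_fun_sub (hg.differentiable p) (hg'.differentiable p)]
  rfl

theorem dir_sum {ι : Type*} (s : Finset ι) {G : ι → ℝ × Space n → ℝ} (hG : ∀ k, Tame per (G k))
    (b : ℝ × Space n) : dir b (fun p => ∑ k ∈ s, G k p) = fun p => ∑ k ∈ s, dir b (G k) p := by
  funext p
  simp only [dir]
  rw [fderiv_fun_sum fun k _ => (hG k).differentiable p]
  simp

theorem dir_mul {g g' : ℝ × Space n → ℝ} (hg : Tame per g) (hg' : Tame per g')
    (b p : ℝ × Space n) : dir b (fun p => g p * g' p) p = g p * dir b g' p + dir b g p * g' p := by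
  simp only [dir]
  rw [fderiv_fun_mul (hg.differentiable p) (hg'.differentiable p)]
  simp [mul_comm]

theorem heatOp_dir {g : ℝ × Space n → ℝ} (hg : Tame per g) (b : ℝ × Space n) :
    heatOp (dir b g) = dir b (heatOp g) := by
  have h1 : heatOp g = fun p => (∑ k, dir (sp k) (dir (sp k) g) p) - dir (1, 0) g p := rfl
  rw [h1, dir_sub (Tame.sum _ fun k => (hg.dir (sp k)).dir (sp k)) (hg.dir (1, 0)),
    dir_sum _ fun k => (hg.dir (sp k)).dir (sp k)]
  funext p
  simp only [heatOp]
  congr 1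
  · refine Finset.sum_congr rfl fun k _ => ?_
    rw [hg.dir_comm (sp k) b, (hg.dir (sp k)).dir_comm (sp k) b]
  · rw [hg.dir_comm]

/-- Late times form an open set, so an identity valid there can be differentiated repeatedly. This
transfers the equation, which is known only for times above 1/2, to its second derivatives. -/
theorem dir_congr {g g' : ℝ × Space n → ℝ} {s : ℝ}
    (h : ∀ p : ℝ × Space n, s < p.1 → g p = g' p) (b : ℝ × Space n) :
    ∀ p : ℝ × Space n, s < p.1 → dir b g p = dir b g' p := by
  intro p hp
  have : g =ᶠ[nhds p] g' := by
    filter_upwards [(continuous_fst.continuousAt (x := p)).eventually_const_lt hp] with q hq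
    exact h q hq
  simp only [dir, this.fderiv_eq]

/-- The total size of the first derivatives of a vector field. -/
noncomputable def jacSum (v : Fin (n + 1) → ℝ × Space n → ℝ) (p : ℝ × Space n) : ℝ≥0∞ :=
  ∑ k, ∑ j, ENNReal.ofReal |dir (sp j) (v k) p|

/-- The total size of the first derivatives of a function. -/
noncomputable def gradSum (g : ℝ × Space n → ℝ) (p : ℝ × Space n) : ℝ≥0∞ :=
  ∑ k, ENNReal.ofReal |dir (sp k) g p|

theorem tameE_jacSum {v : Fin (n + 1) → ℝ × Space n → ℝ} (hv : ∀ k, Tame per (v k)) :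
    TameE per (jacSum v) :=
  TameE.sum _ fun k => TameE.sum _ fun j => ((hv k).dir (sp j)).tameE

theorem tameE_gradSum {g : ℝ × Space n → ℝ} (hg : Tame per g) : TameE per (gradSum g) :=
  TameE.sum _ fun k => (hg.dir (sp k)).tameE

/-- The fundamental theorem of calculus along the segment from x to x + σh. Keeping the integral
over the segment, rather than a supremum of the gradient, is what makes L^p bounds possible. -/
theorem ofReal_abs_increment_le {g : ℝ × Space n → ℝ} (hg : Tame per g) (s : ℝ) (x h : Space n)
    {σ : ℝ} (hσ : 0 ≤ σ) :
    ENNReal.ofReal |g (s, x + σ • h) - g (s, x)| ≤ ENNReal.ofReal (σ * ‖h‖) *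
      ∫⁻ θ in Icc (0 : ℝ) 1, gradSum g (s, x + (θ * σ) • h) := by
  have hd : ∀ θ : ℝ, HasDerivAt (fun θ : ℝ => g (s, x + (θ * σ) • h))
      (∑ k, (σ * h k) * dir (sp k) g (s, x + (θ * σ) • h)) θ := fun θ => by
    have h1 : HasDerivAt (fun θ : ℝ => ((s, x + (θ * σ) • h) : ℝ × Space n)) (0, σ • h) θ := by
      have : HasDerivAt (fun θ : ℝ => θ * σ) σ θ := by
        simpa using (hasDerivAt_id θ).mul_const σ
      exact (hasDerivAt_const θ s).prodMk ((this.smul_const h).const_add x)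
    have h2 := (hg.differentiable _).hasFDerivAt.comp_hasDerivAt θ h1
    rw [dir_space] at h2
    simpa only [PiLp.smul_apply, smul_eq_mul] using! h2
  have hc : Continuous fun θ : ℝ => ∑ k, (σ * h k) * dir (sp k) g (s, x + (θ * σ) • h) :=
    continuous_finsetSum _ fun k _ => continuous_const.mul
      ((hg.dir (sp k)).continuous.comp (by fun_prop))
  have hftc := intervalIntegral.integral_eq_sub_of_hasDerivAt (a := 0) (b := 1)
    (fun θ _ => hd θ) (hc.intervalIntegrable _ _)
  simp only [one_mul, zero_mul, zero_smul, add_zero] at hftc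
  rw [← hftc, intervalIntegral.integral_of_le zero_le_one, ← Real.enorm_eq_ofReal_abs]
  refine (enorm_integral_le_lintegral_enorm _).trans ?_
  rw [setLIntegral_congr Ioc_ae_eq_Icc, ← lintegral_const_mul' _ _ ENNReal.ofReal_ne_top]
  refine lintegral_mono fun θ => ?_
  simp only [gradSum, Real.enorm_eq_ofReal_abs]
  rw [Finset.mul_sum]
  refine (ENNReal.ofReal_le_ofReal (Finset.abs_sum_le_sum_abs _ _)).trans ?_
  rw [ENNReal.ofReal_sum_of_nonneg fun _ _ => abs_nonneg _]
  refine Finset.sum_le_sum fun k _ => ?_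
  rw [← ENNReal.ofReal_mul (by positivity), abs_mul, abs_mul, abs_of_nonneg hσ]
  gcongr
  exact PiLp.norm_apply_le h k

/-- A convection-diffusion equation, valid for times larger than `1 / 2`, with smooth periodic data
on the whole of space-time. -/
structure Flow (per : Fin (n + 1) → ℝ) (ζ f : ℝ × Space n → ℝ)
    (v : Fin (n + 1) → ℝ × Space n → ℝ) : Prop where
  tame_sol : Tame per ζ
  tame_force : Tame per f
  tame_vel : ∀ k, Tame per (v k)
  equation : ∀ p, 1 / 2 < p.1 → heatOp ζ p = (∑ k, v k p * dir (sp k) ζ p) - f p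
  div_mul : ∀ p, (∑ k, dir (sp k) (v k) p) * ζ p = 0

section Flow

variable {ζ f : ℝ × Space n → ℝ} {v : Fin (n + 1) → ℝ × Space n → ℝ}

/-- The contribution of the forcing to the evolution in scale. -/
noncomputable def forceTerm (f : ℝ × Space n → ℝ) (i j : Fin (n + 1)) (σ t : ℝ) (x : Space n) : ℝ :=
  2 * σ * smear (gker 1) (dir (sp i) (dir (sp j) f)) σ t x

/-- The commutator of the smoothing with the convection. -/
noncomputable def commTerm (ζ : ℝ × Space n → ℝ) (v : Fin (n + 1) → ℝ × Space n → ℝ)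
    (i j : Fin (n + 1)) (σ t : ℝ) (x : Space n) : ℝ :=
  2 * σ * smear (gker 1) (dir (sp i) (dir (sp j) fun p => ∑ k, v k p * dir (sp k) ζ p)) σ t x -
    2 * σ * ∑ k, v k (t - σ ^ 2, x) *
      smear (gker 1) (dir (sp k) (dir (sp i) (dir (sp j) ζ))) σ t x

theorem Flow.tame_adv (hF : Flow per ζ f v) : Tame per fun p => ∑ k, v k p * dir (sp k) ζ p :=
  Tame.sum _ fun k => (hF.tame_vel k).mul (hF.tame_sol.dir (sp k))

/-- The drift is frozen at the centre of the average, so the convective part is exactly a transport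
of W_σ and all the rest goes into the commutator. The restrictions on σ and t keep the shifted time
t - σ² at or above 1, where the equation holds. -/
theorem Flow.hasDerivAt_smear (hF : Flow per ζ f v) (hper : ∀ i, 0 < per i) (i j : Fin (n + 1))
    {σ t : ℝ} (hσ : σ ∈ Icc (0 : ℝ) 1) (ht : 2 ≤ t) (x : Space n) :
    HasDerivAt (fun σ => smear (gker 1) (dir (sp i) (dir (sp j) ζ)) σ t x)
      (2 * σ * ∑ k, v k (t - σ ^ 2, x) *
        smear (gker 1) (dir (sp k) (dir (sp i) (dir (sp j) ζ))) σ t x +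
        commTerm ζ v i j σ t x - forceTerm f i j σ t x) σ := by
  have h := hasDerivAt_smear_scale hper ((hF.tame_sol.dir (sp j)).dir (sp i)) σ t x
  convert! h using 1
  have hs := (sq_mem_unit hσ).2
  have hA := hF.tame_adv
  have h1 : smear (gker 1) (heatOp (dir (sp i) (dir (sp j) ζ))) σ t x =
      smear (gker 1) (dir (sp i) (dir (sp j) fun p => (∑ k, v k p * dir (sp k) ζ p) - f p))
        σ t x := by
    rw [heatOp_dir (hF.tame_sol.dir (sp j)), heatOp_dir hF.tame_sol]
    unfold smear
    congr 1
    funext h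
    rw [dir_congr (dir_congr hF.equation (sp j)) (sp i) _ (by simp only; linarith)]
  rw [h1, dir_sub hA hF.tame_force, dir_sub (hA.dir _) (hF.tame_force.dir _),
    smear_sub 1 hper ((hA.dir _).dir _) ((hF.tame_force.dir _).dir _)]
  simp only [commTerm, forceTerm]
  ring

/-- One derivative moved to the kernel uses up the prefactor σ, so the bound by ∇f does not
degenerate as σ tends to 0. The next lemma moves both derivatives and pays 1/σ to reach f itself. -/
theorem forceTerm_eq (hper : ∀ i, 0 < per i) (hf : Tame per f) (i j : Fin (n + 1)) (σ t : ℝ)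
    (x : Space n) : forceTerm f i j σ t x = -2 * smear (gker (gkerD i 1)) (dir (sp j) f) σ t x := by
  have := smear_dir 1 hper (hf.dir (sp j)) i σ t x
  simp only [forceTerm]
  linear_combination 2 * this

theorem mul_forceTerm_eq (hper : ∀ i, 0 < per i) (hf : Tame per f) (i j : Fin (n + 1)) (σ t : ℝ)
    (x : Space n) :
    σ * forceTerm f i j σ t x = 2 * smear (gker (gkerD j (gkerD i 1))) f σ t x := by
  have := smear_dir_dir hper hf i j 1 σ t x
  simp only [forceTerm]
  linear_combination 2 * this

/-- The frozen drift is constant under the averaging integral, so it passes inside, and moving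
∂_i∂_j to the kernel leaves only increments of the drift against ∇ζ. -/
theorem Flow.mul_commTerm_eq (hF : Flow per ζ f v) (hper : ∀ i, 0 < per i) (i j : Fin (n + 1))
    (σ t : ℝ) (x : Space n) :
    σ * commTerm ζ v i j σ t x = 2 * smear (gker (gkerD j (gkerD i 1)))
      (fun p => ∑ k, (v k p - v k (t - σ ^ 2, x)) * dir (sp k) ζ p) σ t x := by
  have hA := hF.tame_adv
  have h1 := smear_dir_dir hper hA i j 1 σ t x
  have h2 : ∀ k, smear (gker 1) (dir (sp k) (dir (sp i) (dir (sp j) ζ))) σ t x =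
      smear (gker 1) (dir (sp i) (dir (sp j) (dir (sp k) ζ))) σ t x := fun k => by
    rw [(hF.tame_sol.dir _).dir_comm (sp k) (sp i), hF.tame_sol.dir_comm (sp k) (sp j)]
  have h3 := fun k => smear_dir_dir hper (hF.tame_sol.dir (sp k)) i j 1 σ t x
  have h4 : (fun p => ∑ k, (v k p - v k (t - σ ^ 2, x)) * dir (sp k) ζ p) = fun p =>
      (∑ k, v k p * dir (sp k) ζ p) - ∑ k, v k (t - σ ^ 2, x) * dir (sp k) ζ p := by
    funext p
    simp only [sub_mul, Finset.sum_sub_distrib]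
  have h5 : ∀ k, Tame per fun p => v k (t - σ ^ 2, x) * dir (sp k) ζ p := fun k =>
    (Tame.const _).mul (hF.tame_sol.dir (sp k))
  rw [h4, smear_sub _ hper hA (Tame.sum _ h5), smear_sum _ hper _ h5]
  simp only [commTerm, smear_const_mul, h2, ← h3, ← h1, Finset.mul_sum, mul_sub]
  congr 1
  · ring
  · refine Finset.sum_congr rfl fun k _ => by ring

/-- One more integration by parts removes the derivative from ζ. It needs the increment times ∇ζ to
be in divergence form, which follows from ζ div v = 0; the drift itself need not be solenoidal. -/
theorem Flow.sq_mul_commTerm_eq (hF : Flow per ζ f v) (hper : ∀ i, 0 < per i) (i j : Fin (n + 1))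
    (σ t : ℝ) (x : Space n) :
    σ ^ 2 * commTerm ζ v i j σ t x = -2 * ∑ k, smear (gker (gkerD k (gkerD j (gkerD i 1))))
      (fun p => (v k p - v k (t - σ ^ 2, x)) * ζ p) σ t x := by
  have h1 := hF.mul_commTerm_eq hper i j σ t x
  have hv : ∀ k, Tame per fun p => v k p - v k (t - σ ^ 2, x) := fun k =>
    (hF.tame_vel k).sub (Tame.const _)
  have hvz : ∀ k, Tame per fun p => (v k p - v k (t - σ ^ 2, x)) * ζ p := fun k =>
    (hv k).mul hF.tame_sol
  have h2 : (fun p => ∑ k, (v k p - v k (t - σ ^ 2, x)) * dir (sp k) ζ p) = fun p =>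
      ∑ k, dir (sp k) (fun p => (v k p - v k (t - σ ^ 2, x)) * ζ p) p := by
    funext p
    have h3 : ∀ k, dir (sp k) (fun p => v k p - v k (t - σ ^ 2, x)) p = dir (sp k) (v k) p :=
      fun k => by
        rw [dir_sub (hF.tame_vel k) (Tame.const _)]
        simp [dir]
    simp only [fun k => dir_mul (hv k) hF.tame_sol (sp k) p, h3, Finset.sum_add_distrib,
      ← Finset.sum_mul, hF.div_mul, add_zero]
  rw [show σ ^ 2 * commTerm ζ v i j σ t x = σ * (σ * commTerm ζ v i j σ t x) by ring, h1, h2,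
    smear_sum _ hper _ fun k => (hvz k).dir (sp k), Finset.mul_sum,
    Finset.mul_sum, Finset.mul_sum]
  refine Finset.sum_congr rfl fun k _ => ?_
  have := smear_dir (gkerD j (gkerD i 1)) hper (hvz k) k σ t x
  linear_combination 2 * this

end Flow

end ConvDiff

/-! ### L^r bounds for the forcing, the averaged Hessian and the commutator. -/

namespace ConvDiff

variable {n : ℕ} {per a : Fin (n + 1) → ℝ} {c : NNReal} {T : ℝ}

/-- A constant dominating all masses of the Gaussian kernels in use. -/
noncomputable def kernelConst (n : ℕ) : ℝ≥0∞ :=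
  2 * ((∑ i : Fin (n + 1), mass (gkerD i 1)) + (∑ i : Fin (n + 1), ∑ j, mass (gkerD j (gkerD i 1))) +
    ∑ i : Fin (n + 1), ∑ j, ∑ k, mass (gkerD k (gkerD j (gkerD i 1))))

theorem kernelConst_ne_top (n : ℕ) : kernelConst n ≠ ⊤ := by
  unfold kernelConst
  refine ENNReal.mul_ne_top (by simp) ?_
  simp [ENNReal.sum_eq_top, mass_ne_top]

theorem two_mul_mass_first_le (i : Fin (n + 1)) : 2 * mass (gkerD i 1) ≤ kernelConst n := by
  unfold kernelConst
  gcongr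
  refine le_trans ?_ (le_self_add.trans le_self_add)
  exact Finset.single_le_sum (f := fun i => mass (gkerD i 1)) (fun _ _ => zero_le)
    (Finset.mem_univ i)

theorem two_mul_mass_second_le (i j : Fin (n + 1)) :
    2 * mass (gkerD j (gkerD i 1)) ≤ kernelConst n := by
  unfold kernelConst
  gcongr
  refine le_trans ?_ (le_add_self.trans le_self_add)
  refine le_trans ?_ (Finset.single_le_sum (fun _ _ => zero_le) (Finset.mem_univ i))
  exact Finset.single_le_sum (f := fun j => mass (gkerD j (gkerD i 1))) (fun _ _ => zero_le)
    (Finset.mem_univ j)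

theorem two_mul_mass_third_le (i j : Fin (n + 1)) :
    2 * ∑ k, mass (gkerD k (gkerD j (gkerD i 1))) ≤ kernelConst n := by
  unfold kernelConst
  gcongr
  refine le_trans ?_ le_add_self
  refine le_trans ?_ (Finset.single_le_sum (fun _ _ => zero_le) (Finset.mem_univ i))
  exact Finset.single_le_sum (f := fun j => ∑ k, mass (gkerD k (gkerD j (gkerD i 1))))
    (fun _ _ => zero_le) (Finset.mem_univ j)

theorem abs_dir_le_gradSum (g : ℝ × Space n → ℝ) (j : Fin (n + 1)) (p : ℝ × Space n) :
    ENNReal.ofReal |dir (sp j) g p| ≤ gradSum g p :=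
  Finset.single_le_sum (f := fun j => ENNReal.ofReal |dir (sp j) g p|) (fun _ _ => zero_le)
    (Finset.mem_univ j)

variable {ζ f : ℝ × Space n → ℝ} {v : Fin (n + 1) → ℝ × Space n → ℝ} {r : ℝ} {σ : ℝ}

theorem nrm_forceTerm_le (hper : ∀ i, 0 < per i) (hf : Tame per f) (i j : Fin (n + 1))
    (hr : 1 ≤ r) (hσ : σ ∈ Icc (0 : ℝ) 1) :
    nrm r (slab c a per 2 T) (fun p => ENNReal.ofReal |forceTerm f i j σ p.1 p.2|) ≤
      kernelConst n * nrm r (slab c a per 1 T) (gradSum f) := by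
  have h0 : 0 < r := by linarith
  have hc : Continuous fun p : ℝ × Space n =>
      smear (gker (gkerD i 1)) (dir (sp j) f) σ p.1 p.2 :=
    (continuous_smear _ hper (hf.dir (sp j))).comp (by fun_prop : Continuous fun p : ℝ × Space n =>
      (σ, p.1, p.2))
  simp only [forceTerm_eq hper hf, abs_mul, abs_neg, abs_two,
    ENNReal.ofReal_mul (zero_le_two (α := ℝ)), ENNReal.ofReal_ofNat]
  rw [nrm_const_mul h0 _ (by fun_prop)]
  calc _ ≤ 2 * (mass (gkerD i 1) * nrm r (slab c a per 1 T) (gradSum f)) := by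
        gcongr
        refine (nrm_abs_smear_le hper (hf.dir (sp j)) _ hr hσ).trans ?_
        gcongr
        exact nrm_mono h0 (abs_dir_le_gradSum f j)
    _ ≤ _ := by rw [← mul_assoc]; gcongr; exact two_mul_mass_first_le i

theorem mul_nrm_forceTerm_le (hper : ∀ i, 0 < per i) (hf : Tame per f) (i j : Fin (n + 1))
    (hr : 1 ≤ r) (hσ : σ ∈ Icc (0 : ℝ) 1) :
    ENNReal.ofReal σ * nrm r (slab c a per 2 T)
      (fun p => ENNReal.ofReal |forceTerm f i j σ p.1 p.2|) ≤
      kernelConst n * nrm r (slab c a per 1 T) (fun p => ENNReal.ofReal |f p|) := by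
  have h0 : 0 < r := by linarith
  have hc : Continuous fun p : ℝ × Space n =>
      smear (gker (gkerD j (gkerD i 1))) f σ p.1 p.2 :=
    (continuous_smear _ hper hf).comp (by fun_prop : Continuous fun p : ℝ × Space n =>
      (σ, p.1, p.2))
  have hc' : Continuous fun p : ℝ × Space n => forceTerm f i j σ p.1 p.2 :=
    continuous_const.mul ((continuous_smear 1 hper ((hf.dir (sp j)).dir (sp i))).comp
      (by fun_prop : Continuous fun p : ℝ × Space n => (σ, p.1, p.2)))
  rw [← nrm_const_mul h0 _ (by fun_prop)]
  simp only [← ENNReal.ofReal_mul hσ.1]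
  have : ∀ p : ℝ × Space n, σ * |forceTerm f i j σ p.1 p.2| =
      2 * |smear (gker (gkerD j (gkerD i 1))) f σ p.1 p.2| := fun p => by
    have := congrArg abs (mul_forceTerm_eq hper hf i j σ p.1 p.2)
    simpa only [abs_mul, abs_two, abs_of_nonneg hσ.1] using this
  simp only [this, ENNReal.ofReal_mul (zero_le_two (α := ℝ)), ENNReal.ofReal_ofNat]
  rw [nrm_const_mul h0 _ (by fun_prop)]
  calc _ ≤ 2 * (mass (gkerD j (gkerD i 1)) *
          nrm r (slab c a per 1 T) (fun p => ENNReal.ofReal |f p|)) := by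
        gcongr
        exact nrm_abs_smear_le hper hf _ hr hσ
    _ ≤ _ := by rw [← mul_assoc]; gcongr; exact two_mul_mass_second_le i j

/-- This bound and the next one control W_σ inside the divergence term 2σ W_σ div v, by ∇ζ and by ζ
respectively. -/
theorem mul_nrm_smear_hess_le (hper : ∀ i, 0 < per i) (hζ : Tame per ζ) (i j : Fin (n + 1))
    (hr : 1 ≤ r) (hσ : σ ∈ Icc (0 : ℝ) 1) :
    ENNReal.ofReal σ * nrm r (slab c a per 2 T)
      (fun p => ENNReal.ofReal |smear (gker 1) (dir (sp i) (dir (sp j) ζ)) σ p.1 p.2|) ≤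
      kernelConst n * nrm r (slab c a per 1 T) (gradSum ζ) := by
  have h0 : 0 < r := by linarith
  have hc' : Continuous fun p : ℝ × Space n =>
      smear (gker 1) (dir (sp i) (dir (sp j) ζ)) σ p.1 p.2 :=
    (continuous_smear 1 hper ((hζ.dir (sp j)).dir (sp i))).comp
      (by fun_prop : Continuous fun p : ℝ × Space n => (σ, p.1, p.2))
  rw [← nrm_const_mul h0 _ (by fun_prop)]
  simp only [← ENNReal.ofReal_mul hσ.1]
  have : ∀ p : ℝ × Space n, σ * |smear (gker 1) (dir (sp i) (dir (sp j) ζ)) σ p.1 p.2| =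
      |smear (gker (gkerD i 1)) (dir (sp j) ζ) σ p.1 p.2| := fun p => by
    rw [← abs_neg (smear (gker (gkerD i 1)) _ _ _ _), ← smear_dir 1 hper (hζ.dir (sp j)), abs_mul,
      abs_of_nonneg hσ.1]
  simp only [this]
  refine (nrm_abs_smear_le hper (hζ.dir (sp j)) _ hr hσ).trans ?_
  refine mul_le_mul' ?_ (nrm_mono h0 (abs_dir_le_gradSum ζ j))
  exact le_trans (by rw [two_mul]; exact le_self_add) (two_mul_mass_first_le i)

theorem sq_mul_nrm_smear_hess_le (hper : ∀ i, 0 < per i) (hζ : Tame per ζ) (i j : Fin (n + 1))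
    (hr : 1 ≤ r) (hσ : σ ∈ Icc (0 : ℝ) 1) :
    ENNReal.ofReal σ ^ 2 * nrm r (slab c a per 2 T)
      (fun p => ENNReal.ofReal |smear (gker 1) (dir (sp i) (dir (sp j) ζ)) σ p.1 p.2|) ≤
      kernelConst n * nrm r (slab c a per 1 T) (fun p => ENNReal.ofReal |ζ p|) := by
  have h0 : 0 < r := by linarith
  have hc' : Continuous fun p : ℝ × Space n =>
      smear (gker 1) (dir (sp i) (dir (sp j) ζ)) σ p.1 p.2 :=
    (continuous_smear 1 hper ((hζ.dir (sp j)).dir (sp i))).comp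
      (by fun_prop : Continuous fun p : ℝ × Space n => (σ, p.1, p.2))
  rw [← nrm_const_mul h0 _ (by fun_prop), ← ENNReal.ofReal_pow hσ.1]
  simp only [← ENNReal.ofReal_mul (sq_nonneg σ)]
  have : ∀ p : ℝ × Space n, σ ^ 2 * |smear (gker 1) (dir (sp i) (dir (sp j) ζ)) σ p.1 p.2| =
      |smear (gker (gkerD j (gkerD i 1))) ζ σ p.1 p.2| := fun p => by
    rw [← smear_dir_dir hper hζ, abs_mul, abs_of_nonneg (sq_nonneg σ)]
  simp only [this]
  refine (nrm_abs_smear_le hper hζ _ hr hσ).trans ?_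
  gcongr
  exact le_trans (by rw [two_mul]; exact le_self_add) (two_mul_mass_second_le i j)

theorem sum_increment_le (hv : ∀ k, Tame per (v k)) (hσ : 0 ≤ σ) (s : ℝ) (x h : Space n) :
    ∑ k, ENNReal.ofReal |v k (s, x + σ • h) - v k (s, x)| ≤ ENNReal.ofReal (σ * ‖h‖) *
      ∫⁻ θ in Icc (0 : ℝ) 1, jacSum v (s, x + (θ * σ) • h) := by
  have h1 : ∀ θ : ℝ, jacSum v (s, x + (θ * σ) • h) = ∑ k, gradSum (v k) (s, x + (θ * σ) • h) :=
    fun θ => rfl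
  simp only [h1]
  rw [lintegral_finsetSum, Finset.mul_sum]
  · exact Finset.sum_le_sum fun k _ => ofReal_abs_increment_le (hv k) s x h hσ
  · intro k _
    exact (tameE_gradSum (hv k)).measurable.comp (by fun_prop)

/-- The increment of the drift contributes σ‖h‖: the σ balances the one lost to the kernel, and ‖h‖
is absorbed in the weighted mass. The common factor σ stays on both sides here and is cancelled
later for σ > 0. -/
theorem Flow.ofReal_mul_commTerm_le (hF : Flow per ζ f v) (hper : ∀ i, 0 < per i)
    (i j : Fin (n + 1)) (hσ : 0 ≤ σ) (t : ℝ) (x : Space n) :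
    ENNReal.ofReal (σ * |commTerm ζ v i j σ t x|) ≤ ENNReal.ofReal σ *
      (2 * ∫⁻ h, ENNReal.ofReal (‖h‖ * |gker (gkerD j (gkerD i 1)) h|) *
      ∫⁻ θ in Icc (0 : ℝ) 1, jacSum v (t - σ ^ 2, x + (θ * σ) • h) *
        gradSum ζ (t - σ ^ 2, x + σ • h)) := by
  have hm := (tameE_jacSum hF.tame_vel).measurable
  have hv : ∀ k, Tame per fun p => v k p - v k (t - σ ^ 2, x) := fun k =>
    (hF.tame_vel k).sub (Tame.const _)
  have h1 : σ * |commTerm ζ v i j σ t x| = 2 * |smear (gker (gkerD j (gkerD i 1)))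
      (fun p => ∑ k, (v k p - v k (t - σ ^ 2, x)) * dir (sp k) ζ p) σ t x| := by
    have := congrArg abs (hF.mul_commTerm_eq hper i j σ t x)
    simpa only [abs_mul, abs_two, abs_of_nonneg hσ] using this
  rw [h1, ENNReal.ofReal_mul zero_le_two, ENNReal.ofReal_ofNat, mul_left_comm,
    ← lintegral_const_mul' _ _ ENNReal.ofReal_ne_top]
  refine mul_le_mul_right ((ofReal_abs_smear_le _ _ _ _ _).trans (lintegral_mono fun h => ?_)) 2
  have hmθ : Measurable fun θ : ℝ => jacSum v (t - σ ^ 2, x + (θ * σ) • h) :=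
    hm.comp (by fun_prop)
  rw [lintegral_mul_const _ hmθ]
  calc _ ≤ ENNReal.ofReal |gker (gkerD j (gkerD i 1)) h| *
        ((∑ k, ENNReal.ofReal |v k (t - σ ^ 2, x + σ • h) - v k (t - σ ^ 2, x)|) *
          gradSum ζ (t - σ ^ 2, x + σ • h)) := by
        gcongr
        rw [Finset.sum_mul]
        refine (ENNReal.ofReal_le_ofReal (Finset.abs_sum_le_sum_abs _ _)).trans ?_
        rw [ENNReal.ofReal_sum_of_nonneg fun _ _ => abs_nonneg _]
        refine Finset.sum_le_sum fun k _ => ?_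
        rw [abs_mul, ENNReal.ofReal_mul (abs_nonneg _)]
        gcongr
        exact abs_dir_le_gradSum ζ k _
    _ ≤ ENNReal.ofReal |gker (gkerD j (gkerD i 1)) h| *
        ((ENNReal.ofReal (σ * ‖h‖) *
          ∫⁻ θ in Icc (0 : ℝ) 1, jacSum v (t - σ ^ 2, x + (θ * σ) • h)) *
          gradSum ζ (t - σ ^ 2, x + σ • h)) := by
        gcongr
        exact sum_increment_le hF.tame_vel hσ _ _ _
    _ = _ := by
        rw [ENNReal.ofReal_mul hσ, ENNReal.ofReal_mul (norm_nonneg _)]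
        ring

theorem Flow.ofReal_sq_mul_commTerm_le (hF : Flow per ζ f v) (hper : ∀ i, 0 < per i)
    (i j : Fin (n + 1)) (hσ : 0 ≤ σ) (t : ℝ) (x : Space n) :
    ENNReal.ofReal (σ ^ 2 * |commTerm ζ v i j σ t x|) ≤ ENNReal.ofReal σ *
      (2 * ∫⁻ h, (∑ k, ENNReal.ofReal (‖h‖ * |gker (gkerD k (gkerD j (gkerD i 1))) h|)) *
      ∫⁻ θ in Icc (0 : ℝ) 1, jacSum v (t - σ ^ 2, x + (θ * σ) • h) *
        ENNReal.ofReal |ζ (t - σ ^ 2, x + σ • h)|) := by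
  have hm := (tameE_jacSum hF.tame_vel).measurable
  have hζc := hF.tame_sol.continuous
  have h1 : σ ^ 2 * |commTerm ζ v i j σ t x| = 2 * |∑ k, smear
      (gker (gkerD k (gkerD j (gkerD i 1)))) (fun p => (v k p - v k (t - σ ^ 2, x)) * ζ p) σ t x| := by
    have := congrArg abs (hF.sq_mul_commTerm_eq hper i j σ t x)
    simpa only [abs_mul, abs_neg, abs_two, abs_of_nonneg (sq_nonneg σ)] using this
  rw [h1, ENNReal.ofReal_mul zero_le_two, ENNReal.ofReal_ofNat, mul_left_comm,
    ← lintegral_const_mul' _ _ ENNReal.ofReal_ne_top]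
  refine mul_le_mul_right ?_ 2
  refine (ENNReal.ofReal_le_ofReal (Finset.abs_sum_le_sum_abs _ _)).trans ?_
  rw [ENNReal.ofReal_sum_of_nonneg fun _ _ => abs_nonneg _]
  refine (Finset.sum_le_sum fun k _ => ofReal_abs_smear_le _ _ _ _ _).trans ?_
  have hvc := fun k => (hF.tame_vel k).continuous
  have hgc := fun k => continuous_gker (n := n) (gkerD k (gkerD j (gkerD i 1)))
  rw [← lintegral_finsetSum]
  swap
  · intro k _
    have := hvc k
    have := hgc k
    fun_prop
  refine lintegral_mono fun h => ?_
  have hmθ : Measurable fun θ : ℝ => jacSum v (t - σ ^ 2, x + (θ * σ) • h) :=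
    hm.comp (by fun_prop)
  rw [lintegral_mul_const _ hmθ]
  have hle : ∀ k, ENNReal.ofReal |v k (t - σ ^ 2, x + σ • h) - v k (t - σ ^ 2, x)| ≤
      ENNReal.ofReal (σ * ‖h‖) * ∫⁻ θ in Icc (0 : ℝ) 1, jacSum v (t - σ ^ 2, x + (θ * σ) • h) :=
    fun k => (Finset.single_le_sum (f := fun k => ENNReal.ofReal
      |v k (t - σ ^ 2, x + σ • h) - v k (t - σ ^ 2, x)|) (fun _ _ => zero_le)
      (Finset.mem_univ k)).trans (sum_increment_le hF.tame_vel hσ _ _ _)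
  rw [Finset.sum_mul, Finset.mul_sum]
  refine Finset.sum_le_sum fun k _ => ?_
  rw [abs_mul, ENNReal.ofReal_mul (abs_nonneg _)]
  calc _ ≤ ENNReal.ofReal |gker (gkerD k (gkerD j (gkerD i 1))) h| * ((ENNReal.ofReal (σ * ‖h‖) *
        ∫⁻ θ in Icc (0 : ℝ) 1, jacSum v (t - σ ^ 2, x + (θ * σ) • h)) *
        ENNReal.ofReal |ζ (t - σ ^ 2, x + σ • h)|) := by
        gcongr
        exact hle k
    _ = _ := by
        rw [ENNReal.ofReal_mul hσ, ENNReal.ofReal_mul (norm_nonneg _)]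
        ring

theorem Flow.continuous_commTerm (hF : Flow per ζ f v) (hper : ∀ i, 0 < per i)
    (i j : Fin (n + 1)) :
    Continuous fun q : ℝ × ℝ × Space n => commTerm ζ v i j q.1 q.2.1 q.2.2 := by
  have h1 := continuous_smear 1 hper ((hF.tame_adv.dir (sp j)).dir (sp i))
  have h2 := fun k => continuous_smear 1 hper (((hF.tame_sol.dir (sp j)).dir (sp i)).dir (sp k))
  unfold commTerm
  refine ((by fun_prop : Continuous fun q : ℝ × ℝ × Space n => 2 * q.1).mul h1).sub
    ((by fun_prop : Continuous fun q : ℝ × ℝ × Space n => 2 * q.1).mul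
      (continuous_finsetSum _ fun k _ => Continuous.mul ?_ (h2 k)))
  exact (hF.tame_vel k).continuous.comp (by fun_prop)

theorem continuous_forceTerm (hper : ∀ i, 0 < per i) (hf : Tame per f) (i j : Fin (n + 1)) :
    Continuous fun q : ℝ × ℝ × Space n => forceTerm f i j q.1 q.2.1 q.2.2 :=
  (by fun_prop : Continuous fun q : ℝ × ℝ × Space n => 2 * q.1).mul
    (continuous_smear 1 hper ((hf.dir (sp j)).dir (sp i)))

/-- Applied with p = 4 and q = 4r/(4-r), this governs the small scales. The companion bound by ζ,
which loses 1/σ, is applied with p = 2 and q = 2r/(2-r) and governs the large ones. -/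
theorem Flow.nrm_commTerm_le (hF : Flow per ζ f v) (hper : ∀ i, 0 < per i) (i j : Fin (n + 1))
    {p q : ℝ} (hp : 0 < p) (hq : 0 < q) (hr : 1 ≤ r) (hpq : 1 / r = 1 / p + 1 / q)
    (hσ : σ ∈ Ioc (0 : ℝ) 1) :
    nrm r (slab c a per 2 T) (fun x => ENNReal.ofReal |commTerm ζ v i j σ x.1 x.2|) ≤
      kernelConst n * (nrm p (slab c a per 1 T) (jacSum v) *
        nrm q (slab c a per 1 T) (gradSum ζ)) := by
  have hσ' : σ ∈ Icc (0 : ℝ) 1 := ⟨hσ.1.le, hσ.2⟩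
  have hJ := tameE_jacSum hF.tame_vel
  have hG := tameE_gradSum hF.tame_sol
  have hmJ := hJ.measurable
  have hmG := hG.measurable
  have hcg := continuous_gker (n := n) (gkerD j (gkerD i 1))
  have h1 : ∀ x : ℝ × Space n, ENNReal.ofReal |commTerm ζ v i j σ x.1 x.2| ≤
      2 * ∫⁻ h, ENNReal.ofReal (‖h‖ * |gker (gkerD j (gkerD i 1)) h|) *
      ∫⁻ θ in Icc (0 : ℝ) 1, jacSum v (x.1 - σ ^ 2, x.2 + (θ * σ) • h) *
        gradSum ζ (x.1 - σ ^ 2, x.2 + σ • h) := fun x => by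
    have := hF.ofReal_mul_commTerm_le hper i j hσ.1.le x.1 x.2
    rwa [ENNReal.ofReal_mul hσ.1.le, ENNReal.mul_le_mul_iff_right (by simpa using hσ.1)
      ENNReal.ofReal_ne_top] at this
  refine (nrm_mono (by linarith) h1).trans ?_
  rw [nrm_const_mul (by linarith)]
  · refine (mul_le_mul_right (nrm_smear_bilinear_le hper hJ hG hp hq hr hpq
      (by fun_prop) hσ') 2).trans ?_
    rw [← mul_assoc]
    gcongr
    refine le_trans ?_ (two_mul_mass_second_le i j)
    gcongr
    exact lintegral_norm_gker_le_mass _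
  · refine Measurable.aemeasurable (Measurable.lintegral_prod_left' (f := fun z : Space n × ℝ × Space n =>
      ENNReal.ofReal (‖z.1‖ * |gker (gkerD j (gkerD i 1)) z.1|) *
      ∫⁻ θ in Icc (0 : ℝ) 1, jacSum v (z.2.1 - σ ^ 2, z.2.2 + (θ * σ) • z.1) *
        gradSum ζ (z.2.1 - σ ^ 2, z.2.2 + σ • z.1)) ?_)
    refine (by fun_prop : Measurable fun z : Space n × ℝ × Space n =>
      ENNReal.ofReal (‖z.1‖ * |gker (gkerD j (gkerD i 1)) z.1|)).mul ?_
    exact Measurable.lintegral_prod_left' (f := fun z : ℝ × Space n × ℝ × Space n =>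
      jacSum v (z.2.2.1 - σ ^ 2, z.2.2.2 + (z.1 * σ) • z.2.1) *
        gradSum ζ (z.2.2.1 - σ ^ 2, z.2.2.2 + σ • z.2.1))
      ((hmJ.comp (by fun_prop)).mul (hmG.comp (by fun_prop)))

theorem Flow.mul_nrm_commTerm_le (hF : Flow per ζ f v) (hper : ∀ i, 0 < per i)
    (i j : Fin (n + 1)) {p q : ℝ} (hp : 0 < p) (hq : 0 < q) (hr : 1 ≤ r)
    (hpq : 1 / r = 1 / p + 1 / q) (hσ : σ ∈ Ioc (0 : ℝ) 1) :
    ENNReal.ofReal σ *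
      nrm r (slab c a per 2 T) (fun x => ENNReal.ofReal |commTerm ζ v i j σ x.1 x.2|) ≤
      kernelConst n * (nrm p (slab c a per 1 T) (jacSum v) *
        nrm q (slab c a per 1 T) (fun p => ENNReal.ofReal |ζ p|)) := by
  have hσ' : σ ∈ Icc (0 : ℝ) 1 := ⟨hσ.1.le, hσ.2⟩
  have hJ := tameE_jacSum hF.tame_vel
  have hG := hF.tame_sol.tameE
  have hmJ := hJ.measurable
  have hmG := hG.measurable
  have hcg := fun k => continuous_gker (n := n) (gkerD k (gkerD j (gkerD i 1)))
  have hκ : Measurable fun h : Space n =>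
      ∑ k, ENNReal.ofReal (‖h‖ * |gker (gkerD k (gkerD j (gkerD i 1))) h|) :=
    Finset.measurable_sum _ fun k _ => by have := hcg k; fun_prop
  have hcc : Continuous fun x : ℝ × Space n => commTerm ζ v i j σ x.1 x.2 :=
    (hF.continuous_commTerm hper i j).comp (by fun_prop : Continuous fun x : ℝ × Space n =>
      (σ, x.1, x.2))
  have h1 : ∀ x : ℝ × Space n, ENNReal.ofReal σ * ENNReal.ofReal |commTerm ζ v i j σ x.1 x.2| ≤
      2 * ∫⁻ h, (∑ k, ENNReal.ofReal (‖h‖ * |gker (gkerD k (gkerD j (gkerD i 1))) h|)) *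
      ∫⁻ θ in Icc (0 : ℝ) 1, jacSum v (x.1 - σ ^ 2, x.2 + (θ * σ) • h) *
        ENNReal.ofReal |ζ (x.1 - σ ^ 2, x.2 + σ • h)| := fun x => by
    have := hF.ofReal_sq_mul_commTerm_le hper i j hσ.1.le x.1 x.2
    rwa [pow_two, mul_assoc, ENNReal.ofReal_mul hσ.1.le, ENNReal.ofReal_mul hσ.1.le, ← pow_two,
      ENNReal.mul_le_mul_iff_right (by simpa using hσ.1) ENNReal.ofReal_ne_top] at this
  rw [← nrm_const_mul (by linarith) _ (by fun_prop)]
  refine (nrm_mono (by linarith) h1).trans ?_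
  rw [nrm_const_mul (by linarith)]
  · refine (mul_le_mul_right (nrm_smear_bilinear_le hper hJ hG hp hq hr hpq hκ hσ') 2).trans ?_
    rw [← mul_assoc]
    gcongr
    refine le_trans ?_ (two_mul_mass_third_le i j)
    gcongr
    rw [lintegral_finsetSum _ fun k _ => by have := hcg k; fun_prop]
    exact Finset.sum_le_sum fun k _ => lintegral_norm_gker_le_mass _
  · refine Measurable.aemeasurable (Measurable.lintegral_prod_left' (f := fun z : Space n × ℝ × Space n =>
      (∑ k, ENNReal.ofReal (‖z.1‖ * |gker (gkerD k (gkerD j (gkerD i 1))) z.1|)) *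
      ∫⁻ θ in Icc (0 : ℝ) 1, jacSum v (z.2.1 - σ ^ 2, z.2.2 + (θ * σ) • z.1) *
        ENNReal.ofReal |ζ (z.2.1 - σ ^ 2, z.2.2 + σ • z.1)|) ?_)
    refine (hκ.comp measurable_fst).mul ?_
    exact Measurable.lintegral_prod_left' (f := fun z : ℝ × Space n × ℝ × Space n =>
      jacSum v (z.2.2.1 - σ ^ 2, z.2.2.2 + (z.1 * σ) • z.2.1) *
        ENNReal.ofReal |ζ (z.2.2.1 - σ ^ 2, z.2.2.2 + σ • z.2.1)|)
      ((hmJ.comp (by fun_prop)).mul (hmG.comp (by fun_prop)))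

end ConvDiff

/-! ### Integration over periodic cells, differentiation in the scale, and the differential
inequality. -/

namespace ConvDiff

variable {n : ℕ} {per a : Fin (n + 1) → ℝ} {c : NNReal} {T : ℝ}

/-- No boundary faces are needed. By translation invariance the integral of G' equals its average
over shifts by τ in (0,1] along the k-th direction. By Fubini and the fundamental theorem of
calculus this is the integral of a difference of two translates of G, which vanishes by translation
invariance again. -/
theorem setIntegral_cell_deriv_eq_zero (hper : ∀ i, 0 < per i) {G G' : Space n → ℝ}
    (hG : CellPeriodic per G) (hG' : CellPeriodic per G') (hcG : Continuous G)
    (hcG' : Continuous G') (k : Fin (n + 1))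
    (hd : ∀ x τ, HasDerivAt (fun τ : ℝ => G (x + EuclideanSpace.single k τ))
      (G' (x + EuclideanSpace.single k τ)) τ) :
    ∫ x in cell a per, G' x = 0 := by
  have hsing : Continuous fun τ : ℝ => (EuclideanSpace.single k τ : Space n) := by
    have : (fun τ : ℝ => (EuclideanSpace.single k τ : Space n)) =
        fun τ => τ • EuclideanSpace.single k 1 := by
      funext τ; ext j; simp
    rw [this]; fun_prop
  have hcomp : IsCompact (closure (cell a per)) := (isBounded_cell a per hper).isCompact_closure
  have hF : Continuous fun z : Space n × ℝ => G' (z.1 + EuclideanSpace.single k z.2) :=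
    hcG'.comp (continuous_fst.add (hsing.comp continuous_snd))
  have hint : Integrable (fun z : Space n × ℝ => G' (z.1 + EuclideanSpace.single k z.2))
      ((volume.restrict (cell a per)).prod (volume.restrict (Ioc (0 : ℝ) 1))) := by
    rw [Measure.prod_restrict]
    exact (hF.continuousOn.integrableOn_compact (hcomp.prod isCompact_Icc)).mono_set
      (prod_mono subset_closure Ioc_subset_Icc_self)
  have hGint : ∀ y : Space n, IntegrableOn (fun x => G (x + y)) (cell a per) := fun y =>
    ((hcG.comp (by fun_prop)).continuousOn.integrableOn_compact hcomp).mono_set subset_closure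
  have h1 : ∫ τ in Ioc (0 : ℝ) 1, ∫ x in cell a per, G' (x + EuclideanSpace.single k τ) =
      ∫ x in cell a per, G' x := by
    simp only [fun τ => setIntegral_cell_add (a := a) hper hG' (EuclideanSpace.single k τ)]
    simp
  rw [← h1, ← integral_integral_swap hint]
  have h2 : ∀ x, ∫ τ in Ioc (0 : ℝ) 1, G' (x + EuclideanSpace.single k τ) =
      G (x + EuclideanSpace.single k 1) - G (x + EuclideanSpace.single k 0) := fun x => by
    rw [← intervalIntegral.integral_of_le zero_le_one]
    exact intervalIntegral.integral_eq_sub_of_hasDerivAt (fun τ _ => hd x τ)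
      ((hcG'.comp (continuous_const.add hsing)).intervalIntegrable _ _)
  simp only [h2]
  rw [integral_sub (hGint _) (hGint _), setIntegral_cell_add hper hG, setIntegral_cell_add hper hG,
    sub_self]

theorem slab_eq (c : NNReal) (a per : Fin (n + 1) → ℝ) (s T : ℝ) :
    slab c a per s T = c • (volume.restrict (Icc s T ×ˢ cell a per)) := by
  unfold slab
  rw [Measure.volume_eq_prod, ← Measure.prod_restrict]
  exact Measure.prod_smul_left (c : ℝ≥0∞)

theorem ae_slab {s : ℝ} {p : ℝ × Space n → Prop}
    (h : ∀ x ∈ Icc s T ×ˢ cell a per, p x) : ∀ᵐ x ∂slab c a per s T, p x := by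
  rw [slab_eq]
  exact Measure.ae_smul_measure ((ae_restrict_iff' (measurableSet_Icc.prod
    (measurableSet_cell a per))).2 (Eventually.of_forall h)) c

theorem isCompact_slab (hper : ∀ i, 0 < per i) (s T : ℝ) :
    IsCompact (Icc s T ×ˢ closure (cell a per)) :=
  isCompact_Icc.prod (isBounded_cell a per hper).isCompact_closure

theorem integrable_slab (hper : ∀ i, 0 < per i) {g : ℝ × Space n → ℝ} (hg : Continuous g) (s : ℝ) :
    Integrable g (slab c a per s T) := by
  rw [slab_eq]
  exact ((hg.continuousOn.integrableOn_compact (isCompact_slab hper s T)).mono_set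
    (prod_mono le_rfl subset_closure)).integrable.smul_measure_nnreal

theorem hasDerivAt_integral_slab (hper : ∀ i, 0 < per i) {F F' : ℝ → ℝ × Space n → ℝ}
    (hF : Continuous fun z : ℝ × ℝ × Space n => F z.1 z.2)
    (hF' : Continuous fun z : ℝ × ℝ × Space n => F' z.1 z.2)
    (hd : ∀ σ ∈ Ioo (0 : ℝ) 1, ∀ p : ℝ × Space n, 2 ≤ p.1 →
      HasDerivAt (fun σ => F σ p) (F' σ p) σ) {σ : ℝ} (hσ : σ ∈ Ioo (0 : ℝ) 1) :
    HasDerivAt (fun σ => ∫ p, F σ p ∂slab c a per 2 T) (∫ p, F' σ p ∂slab c a per 2 T) σ := by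
  have := isFiniteMeasure_slab c (a := a) hper 2 T
  have hs : ∀ σ, Continuous (F σ) := fun σ => hF.comp (by fun_prop : Continuous fun p => (σ, p))
  have hs' : ∀ σ, Continuous (F' σ) := fun σ => hF'.comp (by fun_prop : Continuous fun p => (σ, p))
  obtain ⟨K, hK⟩ := ((isCompact_Icc (a := (0 : ℝ)) (b := 1)).prod
    (isCompact_slab (a := a) hper 2 T)).exists_bound_of_continuousOn hF'.continuousOn
  refine (hasDerivAt_integral_of_dominated_loc_of_deriv_le (s := Ioo (0 : ℝ) 1)
    (Ioo_mem_nhds hσ.1 hσ.2) (bound := fun _ => K)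
    (Eventually.of_forall fun σ => (hs σ).aestronglyMeasurable) (integrable_slab hper (hs σ) 2)
    (hs' σ).aestronglyMeasurable (ae_slab fun p hp τ hτ => ?_) (integrable_const K)
    (ae_slab fun p hp τ hτ => hd τ hτ p hp.1.1)).2
  exact hK (τ, p) ⟨⟨hτ.1.le, hτ.2.le⟩, hp.1, subset_closure hp.2⟩

theorem continuousOn_integral_slab (hper : ∀ i, 0 < per i) {F : ℝ → ℝ × Space n → ℝ}
    (hF : Continuous fun z : ℝ × ℝ × Space n => F z.1 z.2) :
    ContinuousOn (fun σ => ∫ p, F σ p ∂slab c a per 2 T) (Icc 0 1) := by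
  have := isFiniteMeasure_slab c (a := a) hper 2 T
  have hs : ∀ σ, Continuous (F σ) := fun σ => hF.comp (by fun_prop : Continuous fun p => (σ, p))
  obtain ⟨K, hK⟩ := ((isCompact_Icc (a := (0 : ℝ)) (b := 1)).prod
    (isCompact_slab (a := a) hper 2 T)).exists_bound_of_continuousOn hF.continuousOn
  refine continuousOn_of_dominated (bound := fun _ => K)
    (fun σ _ => (hs σ).aestronglyMeasurable) (fun σ hσ => ae_slab fun p hp => ?_)
    (integrable_const K) (Eventually.of_forall fun p => ?_)
  · exact hK (σ, p) ⟨hσ, hp.1, subset_closure hp.2⟩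
  · exact (hF.comp (by fun_prop : Continuous fun σ => (σ, p))).continuousOn

theorem integral_slab_eq_zero (hper : ∀ i, 0 < per i) {g : ℝ × Space n → ℝ} (hg : Continuous g)
    (s : ℝ) (h : ∀ t, ∫ x in cell a per, g (t, x) = 0) : ∫ p, g p ∂slab c a per s T = 0 := by
  have hi := integrable_slab (c := c) (a := a) (T := T) hper hg s
  unfold slab at hi ⊢
  rw [integral_prod _ hi]
  simp [h]

section ODE

/-- The scales between e^{-M} and 1 carry logarithmic length M, and those below e^{-M} have total
length e^{-M}. -/
theorem integral_step {b e : ℝ} (M : ℕ) :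
    IntervalIntegrable (fun σ : ℝ => if σ ≤ Real.exp (-(M : ℝ)) then b else e / σ) volume 0 1 ∧
      ∫ σ in (0 : ℝ)..1, (if σ ≤ Real.exp (-(M : ℝ)) then b else e / σ) =
        e * M + b * Real.exp (-(M : ℝ)) := by
  set m := Real.exp (-(M : ℝ)) with hm
  have hm0 : 0 < m := Real.exp_pos _
  have hm1 : m ≤ 1 := Real.exp_le_one_iff.2 (by simp)
  have e1 : EqOn (fun _ : ℝ => b) (fun σ : ℝ => if σ ≤ m then b else e / σ) (uIoc 0 m) := by
    intro σ hσ
    rw [uIoc_of_le hm0.le] at hσ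
    simp [hσ.2]
  have e2 : EqOn (fun σ : ℝ => e / σ) (fun σ : ℝ => if σ ≤ m then b else e / σ) (uIoc m 1) := by
    intro σ hσ
    rw [uIoc_of_le hm1] at hσ
    simp [not_le.2 hσ.1]
  have i1 : IntervalIntegrable (fun σ : ℝ => if σ ≤ m then b else e / σ) volume 0 m :=
    (intervalIntegrable_const (c := b)).congr e1
  have hne : (0 : ℝ) ∉ uIcc m 1 := by
    rw [uIcc_of_le hm1]; exact fun h => absurd h.1 (not_le.2 hm0)
  have i2 : IntervalIntegrable (fun σ : ℝ => if σ ≤ m then b else e / σ) volume m 1 := by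
    refine IntervalIntegrable.congr e2 (ContinuousOn.intervalIntegrable ?_)
    exact continuousOn_const.div continuousOn_id fun x hx h0 => hne (h0 ▸ hx)
  refine ⟨i1.trans i2, ?_⟩
  rw [← intervalIntegral.integral_add_adjacent_intervals i1 i2,
    ← intervalIntegral.integral_congr_ae (Eventually.of_forall e1),
    ← intervalIntegral.integral_congr_ae (Eventually.of_forall e2)]
  simp only [div_eq_mul_inv, intervalIntegral.integral_const, intervalIntegral.integral_const_mul,
    integral_inv hne, one_mul]
  rw [hm, ← Real.exp_neg, neg_neg, Real.log_exp, smul_eq_mul]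
  ring

/-- Dividing by r Φ^{1-1/r} turns the hypothesis into a bound for the derivative of Φ^{1/r}, which
is where strict positivity of Φ is needed. Each minimum is replaced by one of its entries according
to the position of σ relative to e^{-M} or e^{-N}, and the resulting step functions are integrated.
-/
theorem rpow_inv_le_of_deriv_bound {r : ℝ} (hr : 1 ≤ r) {Φ D : ℝ → ℝ}
    (hc : ContinuousOn Φ (Icc 0 1)) (hpos : ∀ σ ∈ Icc (0 : ℝ) 1, 0 < Φ σ)
    (hd : ∀ σ ∈ Ioo (0 : ℝ) 1, HasDerivAt Φ (D σ) σ) {a₁ b₁ a₂ b₂ e : ℝ} (M N : ℕ)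
    (hD : ∀ σ ∈ Ioo (0 : ℝ) 1, |D σ| ≤ r * Φ σ ^ (1 - 1 / r) *
      (min b₁ (a₁ / σ) + min b₂ (a₂ / σ) + e)) :
    Φ 0 ^ (1 / r) ≤ Φ 1 ^ (1 / r) + (a₁ * M + b₁ * Real.exp (-(M : ℝ)) +
      (a₂ * N + b₂ * Real.exp (-(N : ℝ))) + e) := by
  have hr0 : 0 < r := by linarith
  obtain ⟨i1, v1⟩ := integral_step (b := b₁) (e := a₁) M
  obtain ⟨i2, v2⟩ := integral_step (b := b₂) (e := a₂) N
  have i3 : IntervalIntegrable (fun _ : ℝ => e) volume 0 1 := intervalIntegrable_const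
  have hφ : IntegrableOn (fun σ : ℝ => (if σ ≤ Real.exp (-(M : ℝ)) then b₁ else a₁ / σ) +
      (if σ ≤ Real.exp (-(N : ℝ)) then b₂ else a₂ / σ) + e) (Icc 0 1) := by
    rw [integrableOn_Icc_iff_integrableOn_Ioc, ← intervalIntegrable_iff_integrableOn_Ioc_of_le
      zero_le_one]
    exact (i1.add i2).add i3
  have key := intervalIntegral.sub_le_integral_of_hasDeriv_right_of_le (a := 0) (b := 1)
    (g := fun σ => -(Φ σ ^ (1 / r))) (g' := fun σ => -(D σ * (1 / r) * Φ σ ^ (1 / r - 1)))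
    zero_le_one ((hc.rpow_const fun σ hσ => Or.inl (hpos σ hσ).ne').neg)
    (fun σ hσ => (((hd σ hσ).rpow_const
      (Or.inl (hpos σ ⟨hσ.1.le, hσ.2.le⟩).ne')).neg).hasDerivWithinAt) hφ (fun σ hσ => ?_)
  · rw [intervalIntegral.integral_add (i1.add i2) i3, intervalIntegral.integral_add i1 i2, v1, v2]
      at key
    simp only [intervalIntegral.integral_const, sub_zero, one_smul] at key
    linarith
  · have hΦ := hpos σ ⟨hσ.1.le, hσ.2.le⟩
    have h1 : -(D σ * (1 / r) * Φ σ ^ (1 / r - 1)) ≤ min b₁ (a₁ / σ) + min b₂ (a₂ / σ) + e := by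
      have h2 : Φ σ ^ (1 - 1 / r) * Φ σ ^ (1 / r - 1) = 1 := by
        rw [← Real.rpow_add hΦ]; simp
      calc -(D σ * (1 / r) * Φ σ ^ (1 / r - 1)) = -D σ * ((1 / r) * Φ σ ^ (1 / r - 1)) := by ring
        _ ≤ |D σ| * ((1 / r) * Φ σ ^ (1 / r - 1)) :=
            mul_le_mul_of_nonneg_right (neg_le_abs _) (by positivity)
        _ ≤ (r * Φ σ ^ (1 - 1 / r) * (min b₁ (a₁ / σ) + min b₂ (a₂ / σ) + e)) *
            ((1 / r) * Φ σ ^ (1 / r - 1)) :=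
            mul_le_mul_of_nonneg_right (hD σ hσ) (by positivity)
        _ = (r * (1 / r)) * (Φ σ ^ (1 - 1 / r) * Φ σ ^ (1 / r - 1)) *
            (min b₁ (a₁ / σ) + min b₂ (a₂ / σ) + e) := by ring
        _ = _ := by rw [h2, mul_one_div_cancel hr0.ne']; ring
    refine h1.trans ?_
    gcongr
    · split_ifs
      exacts [min_le_left _ _, min_le_right _ _]
    · split_ifs
      exacts [min_le_left _ _, min_le_right _ _]

end ODE

end ConvDiff

/-! ### Smoothed absolute value, cancellation of convection, and Hölder duality. -/

namespace ConvDiff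

variable {n : ℕ} {per a : Fin (n + 1) → ℝ} {c : NNReal} {T : ℝ}

/-- A smooth positive approximation of the absolute value. -/
noncomputable def softAbs (ε w : ℝ) : ℝ := Real.sqrt (w ^ 2 + ε ^ 2)

section softAbs

variable {ε : ℝ} (w : ℝ)

theorem softAbs_pos (hε : 0 < ε) : 0 < softAbs ε w := Real.sqrt_pos.2 (by positivity)

theorem abs_le_softAbs : |w| ≤ softAbs ε w := by
  rw [softAbs, ← Real.sqrt_sq_eq_abs]
  exact Real.sqrt_le_sqrt (by nlinarith [sq_nonneg ε])

theorem softAbs_le (hε : 0 ≤ ε) : softAbs ε w ≤ |w| + ε := by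
  rw [softAbs, Real.sqrt_le_left (by positivity), ← sq_abs w]
  nlinarith [abs_nonneg w, mul_nonneg (abs_nonneg w) hε]

theorem abs_div_softAbs_le : |w / softAbs ε w| ≤ 1 := by
  have : 0 ≤ softAbs ε w := Real.sqrt_nonneg _
  rw [abs_div, abs_of_nonneg this]
  exact div_le_one_of_le₀ (abs_le_softAbs w) this

theorem continuous_softAbs (ε : ℝ) : Continuous (softAbs ε) := by unfold softAbs; fun_prop

theorem HasDerivAt.softAbs_rpow (hε : 0 < ε) (r : ℝ) {g : ℝ → ℝ} {g' x : ℝ}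
    (hg : HasDerivAt g g' x) : HasDerivAt (fun x => softAbs ε (g x) ^ r)
      (r * softAbs ε (g x) ^ (r - 1) * (g x / softAbs ε (g x)) * g') x := by
  have h0 : g x ^ 2 + ε ^ 2 ≠ 0 := by positivity
  have h1 := ((hg.pow 2).add_const (ε ^ 2)).sqrt h0
  have h2 := h1.rpow_const (p := r) (Or.inl (softAbs_pos (g x) hε).ne')
  refine h2.congr_deriv ?_
  have := (softAbs_pos (g x) hε).ne'
  simp only [softAbs] at this ⊢
  simp only [Pi.pow_apply]
  field_simp
  ring

theorem continuous_softAbs_rpow (hε : 0 < ε) (r : ℝ) : Continuous fun w => softAbs ε w ^ r :=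
  (continuous_softAbs ε).rpow_const fun w => Or.inl (softAbs_pos w hε).ne'

end softAbs

theorem Tame.hasDerivAt_space {g : ℝ × Space n → ℝ} (hg : Tame per g) (s : ℝ) (x : Space n)
    (k : Fin (n + 1)) (τ : ℝ) : HasDerivAt (fun τ : ℝ => g (s, x + EuclideanSpace.single k τ))
      (ConvDiff.dir (sp k) g (s, x + EuclideanSpace.single k τ)) τ := by
  have h2 : HasDerivAt (fun τ : ℝ => (EuclideanSpace.single k τ : Space n))
      (EuclideanSpace.single k 1) τ := by
    have : (fun τ : ℝ => (EuclideanSpace.single k τ : Space n)) =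
        fun τ => τ • EuclideanSpace.single k 1 := by
      funext τ; ext j; simp
    rw [this]
    simpa using (hasDerivAt_id τ).smul_const (EuclideanSpace.single k (1 : ℝ) : Space n)
  have h1 : HasDerivAt (fun τ : ℝ => ((s, x + EuclideanSpace.single k τ) : ℝ × Space n))
      (sp k) τ := (hasDerivAt_const τ _).prodMk (h2.const_add x)
  exact (hg.differentiable _).hasFDerivAt.comp_hasDerivAt τ h1

theorem cellPeriodic_smear {g : ℝ × Space n → ℝ} (hg : Tame per g) (κ : Space n → ℝ) (σ t : ℝ) :
    CellPeriodic per (smear κ g σ t) := fun x i => by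
  unfold smear
  congr 1
  funext h
  rw [add_right_comm, show g (t - σ ^ 2, x + σ • h + EuclideanSpace.single i (per i)) =
    g (t - σ ^ 2, x + σ • h) from hg.periodic _ _ _]

variable {v : Fin (n + 1) → ℝ × Space n → ℝ} {r ε : ℝ}

/-- The convective part of the evolution does not contribute except through the divergence. -/
theorem integral_convection (hper : ∀ i, 0 < per i) (hv : ∀ k, Tame per (v k))
    {g : ℝ × Space n → ℝ} (hg : Tame per g) (hε : 0 < ε) (r σ s : ℝ) :
    ∫ p, (r * softAbs ε (smear (gker 1) g σ p.1 p.2) ^ (r - 1) *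
        (smear (gker 1) g σ p.1 p.2 / softAbs ε (smear (gker 1) g σ p.1 p.2)) *
        (∑ k, v k (p.1 - σ ^ 2, p.2) * smear (gker 1) (dir (sp k) g) σ p.1 p.2) +
      softAbs ε (smear (gker 1) g σ p.1 p.2) ^ r *
        ∑ k, dir (sp k) (v k) (p.1 - σ ^ 2, p.2)) ∂slab c a per s T = 0 := by
  have hW : Continuous fun p : ℝ × Space n => smear (gker 1) g σ p.1 p.2 :=
    (continuous_smear 1 hper hg).comp (by fun_prop : Continuous fun p : ℝ × Space n =>
      (σ, p.1, p.2))
  have hdW : ∀ k, Continuous fun p : ℝ × Space n => smear (gker 1) (dir (sp k) g) σ p.1 p.2 :=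
    fun k => (continuous_smear 1 hper (hg.dir (sp k))).comp
      (by fun_prop : Continuous fun p : ℝ × Space n => (σ, p.1, p.2))
  have hvc : ∀ k, Continuous fun p : ℝ × Space n => v k (p.1 - σ ^ 2, p.2) := fun k =>
    (hv k).continuous.comp (by fun_prop)
  have hdvc : ∀ k, Continuous fun p : ℝ × Space n => dir (sp k) (v k) (p.1 - σ ^ 2, p.2) :=
    fun k => ((hv k).dir (sp k)).continuous.comp (by fun_prop)
  have hA := (continuous_softAbs ε).comp hW
  have hA0 : ∀ p : ℝ × Space n, softAbs ε (smear (gker 1) g σ p.1 p.2) ≠ 0 := fun p =>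
    (softAbs_pos _ hε).ne'
  have hAr : ∀ q : ℝ, Continuous fun p : ℝ × Space n =>
      softAbs ε (smear (gker 1) g σ p.1 p.2) ^ q := fun q =>
    (continuous_softAbs_rpow hε q).comp hW
  have hterm : ∀ k, Continuous fun p : ℝ × Space n =>
      r * softAbs ε (smear (gker 1) g σ p.1 p.2) ^ (r - 1) *
        (smear (gker 1) g σ p.1 p.2 / softAbs ε (smear (gker 1) g σ p.1 p.2)) *
        smear (gker 1) (dir (sp k) g) σ p.1 p.2 * v k (p.1 - σ ^ 2, p.2) +
      softAbs ε (smear (gker 1) g σ p.1 p.2) ^ r * dir (sp k) (v k) (p.1 - σ ^ 2, p.2) :=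
    fun k => (((((hAr (r - 1)).const_mul r).mul (hW.div hA hA0)).mul (hdW k)).mul (hvc k)).add
      ((hAr r).mul (hdvc k))
  have hsplit : ∀ p : ℝ × Space n, (r * softAbs ε (smear (gker 1) g σ p.1 p.2) ^ (r - 1) *
        (smear (gker 1) g σ p.1 p.2 / softAbs ε (smear (gker 1) g σ p.1 p.2)) *
        (∑ k, v k (p.1 - σ ^ 2, p.2) * smear (gker 1) (dir (sp k) g) σ p.1 p.2) +
      softAbs ε (smear (gker 1) g σ p.1 p.2) ^ r *
        ∑ k, dir (sp k) (v k) (p.1 - σ ^ 2, p.2)) =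
      ∑ k, (r * softAbs ε (smear (gker 1) g σ p.1 p.2) ^ (r - 1) *
        (smear (gker 1) g σ p.1 p.2 / softAbs ε (smear (gker 1) g σ p.1 p.2)) *
        smear (gker 1) (dir (sp k) g) σ p.1 p.2 * v k (p.1 - σ ^ 2, p.2) +
      softAbs ε (smear (gker 1) g σ p.1 p.2) ^ r * dir (sp k) (v k) (p.1 - σ ^ 2, p.2)) :=
    fun p => by
      rw [Finset.sum_add_distrib, Finset.mul_sum, Finset.mul_sum]
      congr 1
      exact Finset.sum_congr rfl fun k _ => by ring
  simp only [hsplit]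
  rw [integral_finsetSum _ fun k _ => integrable_slab hper (hterm k) s]
  refine Finset.sum_eq_zero fun k _ => integral_slab_eq_zero hper (hterm k) s fun t => ?_
  have hsl : Continuous fun x : Space n => ((t, x) : ℝ × Space n) := by fun_prop
  -- The k-th summand is the k-th partial derivative of the periodic function softAbs(W)^r v_k, so
  -- its integral over the cell is zero.
  refine setIntegral_cell_deriv_eq_zero hper
    (G := fun x => softAbs ε (smear (gker 1) g σ t x) ^ r * v k (t - σ ^ 2, x)) ?_ ?_
    (((hAr r).mul (hvc k)).comp hsl) ((hterm k).comp hsl) k fun x τ => ?_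
  · intro x i
    simp only [cellPeriodic_smear hg (gker 1) σ t x i,
      show v k (t - σ ^ 2, x + EuclideanSpace.single i (per i)) = v k (t - σ ^ 2, x) from
        (hv k).periodic _ _ _]
  · intro x i
    simp only [cellPeriodic_smear hg (gker 1) σ t x i,
      cellPeriodic_smear (hg.dir (sp k)) (gker 1) σ t x i,
      show v k (t - σ ^ 2, x + EuclideanSpace.single i (per i)) = v k (t - σ ^ 2, x) from
        (hv k).periodic _ _ _,
      show dir (sp k) (v k) (t - σ ^ 2, x + EuclideanSpace.single i (per i)) =
        dir (sp k) (v k) (t - σ ^ 2, x) from ((hv k).dir (sp k)).periodic _ _ _]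
  · exact (HasDerivAt.softAbs_rpow hε r (hasDerivAt_smear_space 1 hper hg k σ t x τ)).mul
      ((hv k).hasDerivAt_space (t - σ ^ 2) x k τ)

theorem nrm_ne_top (hper : ∀ i, 0 < per i) {g : ℝ × Space n → ℝ} (hg : Continuous g)
    {p : ℝ} (hp : 0 < p) (s : ℝ) :
    nrm p (slab c a per s T) (fun x => ENNReal.ofReal |g x|) ≠ ⊤ := by
  refine ENNReal.rpow_ne_top_of_nonneg (by positivity) ?_
  have h1 : Continuous fun x => |g x| ^ p := hg.abs.rpow_const fun _ => Or.inr hp.le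
  have h2 := (integrable_slab (c := c) (a := a) (T := T) hper h1 s).lintegral_lt_top
  simp only [ENNReal.ofReal_rpow_of_nonneg (abs_nonneg _) hp.le]
  exact h2.ne

theorem nrm_gradSum_ne_top (hper : ∀ i, 0 < per i) {g : ℝ × Space n → ℝ} (hg : Tame per g)
    {p : ℝ} (hp : 1 ≤ p) (s : ℝ) : nrm p (slab c a per s T) (gradSum g) ≠ ⊤ := by
  refine ne_top_of_le_ne_top ?_ (nrm_sum_le hp _ fun k => (hg.dir (sp k)).tameE.measurable)
  simp only [ne_eq, ENNReal.sum_eq_top, not_exists, not_and]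
  exact fun k _ => nrm_ne_top hper (hg.dir (sp k)).continuous (by linarith) s

theorem nrm_jacSum_ne_top (hper : ∀ i, 0 < per i) (hv : ∀ k, Tame per (v k))
    {p : ℝ} (hp : 1 ≤ p) (s : ℝ) : nrm p (slab c a per s T) (jacSum v) ≠ ⊤ := by
  refine ne_top_of_le_ne_top ?_ (nrm_sum_le hp _ (F := fun k => gradSum (v k))
    fun k => (tameE_gradSum (hv k)).measurable)
  simp only [ne_eq, ENNReal.sum_eq_top, not_exists, not_and]
  exact fun k _ => nrm_gradSum_ne_top hper (hv k) hp s

theorem le_ofReal_min {X : ℝ≥0∞} {b e σ : ℝ} (hσ : 0 < σ) (h1 : X ≤ ENNReal.ofReal b)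
    (h2 : ENNReal.ofReal σ * X ≤ ENNReal.ofReal e) : X ≤ ENNReal.ofReal (min b (e / σ)) := by
  rw [ENNReal.ofReal_min, le_min_iff]
  refine ⟨h1, ?_⟩
  rw [ENNReal.ofReal_div_of_pos hσ, ENNReal.le_div_iff_mul_le (by simp [hσ]) (by simp), mul_comm]
  exact h2

/-- Hölder between A^{r-1} and H, written with the weights 1 - 1/r and 1/r so that r = 1 needs no
separate treatment. The conclusion has the form required by the differential inequality in the
scale. -/
theorem nrm_mono_integral {μ : Measure (ℝ × Space n)} (hr : 1 ≤ r) {φ : ℝ × Space n → ℝ}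
    {A : ℝ × Space n → ℝ} (hA : ∀ p, 0 < A p) (hφ : Integrable (fun p => A p ^ r) μ)
    (hAm : Measurable A) {H : ℝ × Space n → ℝ≥0∞} (hH : Measurable H)
    (h : ∀ p, ENNReal.ofReal |φ p| ≤ ENNReal.ofReal (r * A p ^ (r - 1)) * H p) {B : ℝ}
    (hB : 0 ≤ B) (hHB : nrm r μ H ≤ ENNReal.ofReal B) :
    |∫ p, φ p ∂μ| ≤ r * (∫ p, A p ^ r ∂μ) ^ (1 - 1 / r) * B := by
  have hr0 : 0 < r := by linarith
  have hΦ : 0 ≤ ∫ p, A p ^ r ∂μ := integral_nonneg fun p => Real.rpow_nonneg (hA p).le _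
  have hex : 0 ≤ 1 - 1 / r := by rw [sub_nonneg]; exact (div_le_one hr0).2 hr
  have h1 : ∀ p, ENNReal.ofReal (A p ^ (r - 1)) = ENNReal.ofReal (A p ^ r) ^ (1 - 1 / r) :=
    fun p => by
      rw [ENNReal.ofReal_rpow_of_nonneg (Real.rpow_nonneg (hA p).le _) hex,
        ← Real.rpow_mul (hA p).le]
      congr 2; field_simp
  have hH2 := ENNReal.lintegral_mul_norm_pow_le (μ := μ) (f := fun p => ENNReal.ofReal (A p ^ r))
    (g := fun p => H p ^ r) (by fun_prop) (hH.pow_const r).aemeasurable hex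
    (by positivity : (0 : ℝ) ≤ 1 / r) (by ring)
  simp only [← ENNReal.rpow_mul, mul_one_div_cancel hr0.ne', ENNReal.rpow_one] at hH2
  rw [← ENNReal.ofReal_le_ofReal_iff (by positivity), ← Real.enorm_eq_ofReal_abs]
  refine (enorm_integral_le_lintegral_enorm _).trans ?_
  simp only [Real.enorm_eq_ofReal_abs]
  calc ∫⁻ p, ENNReal.ofReal |φ p| ∂μ
      ≤ ∫⁻ p, ENNReal.ofReal r * (ENNReal.ofReal (A p ^ r) ^ (1 - 1 / r) * H p) ∂μ := by
        refine lintegral_mono fun p => (h p).trans_eq ?_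
        rw [ENNReal.ofReal_mul hr0.le, h1, mul_assoc]
    _ = ENNReal.ofReal r * ∫⁻ p, ENNReal.ofReal (A p ^ r) ^ (1 - 1 / r) * H p ∂μ :=
        lintegral_const_mul' _ _ ENNReal.ofReal_ne_top
    _ ≤ ENNReal.ofReal r * ((∫⁻ p, ENNReal.ofReal (A p ^ r) ∂μ) ^ (1 - 1 / r) *
          ENNReal.ofReal B) := by
        gcongr
        exact hH2.trans (mul_le_mul_right hHB _)
    _ = _ := by
        rw [← ofReal_integral_eq_lintegral_ofReal hφ (Eventually.of_forall fun p =>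
          Real.rpow_nonneg (hA p).le _), ENNReal.ofReal_rpow_of_nonneg hΦ hex, mul_assoc,
          ENNReal.ofReal_mul hr0.le, ENNReal.ofReal_mul (Real.rpow_nonneg hΦ _)]

end ConvDiff

/-! ### The energy estimate between scale 0 and scale 1. -/

namespace ConvDiff

variable {n : ℕ} {per a : Fin (n + 1) → ℝ} {c : NNReal} {T : ℝ}
  {ζ f : ℝ × Space n → ℝ} {v : Fin (n + 1) → ℝ × Space n → ℝ} {r ε : ℝ}

theorem nrm_shift_zero_le (hper : ∀ i, 0 < per i) {G : ℝ × Space n → ℝ≥0∞} (hG : TameE per G)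
    {r : ℝ} (hr : 0 < r) {σ : ℝ} (hσ : σ ∈ Icc (0 : ℝ) 1) :
    nrm r (slab c a per 2 T) (fun p => G (p.1 - σ ^ 2, p.2)) ≤ nrm r (slab c a per 1 T) G := by
  simpa using nrm_slab_shift (c := c) (a := a) (T := T) hper hG hr (sq_mem_unit hσ) 0

/-- The commutator and divergence terms together, in terms of the gradient of the solution. -/
theorem Flow.nrm_comm_add_div_le (hF : Flow per ζ f v) (hper : ∀ i, 0 < per i) (i j : Fin (n + 1))
    {p q : ℝ} (hp : 0 < p) (hq : 1 ≤ q) (hr : 1 ≤ r) (hpq : 1 / r = 1 / p + 1 / q) {σ : ℝ}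
    (hσ : σ ∈ Ioc (0 : ℝ) 1) :
    nrm r (slab c a per 2 T) (fun x => ENNReal.ofReal |commTerm ζ v i j σ x.1 x.2|) +
      2 * ENNReal.ofReal σ * nrm r (slab c a per 2 T) (fun x =>
        ENNReal.ofReal |smear (gker 1) (dir (sp i) (dir (sp j) ζ)) σ x.1 x.2| *
          jacSum v (x.1 - σ ^ 2, x.2)) ≤
      3 * (kernelConst n * (nrm p (slab c a per 1 T) (jacSum v) *
        nrm q (slab c a per 1 T) (gradSum ζ))) := by
  have hσ' : σ ∈ Icc (0 : ℝ) 1 := ⟨hσ.1.le, hσ.2⟩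
  have hJ := tameE_jacSum hF.tame_vel
  have hJm := hJ.measurable
  have hW : Continuous fun x : ℝ × Space n =>
      smear (gker 1) (dir (sp i) (dir (sp j) ζ)) σ x.1 x.2 :=
    (continuous_smear 1 hper ((hF.tame_sol.dir (sp j)).dir (sp i))).comp
      (by fun_prop : Continuous fun p : ℝ × Space n => (σ, p.1, p.2))
  have h1 := hF.nrm_commTerm_le (c := c) (a := a) (T := T) hper i j hp (by linarith) hr hpq hσ
  have h2 := nrm_mul_le (μ := slab c a per 2 T)
    (F := fun x => ENNReal.ofReal |smear (gker 1) (dir (sp i) (dir (sp j) ζ)) σ x.1 x.2|)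
    (G := fun x => jacSum v (x.1 - σ ^ 2, x.2)) (by linarith : 0 < q) hp
    (by linarith : 0 < r)
    (by rw [hpq]; ring) (by fun_prop) (hJm.comp (by fun_prop)).aemeasurable
  -- The σ in front of the divergence term pays for moving one derivative of W_σ to the kernel. The
  -- factor 3 in the result is 1 for the commutator plus 2 for the divergence.
  have h3 := mul_nrm_smear_hess_le (c := c) (a := a) (T := T) hper hF.tame_sol i j hq hσ'
  calc _ ≤ kernelConst n * (nrm p (slab c a per 1 T) (jacSum v) *
          nrm q (slab c a per 1 T) (gradSum ζ)) +
        2 * (ENNReal.ofReal σ * nrm q (slab c a per 2 T)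
          (fun x => ENNReal.ofReal |smear (gker 1) (dir (sp i) (dir (sp j) ζ)) σ x.1 x.2|) *
          nrm p (slab c a per 1 T) (jacSum v)) := by
        refine add_le_add h1 ?_
        rw [mul_assoc, mul_assoc]
        gcongr
        exact h2.trans (mul_le_mul_right (nrm_shift_zero_le hper hJ hp hσ') _)
    _ ≤ kernelConst n * (nrm p (slab c a per 1 T) (jacSum v) *
          nrm q (slab c a per 1 T) (gradSum ζ)) +
        2 * (kernelConst n * nrm q (slab c a per 1 T) (gradSum ζ) *
          nrm p (slab c a per 1 T) (jacSum v)) := by gcongr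
    _ = _ := by ring

/-- The commutator and divergence terms together, in terms of the solution. -/
theorem Flow.mul_nrm_comm_add_div_le (hF : Flow per ζ f v) (hper : ∀ i, 0 < per i)
    (i j : Fin (n + 1)) {p q : ℝ} (hp : 0 < p) (hq : 1 ≤ q) (hr : 1 ≤ r)
    (hpq : 1 / r = 1 / p + 1 / q) {σ : ℝ} (hσ : σ ∈ Ioc (0 : ℝ) 1) :
    ENNReal.ofReal σ * (nrm r (slab c a per 2 T)
        (fun x => ENNReal.ofReal |commTerm ζ v i j σ x.1 x.2|) +
      2 * ENNReal.ofReal σ * nrm r (slab c a per 2 T) (fun x =>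
        ENNReal.ofReal |smear (gker 1) (dir (sp i) (dir (sp j) ζ)) σ x.1 x.2| *
          jacSum v (x.1 - σ ^ 2, x.2))) ≤
      3 * (kernelConst n * (nrm p (slab c a per 1 T) (jacSum v) *
        nrm q (slab c a per 1 T) (fun x => ENNReal.ofReal |ζ x|))) := by
  have hσ' : σ ∈ Icc (0 : ℝ) 1 := ⟨hσ.1.le, hσ.2⟩
  have hJ := tameE_jacSum hF.tame_vel
  have hJm := hJ.measurable
  have hW : Continuous fun x : ℝ × Space n =>
      smear (gker 1) (dir (sp i) (dir (sp j) ζ)) σ x.1 x.2 :=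
    (continuous_smear 1 hper ((hF.tame_sol.dir (sp j)).dir (sp i))).comp
      (by fun_prop : Continuous fun p : ℝ × Space n => (σ, p.1, p.2))
  have h1 := hF.mul_nrm_commTerm_le (c := c) (a := a) (T := T) hper i j hp (by linarith) hr hpq hσ
  have h2 := nrm_mul_le (μ := slab c a per 2 T)
    (F := fun x => ENNReal.ofReal |smear (gker 1) (dir (sp i) (dir (sp j) ζ)) σ x.1 x.2|)
    (G := fun x => jacSum v (x.1 - σ ^ 2, x.2)) (by linarith : 0 < q) hp
    (by linarith : 0 < r)
    (by rw [hpq]; ring) (by fun_prop) (hJm.comp (by fun_prop)).aemeasurable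
  -- With the additional factor σ, both derivatives of W_σ can be moved to the kernel.
  have h3 := sq_mul_nrm_smear_hess_le (c := c) (a := a) (T := T) hper hF.tame_sol i j hq hσ'
  rw [mul_add]
  calc _ ≤ kernelConst n * (nrm p (slab c a per 1 T) (jacSum v) *
          nrm q (slab c a per 1 T) (fun x => ENNReal.ofReal |ζ x|)) +
        2 * (ENNReal.ofReal σ ^ 2 * nrm q (slab c a per 2 T)
          (fun x => ENNReal.ofReal |smear (gker 1) (dir (sp i) (dir (sp j) ζ)) σ x.1 x.2|) *
          nrm p (slab c a per 1 T) (jacSum v)) := by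
        refine add_le_add h1 ?_
        have : ∀ X : ℝ≥0∞, ENNReal.ofReal σ * (2 * ENNReal.ofReal σ * X) =
            2 * (ENNReal.ofReal σ ^ 2 * X) := fun X => by ring
        rw [this, mul_assoc (ENNReal.ofReal σ ^ 2)]
        gcongr
        exact h2.trans (mul_le_mul_right (nrm_shift_zero_le hper hJ hp hσ') _)
    _ ≤ kernelConst n * (nrm p (slab c a per 1 T) (jacSum v) *
          nrm q (slab c a per 1 T) (fun x => ENNReal.ofReal |ζ x|)) +
        2 * (kernelConst n * nrm q (slab c a per 1 T) (fun x => ENNReal.ofReal |ζ x|) *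
          nrm p (slab c a per 1 T) (jacSum v)) := by gcongr
    _ = _ := by ring

theorem slab_ne_zero (hper : ∀ i, 0 < per i) (hc : c ≠ 0) {s : ℝ} (hT : s < T) :
    slab c a per s T univ ≠ 0 := by
  rw [slab_eq, Measure.smul_apply, Measure.restrict_apply_univ, Measure.volume_eq_prod,
    Measure.prod_prod]
  have h1 : volume (Icc s T) ≠ 0 := by simp [hT]
  have h2 := volume_cell_ne_zero a per hper
  simp [ENNReal.smul_def, hc, h1, h2, -Real.volume_Icc]

theorem exponent_facts (hr : 1 ≤ r) (hr2 : r < 2) :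
    1 ≤ 2 * r / (2 - r) ∧ 1 / r = 1 / 2 + 1 / (2 * r / (2 - r)) ∧
      1 ≤ 4 * r / (4 - r) ∧ 1 / r = 1 / 4 + 1 / (4 * r / (4 - r)) := by
  have h1 : 0 < 2 - r := by linarith
  have h2 : 0 < 4 - r := by linarith
  have h3 : 0 < r := by linarith
  refine ⟨?_, ?_, ?_, ?_⟩
  · rw [le_div_iff₀ h1]; linarith
  · field_simp; ring
  · rw [le_div_iff₀ h2]; linarith
  · field_simp; ring

/-- The differential inequality is applied to Φ(σ) = ∫ softAbs(W_σ)^r. The smoothing parameter ε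
makes the integrand differentiable and Φ positive, at the price of the last term, which is
proportional to ε. All norms are finite on a bounded slab, so the argument can be run in real
numbers. -/
theorem Flow.energy_le (hF : Flow per ζ f v) (hper : ∀ i, 0 < per i) (i j : Fin (n + 1))
    (hr : 1 ≤ r) (hr2 : r < 2) (hε : 0 < ε) (hc : c ≠ 0) (hT : 2 < T) (M N : ℕ) :
    (∫ p, softAbs ε (smear (gker 1) (dir (sp i) (dir (sp j) ζ)) 0 p.1 p.2) ^ r
        ∂slab c a per 2 T) ^ (1 / r) ≤
      (∫ p, softAbs ε (smear (gker 1) (dir (sp i) (dir (sp j) ζ)) 1 p.1 p.2) ^ r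
        ∂slab c a per 2 T) ^ (1 / r) +
      ((kernelConst n * nrm r (slab c a per 1 T) (fun p => ENNReal.ofReal |f p|)).toReal * M +
        (kernelConst n * nrm r (slab c a per 1 T) (gradSum f)).toReal * Real.exp (-(M : ℝ)) +
        ((3 * (kernelConst n * (nrm 2 (slab c a per 1 T) (jacSum v) *
          nrm (2 * r / (2 - r)) (slab c a per 1 T) (fun p => ENNReal.ofReal |ζ p|)))).toReal * N +
        (3 * (kernelConst n * (nrm 4 (slab c a per 1 T) (jacSum v) *
          nrm (4 * r / (4 - r)) (slab c a per 1 T) (gradSum ζ)))).toReal * Real.exp (-(N : ℝ))) +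
        (2 * (ENNReal.ofReal ε * nrm r (slab c a per 1 T) (jacSum v))).toReal) := by
  obtain ⟨hq2, he2, hq4, he4⟩ := exponent_facts hr hr2
  have hr0 : 0 < r := by linarith
  have hZ := (hF.tame_sol.dir (sp j)).dir (sp i)
  have hWc := continuous_smear 1 hper hZ
  have hdWc := fun k => continuous_smear 1 hper (hZ.dir (sp k))
  set g := dir (sp i) (dir (sp j) ζ) with hg
  have hRc := hF.continuous_commTerm hper i j
  have hFc := continuous_forceTerm hper hF.tame_force i j
  have hA : ∀ p : ℝ × Space n, ∀ σ, 0 < softAbs ε (smear (gker 1) g σ p.1 p.2) := fun p σ =>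
    softAbs_pos _ hε
  have hre : Continuous fun z : ℝ × ℝ × Space n => ((z.1, z.2.1, z.2.2) : ℝ × ℝ × Space n) := by
    fun_prop
  have hAc : ∀ q : ℝ, Continuous fun z : ℝ × ℝ × Space n =>
      softAbs ε (smear (gker 1) g z.1 z.2.1 z.2.2) ^ q := fun q =>
    (continuous_softAbs_rpow hε q).comp hWc
  have hsl : ∀ σ : ℝ, Continuous fun p : ℝ × Space n => ((σ, p.1, p.2) : ℝ × ℝ × Space n) :=
    fun σ => by fun_prop
  have hA1 : Continuous fun z : ℝ × ℝ × Space n => r * softAbs ε (smear (gker 1) g z.1 z.2.1 z.2.2)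
      ^ (r - 1) * (smear (gker 1) g z.1 z.2.1 z.2.2 /
        softAbs ε (smear (gker 1) g z.1 z.2.1 z.2.2)) :=
    ((hAc (r - 1)).const_mul r).mul (hWc.div ((continuous_softAbs ε).comp hWc) fun z =>
      (softAbs_pos _ hε).ne')
  have hvc : Continuous fun z : ℝ × ℝ × Space n => ∑ k, v k (z.2.1 - z.1 ^ 2, z.2.2) *
      smear (gker 1) (dir (sp k) g) z.1 z.2.1 z.2.2 := continuous_finsetSum _ fun k _ =>
    ((hF.tame_vel k).continuous.comp (by fun_prop)).mul (hdWc k)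
  have hdivc : Continuous fun z : ℝ × ℝ × Space n =>
      ∑ k, dir (sp k) (v k) (z.2.1 - z.1 ^ 2, z.2.2) := continuous_finsetSum _ fun k _ =>
    ((hF.tame_vel k).dir (sp k)).continuous.comp (by fun_prop)
  have h2c : Continuous fun z : ℝ × ℝ × Space n => 2 * z.1 := by fun_prop
  let F' : ℝ → ℝ × Space n → ℝ := fun σ p =>
    r * softAbs ε (smear (gker 1) g σ p.1 p.2) ^ (r - 1) *
      (smear (gker 1) g σ p.1 p.2 / softAbs ε (smear (gker 1) g σ p.1 p.2)) *
      (2 * σ * ∑ k, v k (p.1 - σ ^ 2, p.2) * smear (gker 1) (dir (sp k) g) σ p.1 p.2 +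
        commTerm ζ v i j σ p.1 p.2 - forceTerm f i j σ p.1 p.2)
  refine rpow_inv_le_of_deriv_bound hr (D := fun σ => ∫ p, F' σ p ∂slab c a per 2 T)
    (Φ := fun σ => ∫ p, softAbs ε (smear (gker 1) g σ p.1 p.2) ^ r ∂slab c a per 2 T)
    (continuousOn_integral_slab hper (hAc r)) (fun σ hσ => ?_)
    (fun σ hσ => hasDerivAt_integral_slab hper (F := fun σ p =>
      softAbs ε (smear (gker 1) g σ p.1 p.2) ^ r) (hAc r)
      (hA1.mul (((h2c.mul hvc).add hRc).sub hFc)) (fun σ hσ p hp =>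
        HasDerivAt.softAbs_rpow hε r (hF.hasDerivAt_smear hper i j ⟨hσ.1.le, hσ.2.le⟩ hp p.2))
      hσ) M N fun σ hσ => ?_
  · rw [integral_pos_iff_support_of_nonneg (fun p => Real.rpow_nonneg (hA p σ).le _)
      (integrable_slab hper ((hAc r).comp (hsl σ)) 2)]
    have : Function.support (fun p : ℝ × Space n => softAbs ε (smear (gker 1) g σ p.1 p.2) ^ r) =
        univ := by
      ext p; simpa using (Real.rpow_pos_of_pos (hA p σ) r).ne'
    rw [this]
    exact (slab_ne_zero hper hc hT).bot_lt
  · have hσ1 : σ ∈ Ioc (0 : ℝ) 1 := ⟨hσ.1, hσ.2.le⟩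
    have hσ2 : σ ∈ Icc (0 : ℝ) 1 := ⟨hσ.1.le, hσ.2.le⟩
    let I : ℝ × Space n → ℝ := fun p => r * softAbs ε (smear (gker 1) g σ p.1 p.2) ^ (r - 1) *
      (smear (gker 1) g σ p.1 p.2 / softAbs ε (smear (gker 1) g σ p.1 p.2)) *
      (commTerm ζ v i j σ p.1 p.2 - forceTerm f i j σ p.1 p.2) -
      2 * σ * (softAbs ε (smear (gker 1) g σ p.1 p.2) ^ r *
        ∑ k, dir (sp k) (v k) (p.1 - σ ^ 2, p.2))
    -- The two integrands differ by 2σ times the integrand of `integral_convection`, whose integral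
    -- vanishes. In `I` the transport is replaced by the divergence of the drift.
    have hDI : ∫ p, F' σ p ∂slab c a per 2 T = ∫ p, I p ∂slab c a per 2 T := by
      have hconv := integral_convection (c := c) (a := a) (T := T) hper hF.tame_vel hZ hε r σ 2
      have hi1 : Integrable (fun p : ℝ × Space n =>
          r * softAbs ε (smear (gker 1) g σ p.1 p.2) ^ (r - 1) *
          (smear (gker 1) g σ p.1 p.2 / softAbs ε (smear (gker 1) g σ p.1 p.2)) *
          (∑ k, v k (p.1 - σ ^ 2, p.2) * smear (gker 1) (dir (sp k) g) σ p.1 p.2) +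
          softAbs ε (smear (gker 1) g σ p.1 p.2) ^ r *
          ∑ k, dir (sp k) (v k) (p.1 - σ ^ 2, p.2)) (slab c a per 2 T) :=
        integrable_slab hper (((hA1.mul hvc).add ((hAc r).mul hdivc)).comp (hsl σ)) 2
      have hi2 : Integrable I (slab c a per 2 T) :=
        integrable_slab hper (((hA1.mul (hRc.sub hFc)).sub
          (h2c.mul ((hAc r).mul hdivc))).comp (hsl σ)) 2
      have : ∀ p, F' σ p = 2 * σ * (r * softAbs ε (smear (gker 1) g σ p.1 p.2) ^ (r - 1) *
          (smear (gker 1) g σ p.1 p.2 / softAbs ε (smear (gker 1) g σ p.1 p.2)) *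
          (∑ k, v k (p.1 - σ ^ 2, p.2) * smear (gker 1) (dir (sp k) g) σ p.1 p.2) +
          softAbs ε (smear (gker 1) g σ p.1 p.2) ^ r *
          ∑ k, dir (sp k) (v k) (p.1 - σ ^ 2, p.2)) + I p := fun p => by
        simp only [F', I]; ring
      simp only [this]
      rw [integral_add (hi1.const_mul _) hi2, integral_const_mul, hconv, mul_zero, zero_add]
    rw [hDI]
    have hJ := tameE_jacSum hF.tame_vel
    have hJm := hJ.measurable
    have hJs : Measurable fun p : ℝ × Space n => jacSum v (p.1 - σ ^ 2, p.2) :=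
      hJm.comp (by fun_prop)
    have hWm : Measurable fun p : ℝ × Space n => smear (gker 1) g σ p.1 p.2 :=
      (hWc.comp (hsl σ)).measurable
    have hAm : Measurable fun p : ℝ × Space n => softAbs ε (smear (gker 1) g σ p.1 p.2) :=
      (continuous_softAbs ε).measurable.comp hWm
    have hRm : Measurable fun p : ℝ × Space n => commTerm ζ v i j σ p.1 p.2 :=
      (hRc.comp (hsl σ)).measurable
    have hFm : Measurable fun p : ℝ × Space n => forceTerm f i j σ p.1 p.2 :=
      (hFc.comp (hsl σ)).measurable
    let H : ℝ × Space n → ℝ≥0∞ := fun p => ENNReal.ofReal |forceTerm f i j σ p.1 p.2| +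
      (ENNReal.ofReal |commTerm ζ v i j σ p.1 p.2| + 2 * ENNReal.ofReal σ *
        (ENNReal.ofReal (softAbs ε (smear (gker 1) g σ p.1 p.2)) * jacSum v (p.1 - σ ^ 2, p.2)))
    have hHm : Measurable H := by fun_prop
    refine nrm_mono_integral (A := fun p => softAbs ε (smear (gker 1) g σ p.1 p.2)) hr
      (fun p => hA p σ) (integrable_slab hper ((hAc r).comp (hsl σ)) 2) hAm hHm
      (fun p => ?_) ?_ ?_
    · set A := softAbs ε (smear (gker 1) g σ p.1 p.2) with hAdef
      have hA0 : 0 < A := hA p σ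
      have hq : |smear (gker 1) g σ p.1 p.2 / A| ≤ 1 := abs_div_softAbs_le _
      have hpow : A ^ r = A ^ (r - 1) * A := by
        rw [← Real.rpow_add_one hA0.ne', sub_add_cancel]
      have hpn : 0 ≤ A ^ (r - 1) := Real.rpow_nonneg hA0.le _
      set R := commTerm ζ v i j σ p.1 p.2
      set G := forceTerm f i j σ p.1 p.2
      set d := ∑ k, dir (sp k) (v k) (p.1 - σ ^ 2, p.2) with hd
      have hreal : |I p| ≤ r * A ^ (r - 1) * (|G| + (|R| + 2 * σ * (A * |d|))) := by
        have e1 : |r * A ^ (r - 1) * (smear (gker 1) g σ p.1 p.2 / A) * (R - G)| ≤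
            r * A ^ (r - 1) * (|R| + |G|) := by
          rw [abs_mul, abs_mul, abs_mul, abs_of_pos hr0, abs_of_nonneg hpn]
          refine mul_le_mul ?_ (abs_sub _ _) (abs_nonneg _) (by positivity)
          exact mul_le_of_le_one_right (by positivity) hq
        have e2 : |2 * σ * (A ^ r * d)| ≤ r * A ^ (r - 1) * (2 * σ * (A * |d|)) := by
          rw [abs_mul, abs_mul, abs_mul, abs_two, abs_of_pos hσ.1, abs_of_nonneg
            (Real.rpow_nonneg hA0.le r), hpow]
          have : 0 ≤ A ^ (r - 1) * (2 * σ * (A * |d|)) := by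
            have := hσ.1.le
            positivity
          nlinarith
        calc |I p| ≤ _ := abs_sub _ _
          _ ≤ _ := add_le_add e1 e2
          _ = _ := by ring
      refine (ENNReal.ofReal_le_ofReal hreal).trans ?_
      rw [ENNReal.ofReal_mul (by positivity)]
      have hσ0 := hσ.1.le
      rw [ENNReal.ofReal_add (abs_nonneg _) (by positivity),
        ENNReal.ofReal_add (abs_nonneg _) (by positivity), ENNReal.ofReal_mul (by positivity),
        ENNReal.ofReal_mul (by positivity : 0 ≤ 2 * σ), ENNReal.ofReal_mul hA0.le,
        ENNReal.ofReal_mul zero_le_two, ENNReal.ofReal_ofNat]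
      have hdiv : ENNReal.ofReal |d| ≤ jacSum v (p.1 - σ ^ 2, p.2) := by
        refine (ENNReal.ofReal_le_ofReal (Finset.abs_sum_le_sum_abs _ _)).trans ?_
        rw [ENNReal.ofReal_sum_of_nonneg fun _ _ => abs_nonneg _]
        exact Finset.sum_le_sum fun k _ => abs_dir_le_gradSum (v k) k _
      simp only [H]
      gcongr
    · have := hσ.1
      have h0 : ∀ X : ℝ≥0∞, ∀ Y : ℝ≥0∞, 0 ≤ min X.toReal (Y.toReal / σ) := fun X Y =>
        le_min ENNReal.toReal_nonneg (div_nonneg ENNReal.toReal_nonneg this.le)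
      exact add_nonneg (add_nonneg (h0 _ _) (h0 _ _)) ENNReal.toReal_nonneg
    · have hK := kernelConst_ne_top n
      have t1 : kernelConst n * nrm r (slab c a per 1 T) (fun p => ENNReal.ofReal |f p|) ≠ ⊤ :=
        ENNReal.mul_ne_top hK (nrm_ne_top hper hF.tame_force.continuous hr0 1)
      have t2 : kernelConst n * nrm r (slab c a per 1 T) (gradSum f) ≠ ⊤ :=
        ENNReal.mul_ne_top hK (nrm_gradSum_ne_top hper hF.tame_force hr 1)
      have t3 : 3 * (kernelConst n * (nrm 2 (slab c a per 1 T) (jacSum v) *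
          nrm (2 * r / (2 - r)) (slab c a per 1 T) (fun p => ENNReal.ofReal |ζ p|))) ≠ ⊤ :=
        ENNReal.mul_ne_top (by simp) (ENNReal.mul_ne_top hK (ENNReal.mul_ne_top
          (nrm_jacSum_ne_top hper hF.tame_vel (by norm_num) 1)
          (nrm_ne_top hper hF.tame_sol.continuous (by linarith) 1)))
      have t4 : 3 * (kernelConst n * (nrm 4 (slab c a per 1 T) (jacSum v) *
          nrm (4 * r / (4 - r)) (slab c a per 1 T) (gradSum ζ))) ≠ ⊤ :=
        ENNReal.mul_ne_top (by simp) (ENNReal.mul_ne_top hK (ENNReal.mul_ne_top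
          (nrm_jacSum_ne_top hper hF.tame_vel (by norm_num) 1)
          (nrm_gradSum_ne_top hper hF.tame_sol hq4 1)))
      have t5 : 2 * (ENNReal.ofReal ε * nrm r (slab c a per 1 T) (jacSum v)) ≠ ⊤ :=
        ENNReal.mul_ne_top (by simp) (ENNReal.mul_ne_top (by simp)
          (nrm_jacSum_ne_top hper hF.tame_vel hr 1))
      have h0 : ∀ X : ℝ≥0∞, ∀ Y : ℝ≥0∞, 0 ≤ min X.toReal (Y.toReal / σ) := fun X Y =>
        le_min ENNReal.toReal_nonneg (div_nonneg ENNReal.toReal_nonneg hσ.1.le)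
      rw [ENNReal.ofReal_add (add_nonneg (h0 _ _) (h0 _ _)) ENNReal.toReal_nonneg,
        ENNReal.ofReal_add (h0 _ _) (h0 _ _), ENNReal.ofReal_toReal t5, add_assoc]
      refine (nrm_add_le hr (by fun_prop) (by fun_prop)).trans (add_le_add ?_ ?_)
      · refine le_ofReal_min hσ.1 ?_ ?_
        · rw [ENNReal.ofReal_toReal t2]
          exact nrm_forceTerm_le hper hF.tame_force i j hr hσ2
        · rw [ENNReal.ofReal_toReal t1]
          exact mul_nrm_forceTerm_le hper hF.tame_force i j hr hσ2
      -- The divergence term contains softAbs(W) instead of |W|. The difference is at most ε and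
      -- produces the error term.
      · have hsoft : nrm r (slab c a per 2 T) (fun p =>
            ENNReal.ofReal (softAbs ε (smear (gker 1) g σ p.1 p.2)) * jacSum v (p.1 - σ ^ 2, p.2)) ≤
            nrm r (slab c a per 2 T) (fun p => ENNReal.ofReal |smear (gker 1) g σ p.1 p.2| *
              jacSum v (p.1 - σ ^ 2, p.2)) +
              ENNReal.ofReal ε * nrm r (slab c a per 1 T) (jacSum v) := by
          calc _ ≤ nrm r (slab c a per 2 T) (fun p =>
                ENNReal.ofReal |smear (gker 1) g σ p.1 p.2| * jacSum v (p.1 - σ ^ 2, p.2) +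
                ENNReal.ofReal ε * jacSum v (p.1 - σ ^ 2, p.2)) := nrm_mono hr0 fun p => by
                  rw [← add_mul, ← ENNReal.ofReal_add (abs_nonneg _) hε.le]
                  gcongr
                  exact softAbs_le _ hε.le
            _ ≤ _ := nrm_add_le hr (by fun_prop) (by fun_prop)
            _ ≤ _ := by
                rw [nrm_const_mul hr0 _ hJs.aemeasurable]
                gcongr
                exact nrm_shift_zero_le hper hJ hr0 hσ2
        have hσle : ENNReal.ofReal σ ≤ 1 := by simpa using hσ.2.le
        calc _ ≤ nrm r (slab c a per 2 T) (fun p => ENNReal.ofReal |commTerm ζ v i j σ p.1 p.2|) +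
              2 * ENNReal.ofReal σ * nrm r (slab c a per 2 T) (fun p =>
                ENNReal.ofReal (softAbs ε (smear (gker 1) g σ p.1 p.2)) *
                jacSum v (p.1 - σ ^ 2, p.2)) := by
              rw [← nrm_const_mul hr0 _ (by fun_prop)]
              exact nrm_add_le hr (by fun_prop) (by fun_prop)
          _ ≤ nrm r (slab c a per 2 T) (fun p => ENNReal.ofReal |commTerm ζ v i j σ p.1 p.2|) +
              2 * ENNReal.ofReal σ * (nrm r (slab c a per 2 T) (fun p =>
                ENNReal.ofReal |smear (gker 1) g σ p.1 p.2| * jacSum v (p.1 - σ ^ 2, p.2)) +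
              ENNReal.ofReal ε * nrm r (slab c a per 1 T) (jacSum v)) := by gcongr
          _ ≤ (nrm r (slab c a per 2 T) (fun p => ENNReal.ofReal |commTerm ζ v i j σ p.1 p.2|) +
              2 * ENNReal.ofReal σ * nrm r (slab c a per 2 T) (fun p =>
                ENNReal.ofReal |smear (gker 1) g σ p.1 p.2| * jacSum v (p.1 - σ ^ 2, p.2))) +
              2 * (ENNReal.ofReal ε * nrm r (slab c a per 1 T) (jacSum v)) := by
              rw [mul_add, ← add_assoc]
              gcongr
              exact mul_le_of_le_one_right' hσle
          _ ≤ _ := by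
              gcongr
              refine le_ofReal_min hσ.1 ?_ ?_
              · rw [ENNReal.ofReal_toReal t4]
                exact hF.nrm_comm_add_div_le hper i j (by norm_num) hq4 hr he4 hσ1
              · rw [ENNReal.ofReal_toReal t3]
                exact hF.mul_nrm_comm_add_div_le hper i j (by norm_num) hq2 hr he2 hσ1

end ConvDiff

/-! ### Removing the smoothing: the estimate for a flow on a bounded time interval. -/

namespace ConvDiff

variable {n : ℕ} {per a : Fin (n + 1) → ℝ} {c : NNReal} {T : ℝ}
  {ζ f : ℝ × Space n → ℝ} {v : Fin (n + 1) → ℝ × Space n → ℝ} {r : ℝ}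

theorem ofReal_integral_rpow {α : Type*} [MeasurableSpace α] {μ : Measure α} (hr : 0 < r)
    {A : α → ℝ} (hA : ∀ x, 0 ≤ A x) (hi : Integrable (fun x => A x ^ r) μ) :
    ENNReal.ofReal ((∫ x, A x ^ r ∂μ) ^ (1 / r)) = nrm r μ fun x => ENNReal.ofReal (A x) := by
  have h0 : ∀ x, 0 ≤ A x ^ r := fun x => Real.rpow_nonneg (hA x) r
  rw [← ENNReal.ofReal_rpow_of_nonneg (integral_nonneg h0) (by positivity),
    ofReal_integral_eq_lintegral_ofReal hi (Eventually.of_forall h0), nrm]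
  simp only [ENNReal.ofReal_rpow_of_nonneg (hA _) hr.le]

/-- The maximal regularity estimate for one second derivative on a bounded time interval. -/
theorem Flow.nrm_hess_le (hF : Flow per ζ f v) (hper : ∀ i, 0 < per i) (i j : Fin (n + 1))
    (hr : 1 ≤ r) (hr2 : r < 2) (hc : c ≠ 0) (hT : 2 < T) (M N : ℕ) :
    ENNReal.ofReal |∫ h : Space n, gker 1 h| * nrm r (slab c a per 2 T)
        (fun p => ENNReal.ofReal |dir (sp i) (dir (sp j) ζ) p|) ≤
      kernelConst n * nrm r (slab c a per 1 T) (fun p => ENNReal.ofReal |ζ p|) +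
      (kernelConst n * nrm r (slab c a per 1 T) (fun p => ENNReal.ofReal |f p|) * M +
        kernelConst n * nrm r (slab c a per 1 T) (gradSum f) *
          ENNReal.ofReal (Real.exp (-(M : ℝ))) +
        (3 * (kernelConst n * (nrm 2 (slab c a per 1 T) (jacSum v) *
          nrm (2 * r / (2 - r)) (slab c a per 1 T) (fun p => ENNReal.ofReal |ζ p|))) * N +
        3 * (kernelConst n * (nrm 4 (slab c a per 1 T) (jacSum v) *
          nrm (4 * r / (4 - r)) (slab c a per 1 T) (gradSum ζ))) *
            ENNReal.ofReal (Real.exp (-(N : ℝ))))) := by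
  obtain ⟨hq2, he2, hq4, he4⟩ := exponent_facts hr hr2
  have hr0 : 0 < r := by linarith
  have hZ := (hF.tame_sol.dir (sp j)).dir (sp i)
  have hWc := continuous_smear 1 hper hZ
  have hsl : ∀ σ : ℝ, Continuous fun p : ℝ × Space n => ((σ, p.1, p.2) : ℝ × ℝ × Space n) :=
    fun σ => by fun_prop
  have hW : ∀ σ, Continuous fun p : ℝ × Space n =>
      smear (gker 1) (dir (sp i) (dir (sp j) ζ)) σ p.1 p.2 := fun σ => hWc.comp (hsl σ)
  have hK := kernelConst_ne_top n
  have t1 : kernelConst n * nrm r (slab c a per 1 T) (fun p => ENNReal.ofReal |f p|) ≠ ⊤ :=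
    ENNReal.mul_ne_top hK (nrm_ne_top hper hF.tame_force.continuous hr0 1)
  have t2 : kernelConst n * nrm r (slab c a per 1 T) (gradSum f) ≠ ⊤ :=
    ENNReal.mul_ne_top hK (nrm_gradSum_ne_top hper hF.tame_force hr 1)
  have t3 : 3 * (kernelConst n * (nrm 2 (slab c a per 1 T) (jacSum v) *
      nrm (2 * r / (2 - r)) (slab c a per 1 T) (fun p => ENNReal.ofReal |ζ p|))) ≠ ⊤ :=
    ENNReal.mul_ne_top (by simp) (ENNReal.mul_ne_top hK (ENNReal.mul_ne_top
      (nrm_jacSum_ne_top hper hF.tame_vel (by norm_num) 1)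
      (nrm_ne_top hper hF.tame_sol.continuous (by linarith) 1)))
  have t4 : 3 * (kernelConst n * (nrm 4 (slab c a per 1 T) (jacSum v) *
      nrm (4 * r / (4 - r)) (slab c a per 1 T) (gradSum ζ))) ≠ ⊤ :=
    ENNReal.mul_ne_top (by simp) (ENNReal.mul_ne_top hK (ENNReal.mul_ne_top
      (nrm_jacSum_ne_top hper hF.tame_vel (by norm_num) 1)
      (nrm_gradSum_ne_top hper hF.tame_sol hq4 1)))
  have tJ := nrm_jacSum_ne_top (c := c) (a := a) (T := T) hper hF.tame_vel hr 1
  have t1' : nrm r (slab c a per 2 T) (fun _ => 1) ≠ ⊤ := by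
    have := nrm_ne_top (c := c) (a := a) (T := T) hper
      (continuous_const (y := (1 : ℝ))) hr0 2
    simpa using this
  set X := kernelConst n * nrm r (slab c a per 1 T) (fun p => ENNReal.ofReal |f p|)
  set X' := kernelConst n * nrm r (slab c a per 1 T) (gradSum f)
  set Y := 3 * (kernelConst n * (nrm 2 (slab c a per 1 T) (jacSum v) *
      nrm (2 * r / (2 - r)) (slab c a per 1 T) (fun p => ENNReal.ofReal |ζ p|)))
  set Y' := 3 * (kernelConst n * (nrm 4 (slab c a per 1 T) (jacSum v) *
      nrm (4 * r / (4 - r)) (slab c a per 1 T) (gradSum ζ)))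
  -- The total coefficient of ε: the first part comes from replacing |W_1| by its smoothing at scale
  -- 1, the second from the divergence term.
  set E := nrm r (slab c a per 2 T) (fun _ => 1) +
    2 * nrm r (slab c a per 1 T) (jacSum v) with hE
  have hEt : E ≠ ⊤ := ENNReal.add_ne_top.2 ⟨t1', ENNReal.mul_ne_top (by simp) tJ⟩
  have hzero : ENNReal.ofReal |∫ h : Space n, gker 1 h| * nrm r (slab c a per 2 T)
      (fun p => ENNReal.ofReal |dir (sp i) (dir (sp j) ζ) p|) = nrm r (slab c a per 2 T)
      (fun p => ENNReal.ofReal |smear (gker 1) (dir (sp i) (dir (sp j) ζ)) 0 p.1 p.2|) := by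
    have := hZ.continuous
    rw [← nrm_const_mul hr0 _ (by fun_prop)]
    simp only [smear_zero, abs_mul, ENNReal.ofReal_mul (abs_nonneg _), Prod.mk.eta]
  have key : ∀ ε : ℝ, 0 < ε → ENNReal.ofReal |∫ h : Space n, gker 1 h| * nrm r (slab c a per 2 T)
      (fun p => ENNReal.ofReal |dir (sp i) (dir (sp j) ζ) p|) ≤
      (kernelConst n * nrm r (slab c a per 1 T) (fun p => ENNReal.ofReal |ζ p|) +
      (X * M + X' * ENNReal.ofReal (Real.exp (-(M : ℝ))) +
        (Y * N + Y' * ENNReal.ofReal (Real.exp (-(N : ℝ)))))) + ENNReal.ofReal ε * E := by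
    intro ε hε
    have hA : ∀ σ, ∀ p : ℝ × Space n,
        0 ≤ softAbs ε (smear (gker 1) (dir (sp i) (dir (sp j) ζ)) σ p.1 p.2) := fun σ p =>
      (softAbs_pos _ hε).le
    have hi : ∀ σ, Integrable (fun p : ℝ × Space n => softAbs ε
        (smear (gker 1) (dir (sp i) (dir (sp j) ζ)) σ p.1 p.2) ^ r) (slab c a per 2 T) := fun σ =>
      integrable_slab hper ((continuous_softAbs_rpow hε r).comp (hW σ)) 2
    have hen := ENNReal.ofReal_le_ofReal
      (hF.energy_le (a := a) (c := c) hper i j hr hr2 hε hc hT M N)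
    have hp : ∀ x : ℝ≥0∞, 0 ≤ x.toReal := fun x => ENNReal.toReal_nonneg
    have hM : (0 : ℝ) ≤ M := M.cast_nonneg
    have hN : (0 : ℝ) ≤ N := N.cast_nonneg
    have hi0 : 0 ≤ (∫ p, softAbs ε (smear (gker 1) (dir (sp i) (dir (sp j) ζ)) 1 p.1 p.2) ^ r
        ∂slab c a per 2 T) ^ (1 / r) :=
      Real.rpow_nonneg (integral_nonneg fun p => Real.rpow_nonneg (hA 1 p) r) _
    rw [ENNReal.ofReal_add hi0 (by positivity), ENNReal.ofReal_add (by positivity) (by positivity),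
      ENNReal.ofReal_add (by positivity) (by positivity),
      ENNReal.ofReal_add (by positivity) (by positivity),
      ENNReal.ofReal_add (by positivity) (by positivity),
      ENNReal.ofReal_mul (hp _), ENNReal.ofReal_mul (hp _), ENNReal.ofReal_mul (hp _),
      ENNReal.ofReal_mul (hp _), ENNReal.ofReal_toReal t1, ENNReal.ofReal_toReal t2,
      ENNReal.ofReal_toReal t3, ENNReal.ofReal_toReal t4,
      ENNReal.ofReal_toReal (ENNReal.mul_ne_top (by simp) (ENNReal.mul_ne_top (by simp) tJ)),
      ofReal_integral_rpow hr0 (hA 0) (hi 0), ofReal_integral_rpow hr0 (hA 1) (hi 1),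
      ENNReal.ofReal_natCast, ENNReal.ofReal_natCast] at hen
    have hWm := (hW 1).measurable
    have hone : nrm r (slab c a per 2 T) (fun p => ENNReal.ofReal
        (softAbs ε (smear (gker 1) (dir (sp i) (dir (sp j) ζ)) 1 p.1 p.2))) ≤
        kernelConst n * nrm r (slab c a per 1 T) (fun p => ENNReal.ofReal |ζ p|) +
          ENNReal.ofReal ε * nrm r (slab c a per 2 T) (fun _ => 1) := by
      -- At σ = 1 moving both derivatives to the kernel costs nothing, so the starting value of the
      -- evolution is controlled by ζ.
      have h1 := sq_mul_nrm_smear_hess_le (c := c) (a := a) (T := T) hper hF.tame_sol i j hr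
        (σ := 1) (by simp)
      simp only [ENNReal.ofReal_one, one_pow, one_mul] at h1
      rw [← nrm_const_mul hr0 (ENNReal.ofReal ε) aemeasurable_const]
      refine le_trans ?_ (add_le_add_left h1 _)
      refine le_trans (nrm_mono hr0 fun p => ?_) (nrm_add_le hr (by fun_prop) (by fun_prop))
      rw [mul_one, ← ENNReal.ofReal_add (abs_nonneg _) hε.le]
      exact ENNReal.ofReal_le_ofReal (softAbs_le _ hε.le)
    rw [hzero]
    calc _ ≤ _ := nrm_mono hr0 fun p => ENNReal.ofReal_le_ofReal (abs_le_softAbs _)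
      _ ≤ _ := hen
      _ ≤ _ := add_le_add_left hone _
      _ = _ := by rw [hE]; ring
  refine ENNReal.le_of_forall_pos_le_add fun δ hδ _ => ?_
  -- This value of ε makes the error at most δ; the summand 1 covers the case E = 0.
  have hpos : 0 < (δ : ℝ) / (E.toReal + 1) := by
    have := E.toReal_nonneg
    positivity
  refine (key _ hpos).trans (add_le_add_right ?_ _)
  have h1 := E.toReal_nonneg
  have hEe : E = ENNReal.ofReal E.toReal := (ENNReal.ofReal_toReal hEt).symm
  generalize E.toReal = e at *
  rw [hEe, ← ENNReal.ofReal_mul hpos.le, ← ENNReal.ofReal_coe_nnreal]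
  refine ENNReal.ofReal_le_ofReal ?_
  rw [div_mul_eq_mul_div, div_le_iff₀ (by positivity)]
  nlinarith [δ.2]

end ConvDiff

/-! ### Extension in time and the periodic vertical cutoff. -/

namespace ConvDiff

variable {n : ℕ}

section extension

/-- A smooth function with positive values which is the identity on `[1 / 2, ∞)`. -/
noncomputable def timeClamp (t : ℝ) : ℝ :=
  1 / 4 + Real.smoothTransition (4 * t - 1) * (t - 1 / 4)

theorem contDiff_timeClamp : ContDiff ℝ ∞ timeClamp := by
  unfold timeClamp
  exact contDiff_const.add ((Real.smoothTransition.contDiff.comp (by fun_prop)).mul (by fun_prop))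

theorem timeClamp_nonneg (t : ℝ) : 0 ≤ timeClamp t := by
  unfold timeClamp
  rcases le_or_gt t (1 / 4) with h | h
  · rw [Real.smoothTransition.zero_of_nonpos (by linarith)]; norm_num
  · have := mul_nonneg (Real.smoothTransition.nonneg (4 * t - 1)) (by linarith : 0 ≤ t - 1 / 4)
    linarith

theorem timeClamp_eq {t : ℝ} (h : 1 / 2 ≤ t) : timeClamp t = t := by
  unfold timeClamp
  rw [Real.smoothTransition.one_of_one_le (by linarith)]; ring

/-- The function `g` after the change of time `θ`. -/
def retime {E : Type*} (θ : ℝ → ℝ) (g : ℝ → Space n → E) (p : ℝ × Space n) : E := g (θ p.1) p.2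

/-- The periods of the problem. -/
noncomputable def periods (n : ℕ) (Λ H : ℝ) : Fin (n + 1) → ℝ :=
  Fin.snoc (α := fun _ => ℝ) (fun _ => Λ) (2 * H)

theorem periods_pos {Λ H : ℝ} (hΛ : 0 < Λ) (hH : 0 < H) (i : Fin (n + 1)) :
    0 < periods n Λ H i := by
  refine Fin.lastCases ?_ (fun i => ?_) i
  · simpa [periods] using hH
  · simpa [periods] using hΛ

theorem IsPeriodic.cellPeriodic {E : Type*} {Λ H : ℝ} {g : ℝ → Space n → E}
    (hg : IsPeriodic Λ H g) {t : ℝ} (ht : 0 ≤ t) : CellPeriodic (periods n Λ H) (g t) := by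
  intro x i
  refine Fin.lastCases ?_ (fun i => ?_) i
  · simpa [periods] using (hg t ht x).2
  · simpa [periods] using (hg t ht x).1 i

/-- Smoothness is given only for nonnegative times, and composition with a nonnegative smooth clock
makes it global. Two clocks are used: `timeClamp`, which leaves times from 1/2 on unchanged, and the
square, which reaches every time down to 0. -/
theorem contDiff_retime {E : Type*} [NormedAddCommGroup E] [NormedSpace ℝ E] {θ : ℝ → ℝ}
    (hθ : ContDiff ℝ ∞ θ) (hθ0 : ∀ t, 0 ≤ θ t) {g : ℝ → Space n → E} (hg : IsSmooth g) :
    ContDiff ℝ ∞ (retime θ g) :=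
  ContDiffOn.comp_contDiff (f := fun p : ℝ × Space n => (θ p.1, p.2)) hg
    ((hθ.comp contDiff_fst).prodMk contDiff_snd) fun p => ⟨hθ0 p.1, mem_univ _⟩

theorem tame_retime {Λ H : ℝ} {θ : ℝ → ℝ} (hθ : ContDiff ℝ ∞ θ) (hθ0 : ∀ t, 0 ≤ θ t)
    {g : ℝ → Space n → ℝ} (hg : IsSmooth g) (hp : IsPeriodic Λ H g) :
    Tame (periods n Λ H) (retime θ g) :=
  ⟨contDiff_retime hθ hθ0 hg, fun t => hp.cellPeriodic (hθ0 t)⟩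

theorem tame_retime_apply {Λ H : ℝ} {θ : ℝ → ℝ} (hθ : ContDiff ℝ ∞ θ) (hθ0 : ∀ t, 0 ≤ θ t)
    {u : ℝ → Space n → Space n} (hu : IsSmooth u) (hp : IsPeriodic Λ H u) (k : Fin (n + 1)) :
    Tame (periods n Λ H) (retime θ fun t x => u t x k) :=
  ⟨(contDiff_piLp (𝕜 := ℝ) 2).1 (contDiff_retime hθ hθ0 hu) k, fun t x i =>
    congrArg (fun w : Space n => w k) (hp.cellPeriodic (hθ0 t) x i)⟩

theorem Tame.dir_sp_eq_pd {per : Fin (n + 1) → ℝ} {G : ℝ × Space n → ℝ} (hG : Tame per G)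
    (i : Fin (n + 1)) (t : ℝ) (x : Space n) :
    ConvDiff.dir (sp i) G (t, x) = pd i (fun x => G (t, x)) x := by
  have h1 : HasFDerivAt (fun x : Space n => ((t, x) : ℝ × Space n))
      ((0 : Space n →L[ℝ] ℝ).prod (ContinuousLinearMap.id ℝ (Space n))) x :=
    (hasFDerivAt_const t x).prodMk (hasFDerivAt_id x)
  have h2 := ((hG.differentiable (t, x)).hasFDerivAt.comp x h1).fderiv
  change _ = fderiv ℝ (G ∘ fun x : Space n => ((t, x) : ℝ × Space n)) x _
  rw [h2]
  simp [ConvDiff.dir, sp]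

theorem Tame.dir_dir_sp_eq_pd {per : Fin (n + 1) → ℝ} {G : ℝ × Space n → ℝ} (hG : Tame per G)
    (i j : Fin (n + 1)) (t : ℝ) (x : Space n) :
    ConvDiff.dir (sp i) (ConvDiff.dir (sp j) G) (t, x) = pd i (pd j fun x => G (t, x)) x := by
  rw [(hG.dir (sp j)).dir_sp_eq_pd]
  congr 1
  funext x
  exact hG.dir_sp_eq_pd j t x

theorem Tame.dir_time_eq_deriv {per : Fin (n + 1) → ℝ} {G : ℝ × Space n → ℝ} (hG : Tame per G)
    (t : ℝ) (x : Space n) : ConvDiff.dir (1, 0) G (t, x) = deriv (fun s => G (s, x)) t := by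
  have h1 : HasDerivAt (fun s : ℝ => ((s, x) : ℝ × Space n)) (1, 0) t :=
    (hasDerivAt_id t).prodMk (hasDerivAt_const t x)
  exact ((hG.differentiable (t, x)).hasFDerivAt.comp_hasDerivAt t h1).deriv.symm

end extension

section cutoff

theorem deriv_smoothTransition_eq_zero {x : ℝ} (h : x ≤ 0 ∨ 1 ≤ x) :
    deriv Real.smoothTransition x = 0 := by
  rcases h with h | h
  · refine IsLocalMin.deriv_eq_zero (Eventually.of_forall fun y => ?_)
    rw [Real.smoothTransition.zero_of_nonpos h]
    exact Real.smoothTransition.nonneg y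
  · refine IsLocalMax.deriv_eq_zero (Eventually.of_forall fun y => ?_)
    rw [Real.smoothTransition.one_of_one_le h]
    exact Real.smoothTransition.le_one y

theorem exists_deriv_smoothTransition_bound :
    ∃ B : ℝ, 0 ≤ B ∧ ∀ x, |deriv Real.smoothTransition x| ≤ B := by
  have hc : Continuous (deriv Real.smoothTransition) :=
    (Real.smoothTransition.contDiff (n := 1)).continuous_deriv le_rfl
  obtain ⟨B, hB⟩ := (isCompact_Icc (a := (0 : ℝ)) (b := 1)).exists_bound_of_continuousOn
    hc.continuousOn
  refine ⟨B, (norm_nonneg _).trans (hB 0 (by simp)), fun x => ?_⟩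
  have hB0 := (norm_nonneg _).trans (hB 0 (by simp))
  rcases le_or_gt x 0 with h | h
  · rw [deriv_smoothTransition_eq_zero (Or.inl h), abs_zero]; exact hB0
  · rcases le_or_gt 1 x with h' | h'
    · rw [deriv_smoothTransition_eq_zero (Or.inr h'), abs_zero]; exact hB0
    · exact hB x ⟨h.le, h'.le⟩

variable {H δ : ℝ}

/-- A smooth function of period `2 * H` comparable to the squared distance to `2 * H * ℤ`. -/
noncomputable def sinSq (H z : ℝ) : ℝ := Real.sin (Real.pi * z / (2 * H)) ^ 2

/-- A cutoff of period `2 * H` which is `1` within distance `δ` of the origin. -/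
noncomputable def cutoff (H δ z : ℝ) : ℝ := Real.smoothTransition (2 - sinSq H z / sinSq H δ)

theorem sinSq_periodic (hH : 0 < H) (z : ℝ) : sinSq H (z + 2 * H) = sinSq H z := by
  unfold sinSq
  rw [show Real.pi * (z + 2 * H) / (2 * H) = Real.pi * z / (2 * H) + Real.pi by field_simp,
    Real.sin_add_pi, neg_sq]

theorem cutoff_periodic (hH : 0 < H) (z : ℝ) : cutoff H δ (z + 2 * H) = cutoff H δ z := by
  unfold cutoff; rw [sinSq_periodic hH]

theorem contDiff_cutoff : ContDiff ℝ ∞ (cutoff H δ) := by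
  unfold cutoff sinSq
  refine Real.smoothTransition.contDiff.comp (contDiff_const.sub (ContDiff.div_const ?_ _))
  exact (Real.contDiff_sin.comp (by fun_prop)).pow 2

/-- Jordan's inequality: on [0, π/2] the sine lies above its chord. -/
theorem div_le_sin (hδ : 0 < δ) (hδH : δ ≤ H) : δ / H ≤ Real.sin (Real.pi * δ / (2 * H)) := by
  have hH : 0 < H := hδ.trans_le hδH
  have h1 : Real.pi * δ / (2 * H) ≤ Real.pi / 2 := by
    rw [div_le_div_iff₀ (by positivity) (by norm_num)]
    nlinarith [Real.pi_pos]
  have := Real.mul_le_sin (x := Real.pi * δ / (2 * H)) (by positivity) h1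
  refine le_trans (le_of_eq ?_) this
  field_simp

theorem sinSq_pos (hδ : 0 < δ) (hδH : δ ≤ H) : 0 < sinSq H δ := by
  have := div_le_sin hδ hδH
  have h2 : 0 < δ / H := div_pos hδ (hδ.trans_le hδH)
  unfold sinSq
  have : 0 < Real.sin (Real.pi * δ / (2 * H)) := by linarith
  positivity

theorem sinSq_abs (z : ℝ) : sinSq H |z| = sinSq H z := by
  unfold sinSq
  rcases abs_choice z with h | h <;> rw [h]
  rw [mul_neg, neg_div, Real.sin_neg, neg_sq]

theorem sinSq_mono (hH : 0 < H) {z w : ℝ} (h : |z| ≤ |w|) (hw : |w| ≤ H) :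
    sinSq H z ≤ sinSq H w := by
  rw [← sinSq_abs z, ← sinSq_abs w]
  unfold sinSq
  have e1 : ∀ s : ℝ, s ≤ H → Real.pi * s / (2 * H) ≤ Real.pi / 2 := fun s hs => by
    rw [div_le_div_iff₀ (by positivity) (by norm_num)]
    nlinarith [Real.pi_pos]
  have e2 : ∀ s : ℝ, 0 ≤ s → 0 ≤ Real.pi * s / (2 * H) := fun s hs => by
    have := Real.pi_pos
    positivity
  have hz0 := e2 _ (abs_nonneg z)
  have hp := Real.pi_pos
  refine pow_le_pow_left₀ (Real.sin_nonneg_of_nonneg_of_le_pi hz0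
    ((e1 _ (h.trans hw)).trans (by linarith))) ?_ 2
  refine Real.sin_le_sin_of_le_of_le_pi_div_two (by linarith) (e1 _ hw) ?_
  gcongr

theorem cutoff_eq_one (hδ : 0 < δ) (hδH : δ ≤ H) {z : ℝ} (h : sinSq H z ≤ sinSq H δ) :
    cutoff H δ z = 1 := by
  refine Real.smoothTransition.one_of_one_le ?_
  have := (div_le_one (sinSq_pos hδ hδH)).2 h
  linarith

/-- With τ = πδ/(2H) and 2τ ≤ π/2, one has sin²(2τ) = 4 sin²τ cos²τ ≥ 2 sin²τ, because cos²τ ≥ 1/2.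
Thus passing from δ to 2δ at least doubles `sinSq`, which is why the cutoff may vanish once the
quotient reaches 2. -/
theorem two_mul_sinSq_le (hδ : 0 < δ) {z : ℝ} (h : 2 * δ < |z|) (hz : |z| ≤ H) :
    2 * sinSq H δ ≤ sinSq H z := by
  have hH : 0 < H := by linarith
  have h1 : sinSq H (2 * δ) ≤ sinSq H z := by
    refine sinSq_mono hH ?_ hz
    rw [abs_of_pos (by linarith)]; exact h.le
  refine le_trans ?_ h1
  unfold sinSq
  have h2 : Real.pi * (2 * δ) / (2 * H) = 2 * (Real.pi * δ / (2 * H)) := by ring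
  rw [h2, Real.sin_two_mul]
  set τ := Real.pi * δ / (2 * H) with hτ
  have hτ1 : 2 * τ ≤ Real.pi / 2 := by
    rw [← h2, div_le_div_iff₀ (by positivity) (by norm_num)]
    nlinarith [Real.pi_pos]
  have hτ0 : 0 ≤ τ := by have := Real.pi_pos; positivity
  have hcos : 0 ≤ Real.cos (2 * τ) := Real.cos_nonneg_of_neg_pi_div_two_le_of_le (by linarith) hτ1
  rw [Real.cos_two_mul] at hcos
  nlinarith [sq_nonneg (Real.sin τ)]

theorem cutoff_eq_zero (hδ : 0 < δ) (hδH : δ ≤ H) {z : ℝ} (h : 2 * δ < |z|) (hz : |z| ≤ H) :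
    cutoff H δ z = 0 := by
  refine Real.smoothTransition.zero_of_nonpos ?_
  have := (le_div_iff₀ (sinSq_pos hδ hδH)).2 (two_mul_sinSq_le hδ h hz)
  linarith

/-- A zero of a nonnegative function is a minimum. This also covers |z| = H, where every
neighbourhood leaves the range in which the cutoff has been shown to vanish. -/
theorem deriv_cutoff_eq_zero (hδ : 0 < δ) (hδH : δ ≤ H) {z : ℝ} (h : 2 * δ < |z|) (hz : |z| ≤ H) :
    deriv (cutoff H δ) z = 0 := by
  refine IsLocalMin.deriv_eq_zero (Eventually.of_forall fun y => ?_)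
  rw [cutoff_eq_zero hδ hδH h hz]
  exact Real.smoothTransition.nonneg _

theorem abs_cutoff_le (z : ℝ) : |cutoff H δ z| ≤ 1 := by
  unfold cutoff
  rw [abs_of_nonneg (Real.smoothTransition.nonneg _)]
  exact Real.smoothTransition.le_one _

/-- The derivative is of order 1/δ uniformly in H. Where it does not vanish, sin²(πz/2H) is at most
twice sin²(πδ/2H) = b², so one factor b of the denominator is cancelled; the other is at least δ/H
and compensates the 1/H from the chain rule. -/
theorem abs_deriv_cutoff_le {B : ℝ} (hB : ∀ x, |deriv Real.smoothTransition x| ≤ B)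
    (hδ : 0 < δ) (hδH : δ ≤ H) (z : ℝ) : |deriv (cutoff H δ) z| ≤ B * (5 / δ) := by
  have hH : 0 < H := hδ.trans_le hδH
  have hB0 : 0 ≤ B := (abs_nonneg _).trans (hB 0)
  set b := Real.sin (Real.pi * δ / (2 * H)) with hb
  have hbd : δ / H ≤ b := div_le_sin hδ hδH
  have hb0 : 0 < b := (div_pos hδ hH).trans_le hbd
  have hsq : sinSq H δ = b ^ 2 := rfl
  set s := Real.sin (Real.pi * z / (2 * H)) with hs
  have hd : HasDerivAt (fun z => 2 - sinSq H z / sinSq H δ)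
      (-((2 * s * (Real.cos (Real.pi * z / (2 * H)) * (Real.pi / (2 * H)))) / b ^ 2)) z := by
    have e1 : HasDerivAt (fun z : ℝ => Real.pi * z / (2 * H)) (Real.pi / (2 * H)) z := by
      simpa using ((hasDerivAt_id z).const_mul Real.pi).div_const (2 * H)
    have e2 := (e1.sin.pow 2).div_const (b ^ 2)
    have e3 := e2.const_sub 2
    simpa [sinSq, hsq] using! e3
  have hdc : HasDerivAt (cutoff H δ) (deriv Real.smoothTransition (2 - sinSq H z / sinSq H δ) *
      (-((2 * s * (Real.cos (Real.pi * z / (2 * H)) * (Real.pi / (2 * H)))) / b ^ 2))) z :=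
    ((Real.smoothTransition.contDiff (n := 1)).differentiable (by simp) _).hasDerivAt.comp z hd
  rw [hdc.deriv]
  rcases le_or_gt (2 - sinSq H z / sinSq H δ) 0 with h | h
  · rw [deriv_smoothTransition_eq_zero (Or.inl h), zero_mul, abs_zero]; positivity
  rw [abs_mul]
  refine mul_le_mul (hB _) ?_ (abs_nonneg _) hB0
  have hs2 : s ^ 2 ≤ 2 * b ^ 2 := by
    have h1 : s ^ 2 / b ^ 2 < 2 := by
      have : s ^ 2 / b ^ 2 = sinSq H z / sinSq H δ := rfl
      linarith
    rw [div_lt_iff₀ (by positivity)] at h1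
    exact h1.le
  -- The factor 3/2 is a rational upper bound for the square root of 2.
  have hsb : |s| ≤ 3 / 2 * b := by
    refine abs_le_of_sq_le_sq ?_ (by positivity)
    nlinarith [sq_nonneg b]
  have hcos : |Real.cos (Real.pi * z / (2 * H))| ≤ 1 := Real.abs_cos_le_one _
  have hpi := Real.pi_pos
  rw [abs_neg, abs_div, abs_mul, abs_mul, abs_mul, abs_two, abs_of_pos (by positivity : 0 < b ^ 2),
    abs_of_pos (by positivity : 0 < Real.pi / (2 * H)), div_le_div_iff₀ (by positivity) hδ]
  have h1 : |Real.cos (Real.pi * z / (2 * H))| * (Real.pi / (2 * H)) ≤ Real.pi / (2 * H) :=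
    mul_le_of_le_one_left (by positivity) hcos
  have h2 : δ ≤ b * H := by rwa [div_le_iff₀ hH] at hbd
  calc 2 * |s| * (|Real.cos (Real.pi * z / (2 * H))| * (Real.pi / (2 * H))) * δ
      ≤ 2 * (3 / 2 * b) * (Real.pi / (2 * H)) * (b * H) := by gcongr
    _ = 3 / 2 * Real.pi * b ^ 2 := by field_simp
    -- Numerically 3π/2 < 1.5 · 3.15 < 5.
    _ ≤ 5 * b ^ 2 := by
        have := Real.pi_lt_d2
        gcongr
        linarith

end cutoff

end ConvDiff

/-! ### Averages in layer coordinates and the vertical Poincaré inequality. -/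

namespace ConvDiff

variable {n : ℕ} {Λ H T s m : ℝ}

/-- The lower corner of the vertically centred cell. -/
noncomputable def corner (n : ℕ) (H : ℝ) : Fin (n + 1) → ℝ :=
  Fin.snoc (α := fun _ => ℝ) (fun _ => 0) (-H)

/-- The horizontal cell of periodicity. -/
def box (n : ℕ) (Λ : ℝ) : Set (Fin n → ℝ) := Set.pi univ fun _ => Ico (0 : ℝ) Λ

theorem continuous_point : Continuous fun q : ℝ × (Fin n → ℝ) => (point q.2 q.1 : Space n) := by
  refine (PiLp.continuous_toLp 2 _).comp (continuous_pi fun i => ?_)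
  refine Fin.lastCases ?_ (fun i => ?_) i
  · simpa using continuous_fst
  · simp only [Fin.snoc_castSucc]
    fun_prop

theorem measurePreserving_point :
    MeasurePreserving (fun q : ℝ × (Fin n → ℝ) => (point q.2 q.1 : Space n)) volume volume := by
  have h1 := (volume_preserving_piFinSuccAbove (fun _ : Fin (n + 1) => ℝ) (Fin.last n)).symm
  have h2 := (PiLp.volume_preserving_toLp (Fin (n + 1))).comp h1
  convert! h2 using 1
  funext q
  simp only [point, Function.comp_apply]
  congr 1
  exact (Fin.insertNth_last' q.1 q.2).symm

theorem lintegral_cell {G : Space n → ℝ≥0∞} (hG : Measurable G) :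
    ∫⁻ x in cell (corner n H) (periods n Λ H), G x =
      ∫⁻ z in Icc (-H) H, ∫⁻ y in box n Λ, G (point y z) := by
  have hpre : (fun q : ℝ × (Fin n → ℝ) => (point q.2 q.1 : Space n)) ⁻¹'
      cell (corner n H) (periods n Λ H) = Ico (-H) H ×ˢ box n Λ := by
    ext q
    simp only [cell, mem_preimage, mem_ofPred_eq, mem_prod, box, Set.mem_pi, mem_univ, true_imp_iff,
      Fin.forall_fin_succ', point, corner, periods, Fin.snoc_castSucc, Fin.snoc_last, zero_add]
    rw [and_comm, show -H + 2 * H = H by ring]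
  rw [← measurePreserving_point.setLIntegral_comp_preimage (measurableSet_cell _ _) hG, hpre,
    Measure.volume_eq_prod, ← Measure.prod_restrict, lintegral_prod]
  · exact setLIntegral_congr Ico_ae_eq_Icc
  · exact (hG.comp continuous_point.measurable).aemeasurable

/-- The normalizing constant of the averages over time and the horizontal cell. -/
noncomputable def meanConst (n : ℕ) (Λ T : ℝ) : NNReal := (Real.toNNReal T)⁻¹ * (Real.toNNReal (Λ ^ n))⁻¹

theorem coe_meanConst (hΛ : 0 < Λ) (hT : 0 < T) : (meanConst n Λ T : ℝ≥0∞) =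
    (ENNReal.ofReal T)⁻¹ * (ENNReal.ofReal (Λ ^ n))⁻¹ := by
  have h1 : T.toNNReal ≠ 0 := by simpa using hT
  have h2 : (Λ ^ n).toNNReal ≠ 0 := by simpa using pow_pos hΛ n
  rw [meanConst, ENNReal.coe_mul, ENNReal.coe_inv h1, ENNReal.coe_inv h2]
  rfl

theorem meanConst_ne_zero (hΛ : 0 < Λ) (hT : 0 < T) : meanConst n Λ T ≠ 0 := by
  have h1 : T.toNNReal ≠ 0 := by simpa using hT
  have h2 : (Λ ^ n).toNNReal ≠ 0 := by simpa using pow_pos hΛ n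
  exact mul_ne_zero (inv_ne_zero h1) (inv_ne_zero h2)

/-- Normalized Lebesgue measure on the product of `[s, T]` and the cell of periodicity. -/
noncomputable def meanSlab (n : ℕ) (Λ H s T : ℝ) : Measure (ℝ × Space n) :=
  slab (meanConst n Λ T) (corner n H) (periods n Λ H) s T

/-- The horizontal strip `|z| ≤ m`. -/
def strip (n : ℕ) (m : ℝ) : Set (ℝ × Space n) := {p | |height p.2| ≤ m}

theorem continuous_height : Continuous (height : Space n → ℝ) := by
  unfold height; fun_prop

theorem measurableSet_strip (m : ℝ) : MeasurableSet (strip n m) :=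
  (isClosed_le (by have := continuous_height (n := n); fun_prop) continuous_const).measurableSet

@[simp]
theorem height_point (y : Fin n → ℝ) (z : ℝ) : height (point y z) = z := by
  simp [height, point]

theorem measurable_slice {G : ℝ × Space n → ℝ≥0∞} (hG : Measurable G) :
    Measurable fun q : (ℝ × ℝ) × (Fin n → ℝ) => G (q.1.2, point q.2 q.1.1) := by
  have : Continuous fun q : (ℝ × ℝ) × (Fin n → ℝ) => (point q.2 q.1.1 : Space n) :=
    continuous_point.comp (by fun_prop : Continuous fun q : (ℝ × ℝ) × (Fin n → ℝ) => (q.1.1, q.2))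
  exact hG.comp (by fun_prop)

theorem measurable_sliceMean_inner {G : ℝ × Space n → ℝ≥0∞} (hG : Measurable G) (c : ℝ≥0∞) :
    Measurable fun q : ℝ × ℝ => c * ∫⁻ y in box n Λ, G (q.2, point y q.1) :=
  (Measurable.lintegral_prod_right' (ν := volume.restrict (box n Λ)) (measurable_slice hG)).const_mul
    c

theorem lintegral_meanSlab (hΛ : 0 < Λ) (hT : 0 < T) {G : ℝ × Space n → ℝ≥0∞}
    (hG : Measurable G) : ∫⁻ p, G p ∂meanSlab n Λ H s T =
      ∫⁻ z in Icc (-H) H, (ENNReal.ofReal T)⁻¹ * ∫⁻ t in Icc s T, (ENNReal.ofReal (Λ ^ n))⁻¹ *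
        ∫⁻ y in box n Λ, G (t, point y z) := by
  have hc1 : (ENNReal.ofReal T)⁻¹ ≠ ⊤ := by simpa using hT
  have hc2 : (ENNReal.ofReal (Λ ^ n))⁻¹ ≠ ⊤ := by simpa using pow_pos hΛ n
  unfold meanSlab slab
  rw [lintegral_prod _ hG.aemeasurable, lintegral_smul_measure, ENNReal.smul_def,
    coe_meanConst hΛ hT]
  have h1 : ∀ t, ∫⁻ x in cell (corner n H) (periods n Λ H), G (t, x) =
      ∫⁻ z in Icc (-H) H, ∫⁻ y in box n Λ, G (t, point y z) := fun t =>
    lintegral_cell (hG.comp (by fun_prop))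
  simp only [h1]
  rw [lintegral_lintegral_swap]
  · rw [smul_eq_mul, mul_assoc, ← lintegral_const_mul' _ _ hc2, ← lintegral_const_mul' _ _ hc1]
    congr 1
    funext z
    rw [lintegral_const_mul' _ _ hc2]
  · have := measurable_sliceMean_inner (Λ := Λ) hG 1
    simp only [one_mul] at this
    exact (this.comp measurable_swap).aemeasurable

theorem lintegral_meanSlab_strip (hΛ : 0 < Λ) (hT : 0 < T) (hm : m ≤ H) {G : ℝ × Space n → ℝ≥0∞}
    (hG : Measurable G) : ∫⁻ p in strip n m, G p ∂meanSlab n Λ H s T =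
      ∫⁻ z in Icc (-m) m, (ENNReal.ofReal T)⁻¹ * ∫⁻ t in Icc s T, (ENNReal.ofReal (Λ ^ n))⁻¹ *
        ∫⁻ y in box n Λ, G (t, point y z) := by
  rw [← lintegral_indicator (measurableSet_strip m),
    lintegral_meanSlab hΛ hT (hG.indicator (measurableSet_strip m))]
  have h1 : ∀ z, (ENNReal.ofReal T)⁻¹ * ∫⁻ t in Icc s T, (ENNReal.ofReal (Λ ^ n))⁻¹ *
        ∫⁻ y in box n Λ, (strip n m).indicator G (t, point y z) =
      (Icc (-m) m).indicator (fun z => (ENNReal.ofReal T)⁻¹ * ∫⁻ t in Icc s T,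
        (ENNReal.ofReal (Λ ^ n))⁻¹ * ∫⁻ y in box n Λ, G (t, point y z)) z := fun z => by
    by_cases hz : z ∈ Icc (-m) m
    · rw [indicator_of_mem hz]
      have : ∀ t (y : Fin n → ℝ), (t, point y z) ∈ strip n m := fun t y => by
        simpa [strip, abs_le] using hz
      simp only [indicator_of_mem (this _ _)]
    · rw [indicator_of_notMem hz]
      have : ∀ t (y : Fin n → ℝ), (t, point y z) ∉ strip n m := fun t y => by
        simpa [strip, abs_le] using hz
      simp [indicator_of_notMem (this _ _)]
  simp only [h1]
  rw [setLIntegral_indicator measurableSet_Icc, inter_eq_left.2]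
  exact Icc_subset_Icc (by linarith) hm

/-- The vertical integral of the averages up to time `T`. -/
noncomputable def sliceMean (Λ T a b : ℝ) (g : ℝ → Space n → ℝ) : ℝ≥0∞ :=
  ∫⁻ z in Icc a b, partialMean Λ T g z

/-- The slab measure is normalised by 1/T although it covers only [s,T]. Enlarging the time interval
to (0,T] and the height range to [a,b] therefore gives the averages of the statement without an
extra constant. -/
theorem lintegral_strip_le_sliceMean (hΛ : 0 < Λ) (hT : 0 < T) (hm : m ≤ H) (hs : 0 < s)
    {a b : ℝ} (ha : a ≤ -m) (hb : m ≤ b)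
    {G : ℝ × Space n → ℝ≥0∞} (hG : Measurable G) {g : ℝ → Space n → ℝ}
    (h : ∀ t ∈ Icc s T, ∀ x, G (t, x) ≤ ENNReal.ofReal (g t x)) :
    ∫⁻ p in strip n m, G p ∂meanSlab n Λ H s T ≤ sliceMean Λ T a b g := by
  rw [lintegral_meanSlab_strip hΛ hT hm hG]
  refine (lintegral_mono fun z => ?_).trans (lintegral_mono_set (Icc_subset_Icc ha hb))
  unfold partialMean
  gcongr _ * ?_
  refine le_trans (setLIntegral_mono' measurableSet_Icc fun t ht => ?_) (lintegral_mono_set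
    fun t (ht : t ∈ Icc s T) => (⟨hs.trans_le ht.1, ht.2⟩ : t ∈ Ioc 0 T))
  exact mul_le_mul' le_rfl (lintegral_mono fun y => h t ht _)

theorem ae_meanSlab_strip : ∀ᵐ p ∂meanSlab n Λ H s T, p ∈ strip n H := by
  unfold meanSlab
  refine ae_slab fun p hp => ?_
  have := hp.2 (Fin.last n)
  simp only [corner, periods, Fin.snoc_last, mem_Ico] at this
  simp only [strip, mem_ofPred_eq, height, abs_le]
  constructor <;> linarith

theorem point_eq_add_single (y : Fin n → ℝ) (z : ℝ) :
    (point y z : Space n) = point y 0 + EuclideanSpace.single (Fin.last n) z := by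
  ext i
  refine Fin.lastCases ?_ (fun i => ?_) i <;> simp [point]

/-- A function vanishing at height zero is controlled by its vertical derivative. -/
theorem ofReal_abs_le_lintegral {per : Fin (n + 1) → ℝ} {U : ℝ × Space n → ℝ} (hU : Tame per U)
    (h0 : ∀ t x, height x = 0 → U (t, x) = 0) (t : ℝ) (y : Fin n → ℝ) {z : ℝ}
    (hz : z ∈ Icc (-m) m) : ENNReal.ofReal |U (t, point y z)| ≤
      ∫⁻ w in Icc (-m) m, ENNReal.ofReal |dir (sp (Fin.last n)) U (t, point y w)| := by
  have hm : 0 ≤ m := by linarith [hz.1, hz.2]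
  have hd := hU.hasDerivAt_space t (point y 0) (Fin.last n)
  simp only [← point_eq_add_single] at hd
  have hc : Continuous fun w => dir (sp (Fin.last n)) U (t, point y w) := by
    refine (hU.dir _).continuous.comp (continuous_const.prodMk ?_)
    exact continuous_point.comp (by fun_prop : Continuous fun w : ℝ => (w, y))
  have hftc := intervalIntegral.integral_eq_sub_of_hasDerivAt (a := 0) (b := z)
    (fun w _ => hd w) (hc.intervalIntegrable _ _)
  rw [h0 t (point y 0) (height_point y 0), sub_zero] at hftc
  rw [← hftc, ← Real.enorm_eq_ofReal_abs]
  have h1 : ‖∫ w in (0 : ℝ)..z, dir (sp (Fin.last n)) U (t, point y w)‖ₑ =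
      ‖∫ w in uIoc 0 z, dir (sp (Fin.last n)) U (t, point y w)‖ₑ := by
    rw [← ofReal_norm, ← ofReal_norm,
      intervalIntegral.norm_intervalIntegral_eq]
  rw [h1]
  refine (enorm_integral_le_lintegral_enorm _).trans ?_
  simp only [Real.enorm_eq_ofReal_abs]
  refine lintegral_mono_set fun w hw => ?_
  have hw' := uIoc_subset_uIcc hw
  rw [mem_uIcc] at hw'
  rcases hw' with h | h
  · exact ⟨by linarith, by linarith [hz.2]⟩
  · exact ⟨by linarith [hz.1], by linarith⟩

/-- Poincaré's inequality in the vertical direction. On each vertical line the value is bounded by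
the integral of the vertical derivative over the strip; Jensen gives (2m)^{p-1}, and integrating the
resulting bound, constant in z, gives one further factor 2m. -/
theorem nrm_strip_le_vertical_deriv (hΛ : 0 < Λ) (hT : 0 < T) (hm : 0 ≤ m) (hmH : m ≤ H)
    {per : Fin (n + 1) → ℝ} {U : ℝ × Space n → ℝ} (hU : Tame per U)
    (h0 : ∀ t x, height x = 0 → U (t, x) = 0) {p : ℝ} (hp : 1 ≤ p) :
    nrm p ((meanSlab n Λ H s T).restrict (strip n m)) (fun x => ENNReal.ofReal |U x|) ≤
      ENNReal.ofReal (2 * m) * nrm p ((meanSlab n Λ H s T).restrict (strip n m))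
        (fun x => ENNReal.ofReal |dir (sp (Fin.last n)) U x|) := by
  have hp0 : 0 < p := by linarith
  have hUc := hU.continuous
  have hDc := (hU.dir (sp (Fin.last n))).continuous
  set D := dir (sp (Fin.last n)) U with hD
  have hDm : Measurable fun x => ENNReal.ofReal |D x| := by fun_prop
  have hc1 : (ENNReal.ofReal T)⁻¹ ≠ ⊤ := by simpa using hT
  have hc2 : (ENNReal.ofReal (Λ ^ n))⁻¹ ≠ ⊤ := by simpa using pow_pos hΛ n
  have hvol : volume (Icc (-m) m) = ENNReal.ofReal (2 * m) := by
    rw [Real.volume_Icc]; congr 1; ring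
  have key : ∀ t y, ∀ z ∈ Icc (-m) m, ENNReal.ofReal |U (t, point y z)| ^ p ≤
      ENNReal.ofReal (2 * m) ^ (p - 1) *
        ∫⁻ w in Icc (-m) m, ENNReal.ofReal |D (t, point y w)| ^ p := by
    intro t y z hz
    refine (ENNReal.rpow_le_rpow (ofReal_abs_le_lintegral hU h0 t y hz) hp0.le).trans ?_
    have hmeas : Measurable fun w => ENNReal.ofReal |D (t, point y w)| := by
      have : Continuous fun w : ℝ => (point y w : Space n) :=
        continuous_point.comp (by fun_prop : Continuous fun w : ℝ => (w, y))
      exact hDm.comp (by fun_prop)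
    have := lintegral_rpow_le (μ := volume.restrict (Icc (-m) m)) hp hmeas.aemeasurable
    rwa [Measure.restrict_apply_univ, hvol] at this
  have hswap : ∀ t, ∫⁻ y in box n Λ, ∫⁻ w in Icc (-m) m, ENNReal.ofReal |D (t, point y w)| ^ p =
      ∫⁻ w in Icc (-m) m, ∫⁻ y in box n Λ, ENNReal.ofReal |D (t, point y w)| ^ p := fun t => by
    refine lintegral_lintegral_swap (Measurable.aemeasurable ?_)
    have : Measurable fun q : (Fin n → ℝ) × ℝ => ((q.2, t), q.1) := by fun_prop
    exact (measurable_slice (hDm.pow_const p)).comp this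
  have hswap2 : ∫⁻ t in Icc s T, ∫⁻ w in Icc (-m) m, ∫⁻ y in box n Λ,
      ENNReal.ofReal |D (t, point y w)| ^ p = ∫⁻ w in Icc (-m) m, ∫⁻ t in Icc s T,
      ∫⁻ y in box n Λ, ENNReal.ofReal |D (t, point y w)| ^ p := by
    refine lintegral_lintegral_swap (Measurable.aemeasurable ?_)
    have := measurable_sliceMean_inner (Λ := Λ) (hDm.pow_const p) 1
    simp only [one_mul] at this
    exact this.comp measurable_swap
  have hmain : ∫⁻ x in strip n m, ENNReal.ofReal |U x| ^ p ∂meanSlab n Λ H s T ≤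
      ENNReal.ofReal (2 * m) ^ p *
        ∫⁻ x in strip n m, ENNReal.ofReal |D x| ^ p ∂meanSlab n Λ H s T := by
    rw [lintegral_meanSlab_strip hΛ hT hmH (by fun_prop),
      lintegral_meanSlab_strip hΛ hT hmH (by fun_prop)]
    calc _ ≤ ∫⁻ z in Icc (-m) m, (ENNReal.ofReal T)⁻¹ * ∫⁻ t in Icc s T,
          (ENNReal.ofReal (Λ ^ n))⁻¹ * ∫⁻ y in box n Λ, ENNReal.ofReal (2 * m) ^ (p - 1) *
            ∫⁻ w in Icc (-m) m, ENNReal.ofReal |D (t, point y w)| ^ p := by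
          refine setLIntegral_mono' measurableSet_Icc fun z hz => ?_
          gcongr with t y
          exact key t y z hz
      _ = ENNReal.ofReal (2 * m) ^ (p - 1) * ENNReal.ofReal (2 * m) * ∫⁻ w in Icc (-m) m,
          (ENNReal.ofReal T)⁻¹ * ∫⁻ t in Icc s T, (ENNReal.ofReal (Λ ^ n))⁻¹ *
          ∫⁻ y in box n Λ, ENNReal.ofReal |D (t, point y w)| ^ p := by
          have hc3 : ENNReal.ofReal (2 * m) ^ (p - 1) ≠ ⊤ :=
            ENNReal.rpow_ne_top_of_nonneg (by linarith) ENNReal.ofReal_ne_top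
          simp only [lintegral_const_mul' _ _ hc1, lintegral_const_mul' _ _ hc2,
            lintegral_const_mul' _ _ hc3, hswap, hswap2, setLIntegral_const, hvol]
          ring
      _ = _ := by
          congr 1
          rcases hm.eq_or_lt with h | h
          · rw [← h]; simp [ENNReal.zero_rpow_of_pos hp0]
          · conv_lhs => rw [← ENNReal.rpow_one (ENNReal.ofReal (2 * m)), ← ENNReal.rpow_mul]
            rw [← ENNReal.rpow_add _ _ (by simpa using h) ENNReal.ofReal_ne_top]
            congr 1; ring
  have := ENNReal.rpow_le_rpow hmain (z := 1 / p) (by positivity)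
  rwa [ENNReal.mul_rpow_of_nonneg _ _ (by positivity), ← ENNReal.rpow_mul,
    mul_one_div_cancel hp0.ne', ENNReal.rpow_one] at this

end ConvDiff

/-! ### Reduction of the layer problem to a flow with cut off drift. -/

namespace ConvDiff

variable {n : ℕ} {Λ H δ : ℝ} {ζ f : ℝ → Space n → ℝ} {u : ℝ → Space n → Space n}

/-- A smooth periodic solution of the convection-diffusion equation, supported near the bottom of
a layer, with a solenoidal drift which vanishes at the bottom. -/
structure Transport (Λ H δ : ℝ) (ζ f : ℝ → Space n → ℝ) (u : ℝ → Space n → Space n) : Prop where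
  length_pos : 0 < Λ
  width_pos : 0 < δ
  width_le : δ ≤ H
  smooth_sol : IsSmooth ζ
  smooth_vel : IsSmooth u
  smooth_force : IsSmooth f
  periodic_sol : IsPeriodic Λ H ζ
  periodic_vel : IsPeriodic Λ H u
  periodic_force : IsPeriodic Λ H f
  equation : ∀ t : ℝ, 0 < t → ∀ x : Space n,
    deriv (fun s => ζ s x) t + ∑ i, u t x i * pd i (ζ t) x - laplace (ζ t) x = f t x
  divergence_eq : ∀ t : ℝ, 0 ≤ t → ∀ x : Space n, divergence (u t) x = 0
  no_slip : ∀ t : ℝ, 0 ≤ t → ∀ x : Space n, height x = 0 → u t x = 0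
  support : ∀ t : ℝ, 0 ≤ t → ∀ x : Space n, |height x| ≤ H → ζ t x ≠ 0 → |height x| ≤ δ

/-- The drift, extended in time and cut off near the bottom. -/
noncomputable def cutVel (H δ : ℝ) (u : ℝ → Space n → Space n) (k : Fin (n + 1))
    (p : ℝ × Space n) : ℝ :=
  cutoff H δ (height p.2) * retime timeClamp (fun t x => u t x k) p

theorem exists_height_shift (hH : 0 < H) (z : ℝ) : ∃ k : ℤ, |z - k * (2 * H)| ≤ H := by
  refine ⟨round (z / (2 * H)), ?_⟩
  have h := abs_sub_round (z / (2 * H))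
  have h2 : z - round (z / (2 * H)) * (2 * H) = (z / (2 * H) - round (z / (2 * H))) * (2 * H) := by
    field_simp
  rw [h2, abs_mul, abs_of_pos (by linarith : 0 < 2 * H)]
  nlinarith

theorem height_add_single (x : Space n) (s : ℝ) :
    height (x + EuclideanSpace.single (Fin.last n) s) = height x + s := by
  simp [height]

theorem tame_cutoff (hH : 0 < H) :
    Tame (periods n Λ H) fun p : ℝ × Space n => cutoff H δ (height p.2) := by
  refine ⟨contDiff_cutoff.comp ?_, fun t x i => ?_⟩
  · unfold height; fun_prop
  · refine Fin.lastCases ?_ (fun i => ?_) i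
    · simp [height_add_single, periods, cutoff_periodic hH]
    · simp [height, periods]

theorem dir_sp_height_comp {η : ℝ → ℝ} (hη : ContDiff ℝ ∞ η) (j : Fin (n + 1)) (p : ℝ × Space n) :
    dir (sp j) (fun p : ℝ × Space n => η (height p.2)) p =
      if j = Fin.last n then deriv η (height p.2) else 0 := by
  have h1 : HasFDerivAt (fun p : ℝ × Space n => height p.2)
      ((EuclideanSpace.proj (Fin.last n) : Space n →L[ℝ] ℝ).comp
        (ContinuousLinearMap.snd ℝ ℝ (Space n))) p :=
    ((EuclideanSpace.proj (Fin.last n) : Space n →L[ℝ] ℝ).comp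
      (ContinuousLinearMap.snd ℝ ℝ (Space n))).hasFDerivAt
  have h2 : HasDerivAt η (deriv η (height p.2)) (height p.2) :=
    (hη.differentiable (by simp) _).hasDerivAt
  have h3 := (h2.comp_hasFDerivAt p h1).fderiv
  change fderiv ℝ (η ∘ fun p : ℝ × Space n => height p.2) p (sp j) = _
  rw [h3]
  by_cases hj : j = Fin.last n
  · simp [sp, hj]
  · simp [sp, hj, Ne.symm hj]

namespace Transport

variable (h : Transport Λ H δ ζ f u)
include h

theorem height_pos : 0 < H := h.width_pos.trans_le h.width_le

theorem periods_pos (i : Fin (n + 1)) : 0 < periods n Λ H i :=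
  ConvDiff.periods_pos h.length_pos h.height_pos i

theorem tame_sol {θ : ℝ → ℝ} (hθ : ContDiff ℝ ∞ θ) (hθ0 : ∀ t, 0 ≤ θ t) :
    Tame (periods n Λ H) (retime θ ζ) := tame_retime hθ hθ0 h.smooth_sol h.periodic_sol

theorem tame_force {θ : ℝ → ℝ} (hθ : ContDiff ℝ ∞ θ) (hθ0 : ∀ t, 0 ≤ θ t) :
    Tame (periods n Λ H) (retime θ f) := tame_retime hθ hθ0 h.smooth_force h.periodic_force

theorem tame_vel {θ : ℝ → ℝ} (hθ : ContDiff ℝ ∞ θ) (hθ0 : ∀ t, 0 ≤ θ t) (k : Fin (n + 1)) :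
    Tame (periods n Λ H) (retime θ fun t x => u t x k) :=
  tame_retime_apply hθ hθ0 h.smooth_vel h.periodic_vel k

theorem tame_cutVel (k : Fin (n + 1)) : Tame (periods n Λ H) (cutVel H δ u k) :=
  (tame_cutoff h.height_pos).mul (h.tame_vel contDiff_timeClamp timeClamp_nonneg k)

/-- The support condition concerns one vertical period only. Shifting by a multiple of 2H brings the
point into |z| ≤ H, and `sinSq` has the same period, so it describes the support on all of space. -/
theorem sinSq_le_of_ne_zero {t : ℝ} (ht : 0 ≤ t) {x : Space n} (hx : ζ t x ≠ 0) :
    sinSq H (height x) ≤ sinSq H δ := by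
  obtain ⟨k, hk⟩ := exists_height_shift h.height_pos (height x)
  have hP : Function.Periodic (fun s => ζ t (x + EuclideanSpace.single (Fin.last n) s)) (2 * H) :=
    fun s => by
      have := (h.periodic_sol t ht (x + EuclideanSpace.single (Fin.last n) s)).2
      have hs : EuclideanSpace.single (Fin.last n) (s + 2 * H) = EuclideanSpace.single (Fin.last n) s +
          EuclideanSpace.single (Fin.last n) (2 * H) := by
        exact PiLp.single_add 2 _
      simpa only [hs, add_assoc] using this
  have hS : Function.Periodic (sinSq H) (2 * H) := sinSq_periodic h.height_pos
  have h1 := hP.sub_int_mul_eq k (x := 0)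
  simp only [zero_sub] at h1
  have h0 : x + EuclideanSpace.single (Fin.last n) (0 : ℝ) = x := by simp
  rw [h0] at h1
  have hz := height_add_single x (-(k * (2 * H)))
  rw [← sub_eq_add_neg] at hz
  have h3 := h.support t ht (x + EuclideanSpace.single (Fin.last n) (-(k * (2 * H))))
    (by rw [hz]; exact hk) (by rw [h1]; exact hx)
  rw [hz] at h3
  rw [← hS.sub_int_mul_eq k]
  refine sinSq_mono h.height_pos ?_ ?_ <;> rw [abs_of_pos h.width_pos]
  · exact h3
  · exact h.width_le

theorem cutoff_eq_one_of_ne_zero {t : ℝ} (ht : 0 ≤ t) {x : Space n} (hx : ζ t x ≠ 0) :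
    cutoff H δ (height x) = 1 :=
  cutoff_eq_one h.width_pos h.width_le (h.sinSq_le_of_ne_zero ht hx)

/-- Either the cutoff equals 1 at the point, or `sinSq` strictly exceeds its value at δ. The latter
condition is open, so ζ vanishes in a neighbourhood together with its derivatives. Hence cutting off
the drift does not change the convective term. -/
theorem cutoff_mul_dir_sol (b p : ℝ × Space n) :
    cutoff H δ (height p.2) * dir b (retime timeClamp ζ) p = dir b (retime timeClamp ζ) p := by
  rcases le_or_gt (sinSq H (height p.2)) (sinSq H δ) with hp | hp
  · rw [cutoff_eq_one h.width_pos h.width_le hp, one_mul]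
  · have hc : Continuous fun q : ℝ × Space n => sinSq H (height q.2) := by
      have := continuous_height (n := n)
      unfold sinSq; fun_prop
    have : retime timeClamp ζ =ᶠ[nhds p] fun _ => 0 := by
      filter_upwards [hc.continuousAt.eventually_const_lt hp] with q hq
      by_contra hne
      exact absurd (h.sinSq_le_of_ne_zero (timeClamp_nonneg q.1) hne) (not_le.2 hq)
    simp [dir, this.fderiv_eq]

theorem flow : Flow (periods n Λ H) (retime timeClamp ζ) (retime timeClamp f) (cutVel H δ u) where
  tame_sol := h.tame_sol contDiff_timeClamp timeClamp_nonneg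
  tame_force := h.tame_force contDiff_timeClamp timeClamp_nonneg
  tame_vel := h.tame_cutVel
  equation := by
    rintro ⟨t, x⟩ (ht : 1 / 2 < t)
    have hZ := h.tame_sol contDiff_timeClamp timeClamp_nonneg
    have hslice : (fun x => retime timeClamp ζ (t, x)) = ζ t := by
      funext x; simp [retime, timeClamp_eq ht.le]
    have hdt : dir (1, 0) (retime timeClamp ζ) (t, x) = deriv (fun s => ζ s x) t := by
      rw [hZ.dir_time_eq_deriv]
      refine Filter.EventuallyEq.deriv_eq ?_
      filter_upwards [eventually_gt_nhds ht] with s hs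
      simp [retime, timeClamp_eq hs.le]
    have heq := h.equation t (by linarith) x
    have hv : ∀ k, cutVel H δ u k (t, x) * dir (sp k) (retime timeClamp ζ) (t, x) =
        u t x k * pd k (ζ t) x := fun k => by
      have := h.cutoff_mul_dir_sol (sp k) (t, x)
      rw [hZ.dir_sp_eq_pd, hslice] at this
      simp only [cutVel, retime, timeClamp_eq ht.le]
      simp only at this
      rw [hZ.dir_sp_eq_pd, hslice, mul_right_comm, this, mul_comm]
    simp only [heatOp, hdt, hv, hZ.dir_dir_sp_eq_pd, hslice]
    have hf : retime timeClamp f (t, x) = f t x := by simp [retime, timeClamp_eq ht.le]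
    rw [hf]
    unfold laplace at heq
    linarith
  div_mul := by
    rintro ⟨t, x⟩
    have hZ := h.tame_sol contDiff_timeClamp timeClamp_nonneg
    -- Where ζ is nonzero it remains so nearby, hence the cutoff is locally 1 and the cut off drift
    -- inherits the zero divergence.
    by_cases hne : retime timeClamp ζ (t, x) = 0
    · rw [hne, mul_zero]
    · have hev := hZ.continuous.continuousAt.eventually_ne hne
      have hd : ∀ k, dir (sp k) (cutVel H δ u k) (t, x) =
          pd k (fun x => u (timeClamp t) x k) x := fun k => by
        have hU := h.tame_vel contDiff_timeClamp timeClamp_nonneg k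
        have : cutVel H δ u k =ᶠ[nhds (t, x)] retime timeClamp fun t x => u t x k := by
          filter_upwards [hev] with q hq
          rw [cutVel, h.cutoff_eq_one_of_ne_zero (timeClamp_nonneg q.1) hq, one_mul]
        have h2 := hU.dir_sp_eq_pd k t x
        rw [dir] at h2 ⊢
        rw [this.fderiv_eq, h2]
        rfl
      simp only [hd]
      have := h.divergence_eq (timeClamp t) (timeClamp_nonneg t) x
      unfold divergence at this
      rw [this, zero_mul]

end Transport

end ConvDiff

/-! ### Slab norms of the data bounded by the averages of the statement. -/

namespace ConvDiff

variable {n : ℕ} {Λ H T s m p : ℝ}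

/-- The p-th power of g enters as a separate function g' so that both natural and real exponents can
be used in the averages. The constant c allows for sums of partial derivatives against Euclidean
norms. -/
theorem nrm_strip_le_sliceMean (hΛ : 0 < Λ) (hT : 0 < T) (hm : m ≤ H) (hs : 0 < s)
    {a b : ℝ} (ha : a ≤ -m) (hb : m ≤ b) (hp : 0 < p)
    {G : ℝ × Space n → ℝ≥0∞} (hG : Measurable G) {g g' : ℝ → Space n → ℝ} {c : ℝ≥0∞}
    (hc : c ≠ 0) (hc' : c ≠ ⊤) (hg : ∀ t x, 0 ≤ g t x)
    (hgg : ∀ t x, g t x ^ p = g' t x)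
    (h : ∀ t ∈ Icc s T, ∀ x, G (t, x) ≤ c * ENNReal.ofReal (g t x)) :
    nrm p ((meanSlab n Λ H s T).restrict (strip n m)) G ≤ c * sliceMean Λ T a b g' ^ (1 / p) := by
  have h1 : nrm p ((meanSlab n Λ H s T).restrict (strip n m)) (fun x => c⁻¹ * G x) ≤
      sliceMean Λ T a b g' ^ (1 / p) := by
    refine ENNReal.rpow_le_rpow ?_ (by positivity)
    refine lintegral_strip_le_sliceMean hΛ hT hm hs ha hb ((hG.const_mul _).pow_const p)
      fun t ht x => ?_
    rw [← hgg, ← ENNReal.ofReal_rpow_of_nonneg (hg t x) hp.le]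
    gcongr
    rw [ENNReal.inv_mul_le_iff hc hc']
    exact h t ht x
  rwa [nrm_const_mul hp _ hG.aemeasurable, ENNReal.inv_mul_le_iff hc hc'] at h1

theorem nrm_le_sliceMean (hΛ : 0 < Λ) (hT : 0 < T) (hs : 0 < s) (hp : 0 < p)
    {G : ℝ × Space n → ℝ≥0∞} (hG : Measurable G) {g g' : ℝ → Space n → ℝ} {c : ℝ≥0∞}
    (hc : c ≠ 0) (hc' : c ≠ ⊤) (hg : ∀ t x, 0 ≤ g t x)
    (hgg : ∀ t x, g t x ^ p = g' t x)
    (h : ∀ t ∈ Icc s T, ∀ x, G (t, x) ≤ c * ENNReal.ofReal (g t x)) :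
    nrm p (meanSlab n Λ H s T) G ≤ c * sliceMean Λ T (-H) H g' ^ (1 / p) := by
  have := nrm_strip_le_sliceMean (H := H) hΛ hT le_rfl hs le_rfl le_rfl hp hG hc hc' hg hgg h
  rwa [Measure.restrict_eq_self_of_ae_mem ae_meanSlab_strip] at this

theorem abs_le_sqrt_sum {ι : Type*} [Fintype ι] (a : ι → ℝ) (i : ι) :
    |a i| ≤ Real.sqrt (∑ i, a i ^ 2) :=
  Real.abs_le_sqrt (Finset.single_le_sum (f := fun i => a i ^ 2) (fun _ _ => sq_nonneg _)
    (Finset.mem_univ i))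

theorem abs_le_sqrt_sum_sum {ι κ : Type*} [Fintype ι] [Fintype κ] (a : ι → κ → ℝ) (i : ι) (j : κ) :
    |a i j| ≤ Real.sqrt (∑ i, ∑ j, a i j ^ 2) := by
  rw [← Fintype.sum_prod_type']
  exact abs_le_sqrt_sum (fun x : ι × κ => a x.1 x.2) (i, j)

theorem sqrt_sum_sum_le {ι κ : Type*} [Fintype ι] [Fintype κ] (a : ι → κ → ℝ) :
    Real.sqrt (∑ i, ∑ j, a i j ^ 2) ≤ ∑ i, ∑ j, |a i j| := by
  rw [← Fintype.sum_prod_type', ← Fintype.sum_prod_type' (fun i j => |a i j|)]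
  refine Real.sqrt_le_iff.2 ⟨Finset.sum_nonneg fun _ _ => abs_nonneg _, ?_⟩
  simpa using Finset.sum_sq_le_sq_sum_of_nonneg (s := Finset.univ)
    (f := fun x : ι × κ => |a x.1 x.2|) fun _ _ => abs_nonneg _

theorem gradNorm_nonneg (g : Space n → ℝ) (x : Space n) : 0 ≤ gradNorm g x := Real.sqrt_nonneg _

theorem hessNorm_nonneg (g : Space n → ℝ) (x : Space n) : 0 ≤ hessNorm g x := Real.sqrt_nonneg _

theorem jacNorm_nonneg (v : Space n → Space n) (x : Space n) : 0 ≤ jacNorm v x :=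
  Real.sqrt_nonneg _

theorem abs_pd_le_gradNorm (g : Space n → ℝ) (x : Space n) (i : Fin (n + 1)) :
    |pd i g x| ≤ gradNorm g x := abs_le_sqrt_sum (fun i => pd i g x) i

theorem abs_pd_le_jacNorm (v : Space n → Space n) (x : Space n) (i j : Fin (n + 1)) :
    |pd j (fun x => v x i) x| ≤ jacNorm v x :=
  abs_le_sqrt_sum_sum (fun i j => pd j (fun x' => v x' i) x) i j

theorem hessNorm_le_sum (g : Space n → ℝ) (x : Space n) :
    hessNorm g x ≤ ∑ i, ∑ j, |pd i (pd j g) x| := sqrt_sum_sum_le fun i j => pd i (pd j g) x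

theorem gradSum_retime_le {per : Fin (n + 1) → ℝ} {g : ℝ → Space n → ℝ}
    (hg : Tame per (retime timeClamp g)) {t : ℝ} (ht : 1 / 2 ≤ t) (x : Space n) :
    gradSum (retime timeClamp g) (t, x) ≤ ((n : ℝ≥0∞) + 1) * ENNReal.ofReal (gradNorm (g t) x) := by
  have hslice : (fun x => retime timeClamp g (t, x)) = g t := by
    funext x; simp [retime, timeClamp_eq ht]
  simp only [gradSum, hg.dir_sp_eq_pd, hslice]
  refine (Finset.sum_le_card_nsmul _ _ (ENNReal.ofReal (gradNorm (g t) x)) fun k _ =>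
    ENNReal.ofReal_le_ofReal (abs_pd_le_gradNorm _ _ k)).trans ?_
  simp [nsmul_eq_mul]

theorem volume_box (hΛ : 0 < Λ) : volume (box n Λ) = ENNReal.ofReal (Λ ^ n) := by
  rw [box, volume_pi_pi]
  simp [ENNReal.ofReal_pow hΛ.le]

theorem sliceMean_one (hΛ : 0 < Λ) (hT : 0 < T) {a b : ℝ} :
    sliceMean (n := n) Λ T a b (fun _ _ => 1) = ENNReal.ofReal (b - a) := by
  have h1 : ENNReal.ofReal T ≠ 0 := by simpa using hT
  have h2 : ENNReal.ofReal (Λ ^ n) ≠ 0 := by simpa using pow_pos hΛ n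
  have hvol : volume (Set.pi univ fun _ : Fin n => Ico (0 : ℝ) Λ) = ENNReal.ofReal (Λ ^ n) :=
    volume_box hΛ
  simp only [sliceMean, partialMean, ENNReal.ofReal_one, setLIntegral_const, one_mul, hvol,
    Real.volume_Ioc, Real.volume_Icc, sub_zero]
  rw [ENNReal.inv_mul_cancel h2 ENNReal.ofReal_ne_top, one_mul,
    ENNReal.inv_mul_cancel h1 ENNReal.ofReal_ne_top, one_mul]

theorem integral_gker_one_pos : 0 < ∫ h : Space n, gker 1 h := by
  have h1 := integrable_gker (n := n) 1
  have h2 : (gker 1 : Space n → ℝ) = fun h => Real.exp (-‖h‖ ^ 2 / 4) := by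
    funext h; simp [gker]
  rw [h2] at h1 ⊢
  exact integral_exp_pos h1

namespace Transport

variable {δ : ℝ} {ζ f : ℝ → Space n → ℝ} {u : ℝ → Space n → Space n}
variable (h : Transport Λ H δ ζ f u)
include h

theorem nrm_force_le (hT : 0 < T) {r : ℝ} (hr : 0 < r) :
    nrm r (meanSlab n Λ H 1 T) (fun p => ENNReal.ofReal |retime timeClamp f p|) ≤
      sliceMean Λ T (-H) H (fun t x => |f t x| ^ r) ^ (1 / r) := by
  have hF := h.tame_force contDiff_timeClamp timeClamp_nonneg
  have := nrm_le_sliceMean (H := H) h.length_pos hT one_pos hr hF.tameE.measurable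
    (g := fun t x => |f t x|) one_ne_zero ENNReal.one_ne_top (fun _ _ => abs_nonneg _)
    (fun _ _ => rfl) fun t ht x => by
      rw [one_mul, retime, timeClamp_eq (by linarith [ht.1])]
  rwa [one_mul] at this

theorem nrm_sol_le (hT : 0 < T) {q : ℝ} (hq : 0 < q) :
    nrm q (meanSlab n Λ H 1 T) (fun p => ENNReal.ofReal |retime timeClamp ζ p|) ≤
      sliceMean Λ T (-H) H (fun t x => |ζ t x| ^ q) ^ (1 / q) := by
  have hF := h.tame_sol contDiff_timeClamp timeClamp_nonneg
  have := nrm_le_sliceMean (H := H) h.length_pos hT one_pos hq hF.tameE.measurable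
    (g := fun t x => |ζ t x|) one_ne_zero ENNReal.one_ne_top (fun _ _ => abs_nonneg _)
    (fun _ _ => rfl) fun t ht x => by
      rw [one_mul, retime, timeClamp_eq (by linarith [ht.1])]
  rwa [one_mul] at this

theorem nrm_gradSum_force_le (hT : 0 < T) {r : ℝ} (hr : 0 < r) :
    nrm r (meanSlab n Λ H 1 T) (gradSum (retime timeClamp f)) ≤
      ((n : ℝ≥0∞) + 1) * sliceMean Λ T (-H) H (fun t x => gradNorm (f t) x ^ r) ^ (1 / r) := by
  have hF := h.tame_force contDiff_timeClamp timeClamp_nonneg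
  exact nrm_le_sliceMean h.length_pos hT one_pos hr (tameE_gradSum hF).measurable
    (g := fun t x => gradNorm (f t) x) (by positivity) (by finiteness)
    (fun _ _ => gradNorm_nonneg _ _) (fun _ _ => rfl)
    fun t ht x => gradSum_retime_le hF (by linarith [ht.1]) x

theorem nrm_gradSum_sol_le (hT : 0 < T) {q : ℝ} (hq : 0 < q) :
    nrm q (meanSlab n Λ H 1 T) (gradSum (retime timeClamp ζ)) ≤
      ((n : ℝ≥0∞) + 1) * sliceMean Λ T (-H) H (fun t x => gradNorm (ζ t) x ^ q) ^ (1 / q) := by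
  have hF := h.tame_sol contDiff_timeClamp timeClamp_nonneg
  exact nrm_le_sliceMean h.length_pos hT one_pos hq (tameE_gradSum hF).measurable
    (g := fun t x => gradNorm (ζ t) x) (by positivity) (by finiteness)
    (fun _ _ => gradNorm_nonneg _ _) (fun _ _ => rfl)
    fun t ht x => gradSum_retime_le hF (by linarith [ht.1]) x

/-- Hölder's inequality on the support of the solution. -/
theorem nrm_sol_le_sq (hT : 0 < T) {r : ℝ} (hr : 1 ≤ r) (hr2 : r < 2) :
    nrm r (meanSlab n Λ H 1 T) (fun p => ENNReal.ofReal |retime timeClamp ζ p|) ≤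
      2 * (ENNReal.ofReal (δ ^ ((2 - r) / (2 * r))) *
        sliceMean Λ T (-H) H (fun t x => ζ t x ^ 2) ^ (1 / 2 : ℝ)) := by
  obtain ⟨hq, he, -, -⟩ := exponent_facts hr hr2
  set q := 2 * r / (2 - r) with hqdef
  have hq1 : 1 / q = (2 - r) / (2 * r) := by rw [hqdef, one_div_div]
  have hδ := h.width_pos
  have hF := h.tame_sol contDiff_timeClamp timeClamp_nonneg
  have hI : Measurable ((strip n δ).indicator fun _ => (1 : ℝ≥0∞)) :=
    measurable_const.indicator (measurableSet_strip δ)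
  have h1 : nrm r (meanSlab n Λ H 1 T) (fun p => ENNReal.ofReal |retime timeClamp ζ p|) ≤
      nrm r (meanSlab n Λ H 1 T) (fun p => (strip n δ).indicator (fun _ => 1) p *
        ENNReal.ofReal |retime timeClamp ζ p|) := by
    refine nrm_mono_ae (by linarith) ?_
    filter_upwards [ae_meanSlab_strip] with p hp
    by_cases hz : retime timeClamp ζ p = 0
    · simp [hz]
    · have hmem : p ∈ strip n δ := h.support _ (timeClamp_nonneg p.1) p.2 hp hz
      rw [indicator_of_mem hmem, one_mul]
  -- Hölder against the indicator of the strip |z| ≤ δ, whose L^q norm is at most (2δ)^{1/q} with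
  -- 1/q = (2-r)/(2r).
  refine h1.trans ((nrm_mul_le (p := q) (q := 2) (by linarith) (by norm_num) (by linarith)
    (by rw [he]; ring) hI.aemeasurable hF.tameE.measurable.aemeasurable).trans ?_)
  rw [← mul_assoc]
  gcongr
  · have h2 : nrm q (meanSlab n Λ H 1 T) ((strip n δ).indicator fun _ => 1) ≤
        ENNReal.ofReal (2 * δ) ^ (1 / q) := by
      refine ENNReal.rpow_le_rpow ?_ (by positivity)
      have h3 := lintegral_strip_le_sliceMean (n := n) h.length_pos hT h.width_le one_pos le_rfl
        le_rfl (G := fun _ => 1) measurable_const (g := fun _ _ => 1) (by simp)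
      rw [sliceMean_one h.length_pos hT, ← lintegral_indicator (measurableSet_strip δ)] at h3
      have h4 : ∀ p : ℝ × Space n, (strip n δ).indicator (fun _ => (1 : ℝ≥0∞)) p ^ q =
          (strip n δ).indicator (fun _ => 1) p := fun p => by
        by_cases hp : p ∈ strip n δ
        · simp [hp]
        · simp [hp, ENNReal.zero_rpow_of_pos (by linarith : 0 < q)]
      simp only [h4]
      refine h3.trans (le_of_eq ?_)
      congr 1; ring
    refine h2.trans ?_
    rw [ENNReal.ofReal_mul zero_le_two, ENNReal.mul_rpow_of_nonneg _ _ (by positivity), hq1,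
      ← ENNReal.ofReal_rpow_of_pos hδ]
    gcongr
    rw [ENNReal.ofReal_ofNat]
    -- The exponent (2-r)/(2r) is at most 1, so its power of 2 is at most 2 and the constant is
    -- independent of r.
    refine (ENNReal.rpow_le_rpow_of_exponent_le (by norm_num) ?_).trans (ENNReal.rpow_one 2).le
    rw [div_le_one (by linarith)]; linarith
  · have := h.nrm_sol_le (q := 2) hT two_pos
    simpa using this

end Transport

end ConvDiff

/-! ### The cut off drift and the estimate up to a fixed time. -/

namespace ConvDiff

variable {n : ℕ}

/-- A bound for the derivative of the smooth transition function. -/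
noncomputable def transitionConst : ℝ := exists_deriv_smoothTransition_bound.choose

theorem transitionConst_nonneg : 0 ≤ transitionConst :=
  exists_deriv_smoothTransition_bound.choose_spec.1

theorem abs_deriv_smoothTransition_le (x : ℝ) :
    |deriv Real.smoothTransition x| ≤ transitionConst :=
  exists_deriv_smoothTransition_bound.choose_spec.2 x

/-- The constant in the estimate of the derivatives of the cut off drift. -/
noncomputable def driftConst (n : ℕ) : ℝ≥0∞ :=
  ((n : ℝ≥0∞) + 1) * (((n : ℝ≥0∞) + 1) * (1 + ENNReal.ofReal (20 * transitionConst)))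

theorem driftConst_ne_top (n : ℕ) : driftConst n ≠ ⊤ := by
  unfold driftConst; finiteness

/-- The constant of the estimate up to a fixed time. -/
noncomputable def regularityConst (n : ℕ) : ℝ≥0∞ :=
  ((n : ℝ≥0∞) + 1) * (((n : ℝ≥0∞) + 1) * ((ENNReal.ofReal |∫ h : Space n, gker 1 h|)⁻¹ *
    (3 * (kernelConst n * (((n : ℝ≥0∞) + 1) * (driftConst n + 1))))))

theorem regularityConst_ne_top (n : ℕ) : regularityConst n ≠ ⊤ := by
  have h1 := kernelConst_ne_top n
  have h2 := driftConst_ne_top n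
  have h3 : ENNReal.ofReal |∫ h : Space n, gker 1 h| ≠ 0 := by
    simpa using integral_gker_one_pos.ne'
  unfold regularityConst
  finiteness

namespace Transport

variable {Λ H T δ : ℝ} {ζ f : ℝ → Space n → ℝ} {u : ℝ → Space n → Space n}
variable (h : Transport Λ H δ ζ f u)
include h

theorem dir_cutVel (k j : Fin (n + 1)) (p : ℝ × Space n) : dir (sp j) (cutVel H δ u k) p =
    cutoff H δ (height p.2) * dir (sp j) (retime timeClamp fun t x => u t x k) p +
      (if j = Fin.last n then deriv (cutoff H δ) (height p.2) else 0) *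
        retime timeClamp (fun t x => u t x k) p := by
  have := dir_mul (tame_cutoff (Λ := Λ) (δ := δ) h.height_pos)
    (h.tame_vel contDiff_timeClamp timeClamp_nonneg k) (sp j) p
  rw [dir_sp_height_comp contDiff_cutoff] at this
  exact this

theorem jacSum_cutVel_le (p : ℝ × Space n) : jacSum (cutVel H δ u) p ≤
    ∑ k, ∑ j, (ENNReal.ofReal |dir (sp j) (retime timeClamp fun t x => u t x k) p| +
      ENNReal.ofReal (transitionConst * (5 / δ)) *
        ENNReal.ofReal |retime timeClamp (fun t x => u t x k) p|) := by
  unfold jacSum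
  have h0 := transitionConst_nonneg
  have h1 := h.width_pos
  gcongr with k _ j _
  rw [← ENNReal.ofReal_mul (by positivity), ← ENNReal.ofReal_add (by positivity) (by positivity)]
  refine ENNReal.ofReal_le_ofReal ?_
  rw [h.dir_cutVel]
  refine (abs_add_le _ _).trans (add_le_add ?_ ?_)
  · rw [abs_mul]
    exact mul_le_of_le_one_left (abs_nonneg _) (abs_cutoff_le _)
  · rw [abs_mul]
    refine mul_le_mul_of_nonneg_right ?_ (abs_nonneg _)
    split_ifs
    · exact abs_deriv_cutoff_le abs_deriv_smoothTransition_le h.width_pos h.width_le _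
    · rw [abs_zero]; positivity

theorem jacSum_cutVel_eq_zero {p : ℝ × Space n} (hp : p ∈ strip n H)
    (hp' : p ∉ strip n (min (2 * δ) H)) : jacSum (cutVel H δ u) p = 0 := by
  have hp1 : |height p.2| ≤ H := hp
  have hp2 : 2 * δ < |height p.2| := by
    by_contra hcon
    exact hp' (le_min (not_lt.1 hcon) hp1)
  unfold jacSum
  refine Finset.sum_eq_zero fun k _ => Finset.sum_eq_zero fun j _ => ?_
  rw [h.dir_cutVel, cutoff_eq_zero h.width_pos h.width_le hp2 hp1,
    deriv_cutoff_eq_zero h.width_pos h.width_le hp2 hp1]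
  simp

/-- The product rule gives the Jacobian of u plus a multiple of u/δ. The latter lives on a strip of
half-width at most 2δ around the plane where u vanishes, so Poincaré compensates 1/δ. The range
[a,b] is left free because it is used both with 2δ (exponent 2) and with H (exponent 4). -/
theorem nrm_jacSum_cutVel_le (hT : 0 < T) {a b : ℝ} (ha : a ≤ -min (2 * δ) H)
    (hb : min (2 * δ) H ≤ b) {p : ℝ} (hp : 1 ≤ p) {g : ℝ → Space n → ℝ}
    (hg : ∀ t x, jacNorm (u t) x ^ p = g t x) :
    nrm p (meanSlab n Λ H 1 T) (jacSum (cutVel H δ u)) ≤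
      driftConst n * sliceMean Λ T a b g ^ (1 / p) := by
  have hp0 : 0 < p := by linarith
  have hδ := h.width_pos
  have hH := h.height_pos
  set m := min (2 * δ) H with hm
  have hm0 : 0 ≤ m := by positivity
  have hmH : m ≤ H := min_le_right _ _
  have hB := transitionConst_nonneg
  set μ := (meanSlab n Λ H 1 T).restrict (strip n m) with hμ
  have hU := fun k => h.tame_vel contDiff_timeClamp timeClamp_nonneg k
  set U : Fin (n + 1) → ℝ × Space n → ℝ := fun k => retime timeClamp fun t x => u t x k with hUdef
  have h1 : nrm p (meanSlab n Λ H 1 T) (jacSum (cutVel H δ u)) ≤ nrm p μ (jacSum (cutVel H δ u)) := by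
    unfold nrm
    refine ENNReal.rpow_le_rpow ?_ (by positivity)
    rw [hμ, ← lintegral_indicator (measurableSet_strip m)]
    refine lintegral_mono_ae ?_
    filter_upwards [ae_meanSlab_strip] with x hx
    by_cases hx' : x ∈ strip n m
    · rw [indicator_of_mem hx']
    · rw [h.jacSum_cutVel_eq_zero hx hx', ENNReal.zero_rpow_of_pos hp0]
      exact zero_le
  have hder : ∀ k j, nrm p μ (fun x => ENNReal.ofReal |dir (sp j) (U k) x|) ≤
      sliceMean Λ T a b g ^ (1 / p) := fun k j => by
    have := nrm_strip_le_sliceMean (H := H) h.length_pos hT hmH one_pos ha hb hp0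
      ((hU k).dir (sp j)).tameE.measurable (g := fun t x => jacNorm (u t) x) one_ne_zero
      ENNReal.one_ne_top (fun _ _ => jacNorm_nonneg _ _) hg fun t ht x => by
        rw [one_mul, (hU k).dir_sp_eq_pd]
        refine ENNReal.ofReal_le_ofReal ?_
        simp only [retime, timeClamp_eq (by linarith [ht.1] : 1 / 2 ≤ t)]
        exact abs_pd_le_jacNorm (u t) x k j
    rwa [one_mul] at this
  have hval : ∀ k, ENNReal.ofReal (transitionConst * (5 / δ)) *
      nrm p μ (fun x => ENNReal.ofReal |U k x|) ≤
      ENNReal.ofReal (20 * transitionConst) * sliceMean Λ T a b g ^ (1 / p) := fun k => by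
    have h2 := nrm_strip_le_vertical_deriv (s := 1) h.length_pos hT hm0 hmH (hU k)
      (fun t x hx => by simp [retime, h.no_slip _ (timeClamp_nonneg t) x hx]) hp
    calc _ ≤ ENNReal.ofReal (transitionConst * (5 / δ)) * (ENNReal.ofReal (2 * m) *
          sliceMean Λ T a b g ^ (1 / p)) := by
          gcongr
          exact h2.trans (by gcongr; exact hder k (Fin.last n))
      _ ≤ _ := by
          rw [← mul_assoc, ← ENNReal.ofReal_mul (by positivity)]
          refine mul_le_mul' (ENNReal.ofReal_le_ofReal ?_) le_rfl
          -- 5/δ from the cutoff times the Poincaré constant 2m ≤ 4δ makes 20.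
          calc transitionConst * (5 / δ) * (2 * m) ≤ transitionConst * (5 / δ) * (2 * (2 * δ)) := by
                gcongr; exact min_le_left _ _
            _ = 20 * transitionConst := by field_simp; ring
  have hmd := fun k j => ((hU k).dir (sp j)).tameE.measurable
  have hmu := fun k => (hU k).tameE.measurable
  have hmt : ∀ k j, Measurable fun x => ENNReal.ofReal |dir (sp j) (U k) x| +
      ENNReal.ofReal (transitionConst * (5 / δ)) * ENNReal.ofReal |U k x| := fun k j =>
    (hmd k j).add ((hmu k).const_mul _)
  refine h1.trans ((nrm_mono hp0 h.jacSum_cutVel_le).trans ?_)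
  refine (nrm_sum_le hp _ fun k => Finset.measurable_sum _ fun j _ => hmt k j).trans ?_
  have hterm : ∀ k j, nrm p μ (fun x => ENNReal.ofReal |dir (sp j) (U k) x| +
      ENNReal.ofReal (transitionConst * (5 / δ)) * ENNReal.ofReal |U k x|) ≤
      (1 + ENNReal.ofReal (20 * transitionConst)) * sliceMean Λ T a b g ^ (1 / p) := fun k j => by
    refine (nrm_add_le hp (hmd k j).aemeasurable ((hmu k).const_mul _).aemeasurable).trans ?_
    rw [nrm_const_mul hp0 _ (hmu k).aemeasurable, add_mul, one_mul]
    exact add_le_add (hder k j) (hval k)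
  refine (Finset.sum_le_sum fun k _ => (nrm_sum_le hp _ (hmt k)).trans
    (Finset.sum_le_sum fun j _ => hterm k j)).trans (le_of_eq ?_)
  simp only [Finset.sum_const, Finset.card_univ, Fintype.card_fin, nsmul_eq_mul, driftConst]
  push_cast
  ring

/-- The second derivatives are bounded near the initial time. -/
theorem exists_hessNorm_le : ∃ K : ℝ, 0 ≤ K ∧ ∀ t ∈ Icc (0 : ℝ) 2, ∀ x, hessNorm (ζ t) x ≤ K := by
  -- The square clock is needed here because the clamp never reaches times below 1/4. A time t in
  -- [0,2] is hit at √t.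
  have hsq : Tame (periods n Λ H) (retime (fun t => t ^ 2) ζ) :=
    h.tame_sol (by fun_prop) fun t => sq_nonneg t
  choose K hK0 hK using fun i j => ((hsq.dir (sp j)).dir (sp i)).bounded h.periods_pos 2
  refine ⟨∑ i, ∑ j, K i j, Finset.sum_nonneg fun i _ => Finset.sum_nonneg fun j _ => hK0 i j,
    fun t ht x => (hessNorm_le_sum _ _).trans ?_⟩
  gcongr with i _ j _
  have h1 : (fun x => retime (fun t => t ^ 2) ζ (Real.sqrt t, x)) = ζ t := by
    funext x; simp [retime, Real.sq_sqrt ht.1]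
  have h2 : Real.sqrt t ≤ 2 := by
    rw [Real.sqrt_le_left (by norm_num)]; linarith [ht.2]
  have := hK i j (Real.sqrt t) ⟨by linarith [Real.sqrt_nonneg t], h2⟩ x
  rwa [hsq.dir_dir_sp_eq_pd, h1] at this

theorem sliceMean_hess_le {r : ℝ} (hr : 1 ≤ r) : ∃ K : ℝ, 0 ≤ K ∧ ∀ T : ℝ, 2 < T →
    sliceMean Λ T (-H) H (fun t x => hessNorm (ζ t) x ^ r) ^ (1 / r) ≤
      ENNReal.ofReal (K / T) ^ (1 / r) + ∑ i, ∑ j, nrm r (meanSlab n Λ H 2 T)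
        (fun p => ENNReal.ofReal |dir (sp i) (dir (sp j) (retime timeClamp ζ)) p|) := by
  obtain ⟨K, hK0, hK⟩ := h.exists_hessNorm_le
  have hr0 : 0 < r := by linarith
  have hH := h.height_pos
  have hΛ := h.length_pos
  -- Vertical width 2H, time length 2, and the pointwise bound K^r for the early Hessian.
  refine ⟨2 * H * (2 * K ^ r), by positivity, fun T hT => ?_⟩
  have hT0 : 0 < T := by linarith
  have hZ := h.tame_sol contDiff_timeClamp timeClamp_nonneg
  set Z := retime timeClamp ζ with hZdef
  set G : ℝ × Space n → ℝ≥0∞ := fun p => ∑ i, ∑ j, ENNReal.ofReal |dir (sp i) (dir (sp j) Z) p|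
    with hG
  have hGij : ∀ i j, Measurable fun p => ENNReal.ofReal |dir (sp i) (dir (sp j) Z) p| := fun i j =>
    ((hZ.dir (sp j)).dir (sp i)).tameE.measurable
  have hGi : ∀ i, Measurable fun p => ∑ j, ENNReal.ofReal |dir (sp i) (dir (sp j) Z) p| := fun i =>
    Finset.measurable_sum _ fun j _ => hGij i j
  have hGm : Measurable G := Finset.measurable_sum _ fun i _ => hGi i
  have hT1 : ENNReal.ofReal T ≠ 0 := by simpa using hT0
  have hΛ1 : ENNReal.ofReal (Λ ^ n) ≠ 0 := by simpa using pow_pos hΛ n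
  have hlate : ∀ t ∈ Icc 2 T, ∀ x, ENNReal.ofReal (hessNorm (ζ t) x ^ r) ≤ G (t, x) ^ r := by
    intro t ht x
    rw [← ENNReal.ofReal_rpow_of_nonneg (hessNorm_nonneg _ _) hr0.le]
    gcongr
    refine (ENNReal.ofReal_le_ofReal (hessNorm_le_sum (ζ t) x)).trans (le_of_eq ?_)
    have hslice : (fun x => Z (t, x)) = ζ t := by
      funext x; simp [hZdef, retime, timeClamp_eq (by linarith [ht.1] : 1 / 2 ≤ t)]
    simp only [hG, hZ.dir_dir_sp_eq_pd, hslice]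
    rw [ENNReal.ofReal_sum_of_nonneg fun _ _ => Finset.sum_nonneg fun _ _ => abs_nonneg _]
    exact Finset.sum_congr rfl fun i _ => ENNReal.ofReal_sum_of_nonneg fun _ _ => abs_nonneg _
  have hearly : ∀ t ∈ Ioc (0 : ℝ) 2, ∀ z, (ENNReal.ofReal (Λ ^ n))⁻¹ * ∫⁻ y in box n Λ,
      ENNReal.ofReal (hessNorm (ζ t) (point y z) ^ r) ≤ ENNReal.ofReal (K ^ r) := by
    intro t ht z
    calc _ ≤ (ENNReal.ofReal (Λ ^ n))⁻¹ * ∫⁻ y in box n Λ, ENNReal.ofReal (K ^ r) := by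
          gcongr with y
          · exact hessNorm_nonneg _ _
          · exact hK t ⟨ht.1.le, ht.2⟩ _
      _ = _ := by
          rw [setLIntegral_const, volume_box hΛ, mul_left_comm,
            ENNReal.inv_mul_cancel hΛ1 ENNReal.ofReal_ne_top, mul_one]
  have hpart : ∀ z, partialMean Λ T (fun t x => hessNorm (ζ t) x ^ r) z ≤
      ENNReal.ofReal (2 * K ^ r / T) + (ENNReal.ofReal T)⁻¹ * ∫⁻ t in Icc 2 T,
        (ENNReal.ofReal (Λ ^ n))⁻¹ * ∫⁻ y in box n Λ, G (t, point y z) ^ r := by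
    intro z
    have hsub : Ioc 0 T ⊆ Ioc (0 : ℝ) 2 ∪ Icc 2 T := fun t ht => by
      rcases le_total t 2 with h2 | h2
      · exact Or.inl ⟨ht.1, h2⟩
      · exact Or.inr ⟨h2, ht.2⟩
    unfold partialMean
    refine (mul_le_mul' le_rfl ((lintegral_mono_set hsub).trans
      (lintegral_union_le _ _ _))).trans ?_
    rw [mul_add]
    refine add_le_add ?_ (mul_le_mul' le_rfl (setLIntegral_mono' measurableSet_Icc fun t ht =>
      mul_le_mul' le_rfl (lintegral_mono fun y => hlate t ht _)))
    refine (mul_le_mul' le_rfl (setLIntegral_mono' measurableSet_Ioc fun t ht =>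
      hearly t ht z)).trans (le_of_eq ?_)
    rw [setLIntegral_const, Real.volume_Ioc, ENNReal.ofReal_div_of_pos hT0,
      ENNReal.ofReal_mul zero_le_two, sub_zero, mul_comm (ENNReal.ofReal 2), div_eq_mul_inv, mul_comm]
  have hslice : sliceMean Λ T (-H) H (fun t x => hessNorm (ζ t) x ^ r) ≤
      ENNReal.ofReal (2 * H * (2 * K ^ r) / T) + nrm r (meanSlab n Λ H 2 T) G ^ r := by
    rw [nrm_rpow hr0, lintegral_meanSlab hΛ hT0 (hGm.pow_const r)]
    refine (lintegral_mono hpart).trans (le_of_eq ?_)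
    rw [lintegral_add_left measurable_const, setLIntegral_const, Real.volume_Icc,
      ← ENNReal.ofReal_mul (by positivity)]
    congr 2
    ring
  refine (ENNReal.rpow_le_rpow hslice (by positivity)).trans ?_
  -- Since 1/r ≤ 1, the power 1/r is subadditive, which separates early from late times without a
  -- constant.
  have h1r : 1 / r ≤ 1 := (div_le_one hr0).2 hr
  refine (ENNReal.rpow_add_le_add_rpow _ _ (by positivity) h1r).trans ?_
  rw [← ENNReal.rpow_mul, mul_one_div_cancel hr0.ne', ENNReal.rpow_one]
  gcongr
  exact (nrm_sum_le hr _ hGi).trans (Finset.sum_le_sum fun i _ => nrm_sum_le hr _ (hGij i))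

/-- The maximal regularity estimate up to a fixed time. -/
theorem sliceMean_hess_le_rightHandSide {r : ℝ} (hr : 1 ≤ r) (hr2 : r < 2) :
    ∃ K : ℝ, 0 ≤ K ∧ ∀ T : ℝ, 2 < T → ∀ M N : ℕ,
      sliceMean Λ T (-H) H (fun t x => hessNorm (ζ t) x ^ r) ^ (1 / r) ≤
        ENNReal.ofReal (K / T) ^ (1 / r) +
          regularityConst n * rightHandSide (sliceMean Λ T) H δ r M N ζ u f := by
  obtain ⟨K, hK0, hK⟩ := h.sliceMean_hess_le hr
  obtain ⟨hq2, -, hq4, -⟩ := exponent_facts hr hr2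
  have hr0 : 0 < r := by linarith
  have hδ := h.width_pos
  refine ⟨K, hK0, fun T hT M N => (hK T hT).trans ?_⟩
  have hT0 : 0 < T := by linarith
  gcongr
  set γ := ENNReal.ofReal |∫ h : Space n, gker 1 h| with hγ
  have hγ0 : γ ≠ 0 := by simpa [hγ] using integral_gker_one_pos.ne'
  set L : ℝ≥0∞ := (n : ℝ≥0∞) + 1 with hL
  have hL1 : 1 ≤ L := le_add_self
  set J := driftConst n with hJ
  have hJ1 : 1 ≤ J + 1 := le_add_self
  have hJJ : J ≤ J + 1 := le_self_add
  set R := rightHandSide (sliceMean Λ T) H δ r M N ζ u f with hR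
  -- One bound serves all entries. The inverse Gaussian mass undoes the missing normalisation of the
  -- kernel, and summing over the (n+1)² entries gives the two remaining factors of the constant.
  have key : ∀ i j, nrm r (meanSlab n Λ H 2 T)
      (fun p => ENNReal.ofReal |dir (sp i) (dir (sp j) (retime timeClamp ζ)) p|) ≤
      γ⁻¹ * (3 * (kernelConst n * (L * (J + 1)))) * R := by
    intro i j
    have h0 := h.flow.nrm_hess_le (a := corner n H) h.periods_pos i j hr hr2
      (meanConst_ne_zero (n := n) h.length_pos hT0) hT M N
    rw [mul_assoc γ⁻¹, ← ENNReal.mul_le_iff_le_inv hγ0 ENNReal.ofReal_ne_top]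
    refine h0.trans ?_
    have e1 := h.nrm_sol_le_sq hT0 hr hr2
    have e2 := h.nrm_force_le hT0 hr0
    have e3 := h.nrm_gradSum_force_le hT0 hr0
    have e4 := h.nrm_jacSum_cutVel_le hT0 (a := -(2 * δ)) (b := 2 * δ)
      (neg_le_neg (min_le_left _ _)) (min_le_left _ _) one_le_two
      (g := fun t x => jacNorm (u t) x ^ 2) (fun t x => Real.rpow_two _)
    have e5 := h.nrm_sol_le hT0 (q := 2 * r / (2 - r)) (by linarith)
    have e6 := h.nrm_jacSum_cutVel_le hT0 (a := -H) (b := H)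
      (neg_le_neg (min_le_right _ _)) (min_le_right _ _) (p := 4) (by norm_num)
      (g := fun t x => jacNorm (u t) x ^ 4) (fun t x => by norm_cast)
    have e7 := h.nrm_gradSum_sol_le hT0 (q := 4 * r / (4 - r)) (by linarith)
    rw [one_div_div] at e5 e7
    simp only [meanSlab] at e1 e2 e3 e4 e5 e6 e7
    set κ := kernelConst n with hκ
    set A1 := sliceMean Λ T (-H) H (fun t x => |f t x| ^ r) ^ (1 / r)
    set A2 := sliceMean Λ T (-H) H (fun t x => gradNorm (f t) x ^ r) ^ (1 / r)
    set A3 := ENNReal.ofReal (δ ^ ((2 - r) / (2 * r))) *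
      sliceMean Λ T (-H) H (fun t x => ζ t x ^ 2) ^ (1 / 2 : ℝ)
    set A4 := sliceMean Λ T (-(2 * δ)) (2 * δ) (fun t x => jacNorm (u t) x ^ 2) ^ (1 / 2 : ℝ)
    set A5 := sliceMean Λ T (-H) H (fun t x => |ζ t x| ^ (2 * r / (2 - r))) ^ ((2 - r) / (2 * r))
    set A6 := sliceMean Λ T (-H) H (fun t x => jacNorm (u t) x ^ 4) ^ (1 / 4 : ℝ)
    set A7 := sliceMean Λ T (-H) H (fun t x => gradNorm (ζ t) x ^ (4 * r / (4 - r))) ^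
      ((4 - r) / (4 * r))
    set eM := ENNReal.ofReal (Real.exp (-(M : ℝ)))
    set eN := ENNReal.ofReal (Real.exp (-(N : ℝ)))
    have hRe : R = M * A1 + eM * A2 + A3 + N * (A4 * A5) + eN * (A6 * A7) := rfl
    have h23 : (2 : ℝ≥0∞) ≤ 3 := by norm_num
    have h13 : (1 : ℝ≥0∞) ≤ 3 := by norm_num
    calc _ ≤ κ * (2 * A3) + (κ * A1 * M + κ * (L * A2) * eM +
          (3 * (κ * (J * A4 * A5)) * N + 3 * (κ * (J * A6 * (L * A7))) * eN)) := by gcongr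
      _ = 2 * (κ * (1 * 1)) * A3 + (1 * (κ * (1 * 1)) * (M * A1) + 1 * (κ * (L * 1)) * (eM * A2) +
          (3 * (κ * (1 * J)) * (N * (A4 * A5)) + 3 * (κ * (L * J)) * (eN * (A6 * A7)))) := by ring
      _ ≤ 3 * (κ * (L * (J + 1))) * A3 + (3 * (κ * (L * (J + 1))) * (M * A1) +
          3 * (κ * (L * (J + 1))) * (eM * A2) + (3 * (κ * (L * (J + 1))) * (N * (A4 * A5)) +
          3 * (κ * (L * (J + 1))) * (eN * (A6 * A7)))) := by gcongr
      _ = _ := by rw [hRe]; ring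
  refine (Finset.sum_le_sum fun i _ => Finset.sum_le_sum fun j _ => key i j).trans (le_of_eq ?_)
  simp only [Finset.sum_const, Finset.card_univ, Fintype.card_fin, nsmul_eq_mul, regularityConst]
  push_cast
  ring

end Transport

end ConvDiff

/-! ### Passage to the limit in time. -/

namespace ConvDiff

variable {n : ℕ}

section limsup

variable {ι : Type*} {F : Filter ι}

theorem limsup_add_le_add (a b : ι → ℝ≥0∞) :
    limsup (fun i => a i + b i) F ≤ limsup a F + limsup b F := by
  refine ENNReal.le_of_forall_pos_le_add fun ε hε hfin => ?_
  have hA : limsup a F ≠ ⊤ := (le_self_add.trans_lt hfin).ne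
  have hB : limsup b F ≠ ⊤ := (le_add_self.trans_lt hfin).ne
  have hε2 : (ε : ℝ≥0∞) / 2 ≠ 0 := by simpa using hε.ne'
  have hsum : limsup a F + limsup b F + ε = (limsup a F + ε / 2) + (limsup b F + ε / 2) := by
    rw [add_add_add_comm, ENNReal.add_halves]
  rw [hsum]
  refine limsup_le_of_le (h := ?_)
  filter_upwards [eventually_lt_of_limsup_lt (ENNReal.lt_add_right hA hε2),
    eventually_lt_of_limsup_lt (ENNReal.lt_add_right hB hε2)] with i h1 h2
  exact add_le_add h1.le h2.le

theorem limsup_rpow [F.NeBot] (a : ι → ℝ≥0∞) {p : ℝ} (hp : 0 ≤ p) :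
    limsup (fun i => a i ^ p) F = limsup a F ^ p :=
  ((ENNReal.monotone_rpow_of_nonneg hp).map_limsup_of_continuousAt a
    ENNReal.continuous_rpow_const.continuousAt).symm

/-- Submultiplicativity of the upper limit can fail when the limits are 0 and ∞: the product of the
limits is then 0 by convention, while the products themselves may stay large. This is the role of
the proviso on the pairs of averages. -/
theorem limsup_rpow_mul_rpow_le [F.NeBot] {a b : ι → ℝ≥0∞} {p q : ℝ} (hp : 0 < p) (hq : 0 < q)
    (h : ProductDefined (limsup a F) (limsup b F)) :
    limsup (fun i => a i ^ p * b i ^ q) F ≤ limsup a F ^ p * limsup b F ^ q := by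
  have := ENNReal.limsup_mul_le' (f := F) (u := fun i => a i ^ p) (v := fun i => b i ^ q)
  rw [limsup_rpow a hp.le, limsup_rpow b hq.le] at this
  exact this (h.1.imp (by simp [hp, hp.le]) (by simp [hq, hq.le]))
    (h.2.imp (by simp [hp, hp.le]) (by simp [hq, hq.le]))

end limsup

/-- The upper limit of the vertical integrals of the averages along a filter. -/
noncomputable def filterMean (F : Filter ℝ) (Λ a b : ℝ) (g : ℝ → Space n → ℝ) : ℝ≥0∞ :=
  limsup (fun T => sliceMean Λ T a b g) F

theorem limsup_rightHandSide_le {F : Filter ℝ} [F.NeBot] {Λ H δ r : ℝ} (hr : 1 ≤ r) (hr2 : r < 2)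
    {ζ f : ℝ → Space n → ℝ} {u : ℝ → Space n → Space n}
    (h1 : ProductDefined (filterMean F Λ (-(2 * δ)) (2 * δ) fun t x => jacNorm (u t) x ^ 2)
      (filterMean F Λ (-H) H fun t x => |ζ t x| ^ (2 * r / (2 - r))))
    (h2 : ProductDefined (filterMean F Λ (-H) H fun t x => jacNorm (u t) x ^ 4)
      (filterMean F Λ (-H) H fun t x => gradNorm (ζ t) x ^ (4 * r / (4 - r)))) (M N : ℕ) :
    limsup (fun T => rightHandSide (sliceMean Λ T) H δ r M N ζ u f) F ≤
      rightHandSide (filterMean F Λ) H δ r M N ζ u f := by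
  have hr0 : 0 < r := by linarith
  have hq1 : 0 < (2 - r) / (2 * r) := div_pos (by linarith) (by linarith)
  have hq2 : 0 < (4 - r) / (4 * r) := div_pos (by linarith) (by linarith)
  unfold rightHandSide
  refine (limsup_add_le_add _ _).trans (add_le_add ((limsup_add_le_add _ _).trans (add_le_add
    ((limsup_add_le_add _ _).trans (add_le_add ((limsup_add_le_add _ _).trans (add_le_add
    ?_ ?_)) ?_)) ?_)) ?_)
  · rw [ENNReal.limsup_const_mul_of_ne_top (by finiteness), limsup_rpow _ (by positivity)]
    rfl
  · rw [ENNReal.limsup_const_mul_of_ne_top (by finiteness), limsup_rpow _ (by positivity)]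
    rfl
  · rw [ENNReal.limsup_const_mul_of_ne_top (by finiteness), limsup_rpow _ (by positivity)]
    rfl
  · rw [ENNReal.limsup_const_mul_of_ne_top (by finiteness)]
    exact mul_le_mul' le_rfl (limsup_rpow_mul_rpow_le (by norm_num) hq1 h1)
  · rw [ENNReal.limsup_const_mul_of_ne_top (by finiteness)]
    exact mul_le_mul' le_rfl (limsup_rpow_mul_rpow_le (by norm_num) hq2 h2)

/-- The estimate at fixed T passes to the upper limit along any nontrivial filter tending to
infinity, since the early-time error is O(1/T). The filter `atTop` gives the first assertion of the
theorem, the integers the second. -/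
theorem Transport.filterMean_hess_le {Λ H δ : ℝ} {ζ f : ℝ → Space n → ℝ}
    {u : ℝ → Space n → Space n} (h : Transport Λ H δ ζ f u) {F : Filter ℝ} [F.NeBot]
    (hF : F ≤ atTop) {r : ℝ} (hr : 1 ≤ r) (hr2 : r < 2)
    (h1 : ProductDefined (filterMean F Λ (-(2 * δ)) (2 * δ) fun t x => jacNorm (u t) x ^ 2)
      (filterMean F Λ (-H) H fun t x => |ζ t x| ^ (2 * r / (2 - r))))
    (h2 : ProductDefined (filterMean F Λ (-H) H fun t x => jacNorm (u t) x ^ 4)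
      (filterMean F Λ (-H) H fun t x => gradNorm (ζ t) x ^ (4 * r / (4 - r)))) (M N : ℕ) :
    filterMean F Λ (-H) H (fun t x => hessNorm (ζ t) x ^ r) ^ (1 / r) ≤
      regularityConst n * rightHandSide (filterMean F Λ) H δ r M N ζ u f := by
  have hr0 : 0 < r := by linarith
  obtain ⟨K, hK0, hK⟩ := h.sliceMean_hess_le_rightHandSide hr hr2
  have hzero : Tendsto (fun T : ℝ => ENNReal.ofReal (K / T) ^ (1 / r)) F (nhds 0) := by
    have e1 : Tendsto (fun T : ℝ => K / T) F (nhds 0) := (tendsto_id.mono_left hF).const_div_atTop K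
    have e2 := (ENNReal.continuous_rpow_const (y := 1 / r)).tendsto (ENNReal.ofReal 0)
    have e3 := e2.comp ((ENNReal.continuous_ofReal.tendsto 0).comp e1)
    simpa [ENNReal.zero_rpow_of_pos (inv_pos.2 hr0)] using! e3
  rw [filterMean, ← limsup_rpow _ (by positivity)]
  calc _ ≤ limsup (fun T => ENNReal.ofReal (K / T) ^ (1 / r) +
        regularityConst n * rightHandSide (sliceMean Λ T) H δ r M N ζ u f) F := by
        refine limsup_le_limsup ?_
        filter_upwards [hF (eventually_gt_atTop 2)] with T hT
        exact hK T hT M N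
    _ ≤ _ := by
        refine (limsup_add_le_add _ _).trans ?_
        rw [hzero.limsup_eq, zero_add,
          ENNReal.limsup_const_mul_of_ne_top (regularityConst_ne_top n)]
        exact mul_le_mul' le_rfl (limsup_rightHandSide_le hr hr2 h1 h2 M N)

section averages

variable {Λ T a b K : ℝ} {g : ℝ → Space n → ℝ}

/-- Nothing is known about g at negative times, so measurability is assumed only after the
substitution of t² for t; on (0,T] this is undone by the square root. -/
theorem measurable_partialMean (hg : Measurable fun p : ℝ × Space n => g (p.1 ^ 2) p.2) :
    Measurable (partialMean Λ T g) := by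
  have hG : Measurable fun p : ℝ × Space n => ENNReal.ofReal (g (Real.sqrt p.1 ^ 2) p.2) :=
    (hg.comp (by fun_prop : Measurable fun p : ℝ × Space n => (Real.sqrt p.1, p.2))).ennreal_ofReal
  have h1 : partialMean Λ T g = fun z => (ENNReal.ofReal T)⁻¹ * ∫⁻ t in Ioc 0 T,
      (ENNReal.ofReal (Λ ^ n))⁻¹ * ∫⁻ y in box n Λ,
        ENNReal.ofReal (g (Real.sqrt t ^ 2) (point y z)) := by
    funext z
    unfold partialMean
    congr 1
    refine setLIntegral_congr_fun measurableSet_Ioc fun t ht => ?_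
    simp only [Real.sq_sqrt ht.1.le]
    rfl
  rw [h1]
  exact (Measurable.lintegral_prod_right' (ν := volume.restrict (Ioc 0 T))
    (measurable_sliceMean_inner hG _)).const_mul _

theorem partialMean_le (hΛ : 0 < Λ) (hT : 0 < T) (hg : ∀ t, 0 ≤ t → ∀ x, g t x ≤ K) (z : ℝ) :
    partialMean Λ T g z ≤ ENNReal.ofReal K := by
  have h1 : ENNReal.ofReal T ≠ 0 := by simpa using hT
  have h2 : ENNReal.ofReal (Λ ^ n) ≠ 0 := by simpa using pow_pos hΛ n
  calc partialMean Λ T g z ≤ (ENNReal.ofReal T)⁻¹ * ∫⁻ t in Ioc 0 T,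
        (ENNReal.ofReal (Λ ^ n))⁻¹ * ∫⁻ y in box n Λ, ENNReal.ofReal K :=
        mul_le_mul' le_rfl (setLIntegral_mono' measurableSet_Ioc fun t ht =>
          mul_le_mul' le_rfl (lintegral_mono fun y => ENNReal.ofReal_le_ofReal (hg t ht.1.le _)))
    _ = ENNReal.ofReal K := by
        simp only [setLIntegral_const, volume_box hΛ, Real.volume_Ioc, sub_zero]
        rw [mul_left_comm (ENNReal.ofReal (Λ ^ n))⁻¹,
          ENNReal.inv_mul_cancel h2 ENNReal.ofReal_ne_top, mul_one, mul_left_comm,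
          ENNReal.inv_mul_cancel h1 ENNReal.ofReal_ne_top, mul_one]

/-- The filter generated by the sequence of positive integers. -/
def seqFilter : Filter ℝ := map (fun k : ℕ => (k : ℝ) + 1) atTop

instance : seqFilter.NeBot := by unfold seqFilter; infer_instance

theorem seqFilter_le : seqFilter ≤ atTop :=
  tendsto_atTop_add_const_right _ _ tendsto_natCast_atTop_atTop

theorem filterMean_seqFilter (g : ℝ → Space n → ℝ) : filterMean seqFilter Λ a b g =
    limsup (fun k : ℕ => ∫⁻ z in Icc a b, partialMean Λ ((k : ℝ) + 1) g z) atTop := by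
  rw [filterMean, seqFilter, ← limsup_comp]
  rfl

/-- The reverse Fatou lemma, with the constant K as integrable majorant on [a,b]. It is stated for
sequences, which is the reason for restricting T to integers; the upper limit along them does not
exceed the one over all real times. -/
theorem filterMean_le_iteratedMean (hΛ : 0 < Λ)
    (hm : Measurable fun p : ℝ × Space n => g (p.1 ^ 2) p.2)
    (hg : ∀ t, 0 ≤ t → ∀ x, g t x ≤ K) :
    filterMean seqFilter Λ a b g ≤ iteratedMean Λ a b g := by
  rw [filterMean_seqFilter]
  refine (limsup_lintegral_le (fun _ => ENNReal.ofReal K)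
    (fun k => measurable_partialMean hm) (fun k => Eventually.of_forall fun z =>
      partialMean_le hΛ (by positivity) hg z) (by simp [ENNReal.mul_eq_top])).trans ?_
  refine lintegral_mono fun z => ?_
  have : limsup (fun k : ℕ => partialMean Λ ((k : ℝ) + 1) g z) atTop =
      limsup (fun T => partialMean Λ T g z) seqFilter := by
    rw [seqFilter, ← limsup_comp]; rfl
  rw [this]
  exact limsup_le_limsup_of_le seqFilter_le

theorem filterMean_ne_top (hΛ : 0 < Λ) (hg : ∀ t, 0 ≤ t → ∀ x, g t x ≤ K) :
    filterMean seqFilter Λ a b g ≠ ⊤ := by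
  have h1 : filterMean seqFilter Λ a b g ≤ ENNReal.ofReal K * ENNReal.ofReal (b - a) := by
    rw [filterMean_seqFilter]
    refine limsup_le_of_le (h := Eventually.of_forall fun k => ?_)
    refine (lintegral_mono fun z => partialMean_le hΛ (by positivity) hg z).trans ?_
    rw [setLIntegral_const, Real.volume_Icc]
  exact (h1.trans_lt (by finiteness)).ne

/-- Fatou's lemma bounds the integral of the lower limit. Existence of the limit at almost every
height is what identifies the lower limit with the upper limit in `longTimeMean`. -/
theorem iteratedMean_le_filterMean (hm : Measurable fun p : ℝ × Space n => g (p.1 ^ 2) p.2)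
    (hlim : ∀ᵐ z ∂volume.restrict (Icc a b),
      Tendsto (fun T => partialMean Λ T g z) atTop (nhds (longTimeMean Λ g z))) :
    iteratedMean Λ a b g ≤ filterMean seqFilter Λ a b g := by
  rw [filterMean_seqFilter]
  calc iteratedMean Λ a b g = ∫⁻ z in Icc a b,
        liminf (fun k : ℕ => partialMean Λ ((k : ℝ) + 1) g z) atTop := by
        refine lintegral_congr_ae ?_
        filter_upwards [hlim] with z hz
        exact (hz.comp seqFilter_le).liminf_eq.symm
    _ ≤ liminf (fun k : ℕ => ∫⁻ z in Icc a b, partialMean Λ ((k : ℝ) + 1) g z) atTop :=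
        lintegral_liminf_le fun k => measurable_partialMean hm
    _ ≤ _ := liminf_le_limsup

end averages

theorem Tame.measurable_gradNorm_sq {per : Fin (n + 1) → ℝ} {g : ℝ → Space n → ℝ}
    (hg : Tame per (retime (fun t => t ^ 2) g)) :
    Measurable fun p : ℝ × Space n => gradNorm (g (p.1 ^ 2)) p.2 := by
  have h1 : ∀ i, Measurable fun p : ℝ × Space n => pd i (g (p.1 ^ 2)) p.2 := fun i => by
    have := (hg.dir (sp i)).continuous.measurable
    convert this using 2 with p
    exact (hg.dir_sp_eq_pd i p.1 p.2).symm
  unfold gradNorm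
  fun_prop

namespace Transport

variable {Λ H δ : ℝ} {ζ f : ℝ → Space n → ℝ} {u : ℝ → Space n → Space n}
variable (h : Transport Λ H δ ζ f u)
include h

theorem measurable_hessNorm_sq :
    Measurable fun p : ℝ × Space n => hessNorm (ζ (p.1 ^ 2)) p.2 := by
  have hg := h.tame_sol (θ := fun t => t ^ 2) (by fun_prop) fun t => sq_nonneg t
  have h1 : ∀ i j, Measurable fun p : ℝ × Space n => pd i (pd j (ζ (p.1 ^ 2))) p.2 := fun i j => by
    have := ((hg.dir (sp j)).dir (sp i)).continuous.measurable
    convert this using 2 with p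
    exact (hg.dir_dir_sp_eq_pd i j p.1 p.2).symm
  unfold hessNorm
  fun_prop

theorem measurable_jacNorm_sq :
    Measurable fun p : ℝ × Space n => jacNorm (u (p.1 ^ 2)) p.2 := by
  have hg := fun i => h.tame_vel (θ := fun t => t ^ 2) (by fun_prop) (fun t => sq_nonneg t) i
  have h1 : ∀ i j, Measurable fun p : ℝ × Space n => pd j (fun x => u (p.1 ^ 2) x i) p.2 :=
    fun i j => by
      have := ((hg i).dir (sp j)).continuous.measurable
      convert this using 2 with p
      exact ((hg i).dir_sp_eq_pd j p.1 p.2).symm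
  unfold jacNorm
  fun_prop

/-- The maximal regularity estimate with the upper limits taken at each height. -/
theorem iteratedMean_hess_le {K : ℝ} (hK : ∀ t : ℝ, 0 ≤ t → ∀ x : Space n,
      |ζ t x| ≤ K ∧ gradNorm (ζ t) x ≤ K ∧ jacNorm (u t) x ≤ K ∧
        |f t x| ≤ K ∧ gradNorm (f t) x ≤ K) {r : ℝ} (hr : 1 ≤ r) (hr2 : r < 2)
    (hlim : ∀ᵐ z ∂volume.restrict (Icc (-H) H), Tendsto
      (fun T => partialMean Λ T (fun t x => hessNorm (ζ t) x ^ r) z) atTop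
      (nhds (longTimeMean Λ (fun t x => hessNorm (ζ t) x ^ r) z))) (M N : ℕ) :
    iteratedMean Λ (-H) H (fun t x => hessNorm (ζ t) x ^ r) ^ (1 / r) ≤
      regularityConst n * rightHandSide (iteratedMean Λ) H δ r M N ζ u f := by
  obtain ⟨hq2, -, hq4, -⟩ := exponent_facts hr hr2
  have hr0 : 0 < r := by linarith
  have hq1 : 0 ≤ (2 - r) / (2 * r) := div_nonneg (by linarith) (by linarith)
  have hq3 : 0 ≤ (4 - r) / (4 * r) := div_nonneg (by linarith) (by linarith)
  have hΛ := h.length_pos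
  have mζ := (h.tame_sol (θ := fun t => t ^ 2) (by fun_prop) fun t => sq_nonneg t)
  have mf := (h.tame_force (θ := fun t => t ^ 2) (by fun_prop) fun t => sq_nonneg t)
  have mζ' : Measurable fun p : ℝ × Space n => ζ (p.1 ^ 2) p.2 := mζ.continuous.measurable
  have mf' : Measurable fun p : ℝ × Space n => f (p.1 ^ 2) p.2 := mf.continuous.measurable
  have mgζ := mζ.measurable_gradNorm_sq
  have mgf := mf.measurable_gradNorm_sq
  have mu := h.measurable_jacNorm_sq
  have mh := h.measurable_hessNorm_sq
  have b1 : ∀ t, 0 ≤ t → ∀ x, |f t x| ^ r ≤ K ^ r := fun t ht x =>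
    Real.rpow_le_rpow (abs_nonneg _) (hK t ht x).2.2.2.1 hr0.le
  have b2 : ∀ t, 0 ≤ t → ∀ x, gradNorm (f t) x ^ r ≤ K ^ r := fun t ht x =>
    Real.rpow_le_rpow (gradNorm_nonneg _ _) (hK t ht x).2.2.2.2 hr0.le
  have b3 : ∀ t, 0 ≤ t → ∀ x, ζ t x ^ 2 ≤ K ^ 2 := fun t ht x => by
    rw [← sq_abs]; exact pow_le_pow_left₀ (abs_nonneg _) (hK t ht x).1 2
  have b4 : ∀ t, 0 ≤ t → ∀ x, jacNorm (u t) x ^ 2 ≤ K ^ 2 := fun t ht x =>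
    pow_le_pow_left₀ (jacNorm_nonneg _ _) (hK t ht x).2.2.1 2
  have b5 : ∀ t, 0 ≤ t → ∀ x, |ζ t x| ^ (2 * r / (2 - r)) ≤ K ^ (2 * r / (2 - r)) := fun t ht x =>
    Real.rpow_le_rpow (abs_nonneg _) (hK t ht x).1 (by linarith)
  have b6 : ∀ t, 0 ≤ t → ∀ x, jacNorm (u t) x ^ 4 ≤ K ^ 4 := fun t ht x =>
    pow_le_pow_left₀ (jacNorm_nonneg _ _) (hK t ht x).2.2.1 4
  have b7 : ∀ t, 0 ≤ t → ∀ x, gradNorm (ζ t) x ^ (4 * r / (4 - r)) ≤ K ^ (4 * r / (4 - r)) :=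
    fun t ht x => Real.rpow_le_rpow (gradNorm_nonneg _ _) (hK t ht x).2.1 (by linarith)
  -- All averages are finite for bounded data, so both products are automatically well defined.
  have main := h.filterMean_hess_le seqFilter_le hr hr2
    ⟨Or.inr (filterMean_ne_top hΛ b5), Or.inl (filterMean_ne_top hΛ b4)⟩
    ⟨Or.inr (filterMean_ne_top hΛ b7), Or.inl (filterMean_ne_top hΛ b6)⟩ M N
  refine (ENNReal.rpow_le_rpow (iteratedMean_le_filterMean (mh.pow_const r) hlim)
    (by positivity)).trans (main.trans (mul_le_mul' le_rfl ?_))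
  unfold rightHandSide
  gcongr
  · exact filterMean_le_iteratedMean hΛ (mf'.norm.pow_const r) b1
  · exact filterMean_le_iteratedMean hΛ (by fun_prop) b2
  · exact filterMean_le_iteratedMean hΛ (mζ'.pow_const 2) b3
  · exact filterMean_le_iteratedMean hΛ (by fun_prop) b4
  · exact filterMean_le_iteratedMean hΛ (mζ'.norm.pow_const _) b5
  · exact filterMean_le_iteratedMean hΛ (by fun_prop) b6
  · exact filterMean_le_iteratedMean hΛ (by fun_prop) b7

end Transport

end ConvDiff

/-! ### The theorem. -/

theorem mainTheorem5 (n : ℕ) :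
    ∃ C : ℝ, 0 < C ∧
      ∀ (Λ H δ r : ℝ) (ζ : ℝ → ConvDiff.Space n → ℝ)
        (u : ℝ → ConvDiff.Space n → ConvDiff.Space n) (f : ℝ → ConvDiff.Space n → ℝ),
        0 < Λ → 0 < δ → δ ≤ H → 1 ≤ r → r < 2 →
        ConvDiff.IsSmooth ζ → ConvDiff.IsSmooth u → ConvDiff.IsSmooth f →
        ConvDiff.IsPeriodic Λ H ζ → ConvDiff.IsPeriodic Λ H u → ConvDiff.IsPeriodic Λ H f →
        -- the convection-diffusion equation
        (∀ t : ℝ, 0 < t → ∀ x : ConvDiff.Space n,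
          deriv (fun s => ζ s x) t + ∑ i, u t x i * ConvDiff.pd i (ζ t) x
            - ConvDiff.laplace (ζ t) x = f t x) →
        (∀ t : ℝ, 0 ≤ t → ∀ x : ConvDiff.Space n, ConvDiff.divergence (u t) x = 0) →
        (∀ t : ℝ, 0 ≤ t → ∀ x : ConvDiff.Space n, ConvDiff.height x = 0 → u t x = 0) →
        -- the vertical support condition, on one period
        (∀ t : ℝ, 0 ≤ t → ∀ x : ConvDiff.Space n,
          |ConvDiff.height x| ≤ H → ζ t x ≠ 0 → |ConvDiff.height x| ≤ δ) →
        -- the estimate for space-time averages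
        (ConvDiff.ProductDefined
            (ConvDiff.layerMean Λ (-(2 * δ)) (2 * δ) (fun t x => ConvDiff.jacNorm (u t) x ^ 2))
            (ConvDiff.layerMean Λ (-H) H (fun t x => |ζ t x| ^ (2 * r / (2 - r)))) →
          ConvDiff.ProductDefined
            (ConvDiff.layerMean Λ (-H) H (fun t x => ConvDiff.jacNorm (u t) x ^ 4))
            (ConvDiff.layerMean Λ (-H) H
              (fun t x => ConvDiff.gradNorm (ζ t) x ^ (4 * r / (4 - r)))) →
          ∀ M N : ℕ,
            (ConvDiff.layerMean Λ (-H) H (fun t x => ConvDiff.hessNorm (ζ t) x ^ r)) ^ (1 / r)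
              ≤ ENNReal.ofReal C *
                ConvDiff.rightHandSide (ConvDiff.layerMean Λ) H δ r M N ζ u f) ∧
        -- the same estimate with the upper limit in time taken at each height
        ((∃ K : ℝ, ∀ t : ℝ, 0 ≤ t → ∀ x : ConvDiff.Space n,
            |ζ t x| ≤ K ∧ ConvDiff.gradNorm (ζ t) x ≤ K ∧ ConvDiff.jacNorm (u t) x ≤ K ∧
              |f t x| ≤ K ∧ ConvDiff.gradNorm (f t) x ≤ K) →
          (∀ᵐ z ∂(MeasureTheory.volume.restrict (Set.Icc (-H) H)),
            Filter.Tendsto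
              (fun t₀ : ℝ =>
                ConvDiff.partialMean Λ t₀ (fun t x => ConvDiff.hessNorm (ζ t) x ^ r) z)
              Filter.atTop
              (nhds (ConvDiff.longTimeMean Λ (fun t x => ConvDiff.hessNorm (ζ t) x ^ r) z))) →
          ∀ M N : ℕ,
            (ConvDiff.iteratedMean Λ (-H) H (fun t x => ConvDiff.hessNorm (ζ t) x ^ r)) ^ (1 / r)
              ≤ ENNReal.ofReal C *
                ConvDiff.rightHandSide (ConvDiff.iteratedMean Λ) H δ r M N ζ u f) := by
  have hC : ConvDiff.regularityConst n ≤
      ENNReal.ofReal ((ConvDiff.regularityConst n).toReal + 1) := by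
    rw [ENNReal.ofReal_add ENNReal.toReal_nonneg zero_le_one,
      ENNReal.ofReal_toReal (ConvDiff.regularityConst_ne_top n)]
    exact le_self_add
  refine ⟨(ConvDiff.regularityConst n).toReal + 1, by positivity, ?_⟩
  intro Λ H δ r ζ u f hΛ hδ hδH hr hr2 sζ su sf pζ pu pf heq hdiv hu hsupp
  have h : ConvDiff.Transport Λ H δ ζ f u :=
    ⟨hΛ, hδ, hδH, sζ, su, sf, pζ, pu, pf, heq, hdiv, hu, hsupp⟩
  refine ⟨fun h1 h2 M N => ?_, fun ⟨K, hK⟩ hlim M N => ?_⟩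
  -- Along the filter `atTop` the mean `filterMean` is `layerMean` by definition.
  · exact (h.filterMean_hess_le le_rfl hr hr2 h1 h2 M N).trans (mul_le_mul' hC le_rfl)
  · exact (h.iteratedMean_hess_le hK hr hr2 hlim M N).trans (mul_le_mul' hC le_rfl)
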